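/- Let $\kappa$ be an uncountable regular cardinal with $2^{\mu}\le\kappa$ for every cardinal $\mu<\kappa$ (as is the case under GCH). Let $\mathbb P_\kappa$ be the mangrove forcing at $\kappa$, let $G$ be $\mathbb P_\kappa$-generic over $V$, and let $M^G=\langle\mathcal S^G,\prec^G,\pi^G\rangle$ be the direct limit of the conditions in $G$: $\mathcal S^G=\bigcup_{p\in G}\mathcal S^p$; $x\prec^G y$ iff $x\prec^p y$ for some $p\in G$; and then $\pi^G_{xy}=\pi^p_{xy}$. Then, in $V[G]$, $M^G$ is a $\kappa$-mangrove. (Equivalently: this statement about the canonical names of $\kappa,\mathcal S^G,\prec^G,\pi^G$ is forced by the largest condition of $\mathbb P_\kappa$.) The notions used are the following. A node is a pair $x=\langle l(x),o(x)\rangle$ of ordinals (level and order). A tree order is a strict partial order in which the predecessors of each element are well-ordered. A function $\pi$ from an ordinal to an ordinal is SLOOP if $\pi(0)=0$, $\pi(\gamma+1)=\pi(\gamma)+1$ whenever $\gamma+1$ is in the domain, $\pi$ maps (nonzero) limits to limits, and $\pi$ is strictly increasing. Here $A$ is unbounded in $\delta$ if every $\varepsilon<\delta$ has some $\alpha\in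 A$ with $\varepsilon<\alpha<\delta$, and $A$ is closed in $\delta$ if it contains each limit ordinal $\gamma<\delta$ in which it is unbounded. A $(\kappa,1)$-morass, for $\kappa$ an uncountable regular cardinal, consists of a set of nodes $\mathcal S\subseteq(\kappa\times\kappa)\cup(\{\kappa\}\times\kappa^+)$, a tree order $\prec$ on $\mathcal S$, and a function $\pi_{xy}:o(x)+1\to o(y)+1$ for all $x\prec y$ in $\mathcal S$, such that: - Left-alignment: $\theta_\alpha=\{\beta\mid\langle\alpha,\beta\rangle\in\mathcal S\}$ is an ordinal for each $\alpha\le\kappa$, with $\theta_\kappa=\kappa^+$ and $0<\theta_\alpha<\kappa$ for $\alpha<\kappa$. - Monotonicity: $x\prec y$ implies $l(x)<l(y)$. - Commutativity: $x\prec y\prec z$ implies $\pi_{yz}\circ\pi_{xy}=\pi_{xz}$. - M.1: if $x\prec y$ then $\pi_{xy}$ is SLOOP and $\pi_{xy}(o(x))=o(y)$. - M.2: if $x\prec y$, $\nu<o(x)$, $w=\langle l(x),\nu\rangle$ and $z=\langle l(y),\pi_{xy}(\nu)\rangle$, then $w\prec z$ and $\pi_{wz}=\pi_{xy}\restriction(\nu+1)$.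 - M.3: for $y\in\mathcal S$, $\{l(x)\mid x\prec y\}$ is closed in $l(y)$. - M.4: for $y\in\mathcal S$, if $o(y)+1\ne\theta_{l(y)}$ then $\{l(x)\mid x\prec y\}$ is unbounded in $l(y)$. - M.5: for $y\in\mathcal S$, if $\{l(x)\mid x\prec y\}$ is unbounded in $l(y)$ then $o(y)=\bigcup\{\pi_{xy}[o(x)]\mid x\prec y\}$. - M.6: if $x\prec y$, $o(x)$ is a limit, $\nu=\sup\pi_{xy}[o(x)]$ and $z=\langle l(y),\nu\rangle$, then $x\prec z$ and $\pi_{xz}\restriction o(x)=\pi_{xy}\restriction o(x)$. - M.7: if $x\prec y$, $l(x)<\alpha<l(y)$, $o(x)$ is a limit, $o(y)=\sup\pi_{xy}[o(x)]$, and for every $\nu<o(x)$ there is $\gamma$ with $\langle\alpha,\gamma\rangle\prec\langle l(y),\pi_{xy}(\nu)\rangle$, then there is $\gamma$ with $\langle\alpha,\gamma\rangle\prec y$. An ordinal $\alpha$ is a mangal of such a structure if for all $x\prec y$ with $l(x)<\alpha<l(y)$ there is $z\in\mathcal S$ with $l(z)=\alpha$ and $x\prec z\prec y$. A $\kappa$-mangrove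 is a $(\kappa,1)$-morass whose mangals $\alpha<\kappa$ are cofinal in $\kappa$. A $(\kappa,1)$-morass condition $p$ consists of an ordinal $\lambda<\kappa$, a set of nodes $\mathcal S\subseteq((\lambda+1)\times\kappa)\cup(\{\kappa\}\times\kappa^+)$, a tree order $\prec$ on $\mathcal S$, and functions $\pi_{xy}:o(x)+1\to o(y)+1$ for $x\prec y$, such that: for each $\alpha\le\lambda$, $\theta_\alpha$ is an ordinal with $0<\theta_\alpha<\kappa$; the set $S=\{\beta\mid\langle\kappa,\beta\rangle\in\mathcal S\}$ contains $0$ and is closed under ordinal successors and predecessors; $\mathrm{ot}(S)\le\theta_\lambda$ and $\langle\lambda,\nu\rangle\prec\langle\kappa,f(\nu)\rangle$ for all $\nu<\mathrm{ot}(S)$, where $f:\mathrm{ot}(S)\to S$ is the order isomorphism; Monotonicity, Commutativity, M.1, M.2, M.3 and M.5 hold; M.4 holds for those $y$ with $l(y)\le\lambda$; and M.6 and M.7 hold for those $x,y$ such that $y$ is an immediate $\prec$-successor of $x$ and $l(y)\le\lambda$. $\mathbb P_\kappa$ is the set of $(\kappa,1)$-morass conditions together with an extra largest element, where for conditions $p,q$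 we put $q\le p$ iff $\mathcal S^p\subseteq\mathcal S^q$, $\mathcal S^p$ and $\mathcal S^q$ have the same elements in $(\lambda^p+1)\times\kappa$, $\prec^p$ is the restriction of $\prec^q$ to $\mathcal S^p$, $\pi^p_{xy}=\pi^q_{xy}$ whenever $x\prec^p y$, and $\lambda^p\le\lambda^q$ is a mangal of $q$. -/

import Mathlib

universe u v w

/-! ## The language of set theory -/

/-- Formulas of the language `{∈, =}` of set theory, with parameters from `U`; a quantifier binds a
variable ranging over `U`. Primitive symbols: `∈`, `=`, `¬`, `∧`, `∀`. -/
inductive SetFormula (U : Type v) : Type v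
  | mem (x y : U) : SetFormula U
  | eq (x y : U) : SetFormula U
  | neg (φ : SetFormula U) : SetFormula U
  | and (φ ψ : SetFormula U) : SetFormula U
  | all (φ : U → SetFormula U) : SetFormula U

namespace SetFormula

variable {U : Type v}

def or (φ ψ : SetFormula U) : SetFormula U := neg (and (neg φ) (neg ψ))
def imp (φ ψ : SetFormula U) : SetFormula U := neg (and φ (neg ψ))
def iff (φ ψ : SetFormula U) : SetFormula U := and (imp φ ψ) (imp ψ φ)
def ex (φ : U → SetFormula U) : SetFormula U := neg (all fun x => neg (φ x))

end SetFormula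

infix:70 " ∈ₛ " => SetFormula.mem
infix:70 " =ₛ " => SetFormula.eq
prefix:max "¬ₛ " => SetFormula.neg
infixr:55 " ∧ₛ " => SetFormula.and
infixr:50 " ∨ₛ " => SetFormula.or
infixr:45 " →ₛ " => SetFormula.imp
infix:40 " ↔ₛ " => SetFormula.iff
notation:max "∀ₛ " x ", " φ:35 => SetFormula.all (fun x => φ)
notation:max "∃ₛ " x ", " φ:35 => SetFormula.ex (fun x => φ)

namespace SetFormula

variable {U : Type v}

/-- `w = {x, y}`. -/
def isUPair (w x y : U) : SetFormula U := ∀ₛ v, v ∈ₛ w ↔ₛ v =ₛ x ∨ₛ v =ₛ y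

/-- `z = ⟨x, y⟩ = {{x}, {x, y}}`. -/
def isPair (z x y : U) : SetFormula U := ∀ₛ w, w ∈ₛ z ↔ₛ isUPair w x x ∨ₛ isUPair w x y

/-- `⟨x, y⟩ ∈ r`. -/
def pairMem (x y r : U) : SetFormula U := ∃ₛ z, isPair z x y ∧ₛ z ∈ₛ r

/-- `x` is a transitive set. -/
def isTrans (x : U) : SetFormula U := ∀ₛ y, y ∈ₛ x →ₛ ∀ₛ z, z ∈ₛ y →ₛ z ∈ₛ x

/-- `x` is an ordinal: a transitive set of transitive sets. -/
def isOrd (x : U) : SetFormula U := isTrans x ∧ₛ ∀ₛ y, y ∈ₛ x →ₛ isTrans y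

/-- `x = 0`. -/
def isZero (x : U) : SetFormula U := ∀ₛ y, ¬ₛ (y ∈ₛ x)

/-- `y = x + 1 = x ∪ {x}`. -/
def isSucc (y x : U) : SetFormula U := ∀ₛ z, z ∈ₛ y ↔ₛ z ∈ₛ x ∨ₛ z =ₛ x

/-- `x` is a (nonzero) limit ordinal. -/
def isLimit (x : U) : SetFormula U :=
  isOrd x ∧ₛ (∃ₛ y, y ∈ₛ x) ∧ₛ ∀ₛ y, y ∈ₛ x →ₛ ∃ₛ z, z ∈ₛ x ∧ₛ y ∈ₛ z

/-- `f` is a function from `a` to `b`. -/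
def isFun (f a b : U) : SetFormula U :=
  (∀ₛ z, z ∈ₛ f →ₛ ∃ₛ x, ∃ₛ y, x ∈ₛ a ∧ₛ y ∈ₛ b ∧ₛ isPair z x y) ∧ₛ
  (∀ₛ x, x ∈ₛ a →ₛ ∃ₛ y, pairMem x y f) ∧ₛ
  (∀ₛ x, ∀ₛ y, ∀ₛ y', pairMem x y f →ₛ pairMem x y' f →ₛ y =ₛ y')

/-- `k` is a cardinal: an ordinal that is not a surjective image of a smaller ordinal. -/
def isCardinal (k : U) : SetFormula U :=
  isOrd k ∧ₛ ∀ₛ a, a ∈ₛ k →ₛ ∀ₛ f, isFun f a k →ₛ ∃ₛ b, b ∈ₛ k ∧ₛ ∀ₛ c, ¬ₛ (pairMem c b f)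

/-- `m` is the least cardinal greater than `k`. -/
def isSuccCardinal (m k : U) : SetFormula U :=
  isCardinal m ∧ₛ k ∈ₛ m ∧ₛ ∀ₛ n, n ∈ₛ m →ₛ k ∈ₛ n →ₛ ¬ₛ (isCardinal n)

/-- `k` is an uncountable regular cardinal: an ordinal above the first limit ordinal such that
every function from a smaller ordinal to `k` is bounded in `k`. -/
def isUncountableRegular (k : U) : SetFormula U :=
  isCardinal k ∧ₛ (∃ₛ w, w ∈ₛ k ∧ₛ isLimit w) ∧ₛ
  ∀ₛ a, a ∈ₛ k →ₛ ∀ₛ f, isFun f a k →ₛ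
    ∃ₛ b, b ∈ₛ k ∧ₛ ∀ₛ c, ∀ₛ d, pairMem c d f →ₛ d ∈ₛ b

/-! ### Morasses and mangroves

In the formulas below `S` is the set of nodes, `R` the tree order (a set of pairs of nodes) and `p`
the family of maps (a function with domain `R`). A node is an ordered pair of ordinals, the first
being its level and the second its order. -/

/-- `f = π_{xy}`, that is, `⟨⟨x, y⟩, f⟩ ∈ p`. -/
def isMap (p x y f : U) : SetFormula U := ∃ₛ z, isPair z x y ∧ₛ pairMem z f p

/-- `a ∈ {l(x) | x ≺ y}`. -/
def levelBelow (R y a : U) : SetFormula U := ∃ₛ x, ∃ₛ b, isPair x a b ∧ₛ pairMem x y R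

/-- `{l(x) | x ≺ y}` is unbounded in `c`. -/
def levelsUnbounded (R y c : U) : SetFormula U :=
  ∀ₛ e, e ∈ₛ c →ₛ ∃ₛ a, a ∈ₛ c ∧ₛ e ∈ₛ a ∧ₛ levelBelow R y a

/-- `{l(x) | x ≺ y}` is closed in `c`. -/
def levelsClosed (R y c : U) : SetFormula U :=
  ∀ₛ d, d ∈ₛ c →ₛ isLimit d →ₛ
    (∀ₛ e, e ∈ₛ d →ₛ ∃ₛ a, a ∈ₛ d ∧ₛ e ∈ₛ a ∧ₛ levelBelow R y a) →ₛ levelBelow R y d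

/-- `t = θ_a = {b | ⟨a, b⟩ ∈ S}`. -/
def isTheta (S a t : U) : SetFormula U := ∀ₛ b, b ∈ₛ t ↔ₛ pairMem a b S

/-- `s = sup (f '' b)`, for `f` with ordinal values. -/
def isSupImage (s f b : U) : SetFormula U :=
  ∀ₛ h, h ∈ₛ s ↔ₛ ∃ₛ g, ∃ₛ d, g ∈ₛ b ∧ₛ pairMem g d f ∧ₛ h ∈ₛ d

/-- `f`, with domain the ordinal `b + 1`, preserves successors, limits, zero and order. -/
def isSLOOP (f b : U) : SetFormula U :=
  (∀ₛ g, ∀ₛ g', ∀ₛ d, g ∈ₛ b →ₛ isSucc g' g →ₛ pairMem g d f →ₛ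
    ∃ₛ d', isSucc d' d ∧ₛ pairMem g' d' f) ∧ₛ
  (∀ₛ g, ∀ₛ d, isLimit g →ₛ pairMem g d f →ₛ isLimit d) ∧ₛ
  (∀ₛ g, ∀ₛ d, isZero g →ₛ pairMem g d f →ₛ isZero d) ∧ₛ
  (∀ₛ g, ∀ₛ g', ∀ₛ d, ∀ₛ d', g ∈ₛ g' →ₛ pairMem g d f →ₛ pairMem g' d' f →ₛ d ∈ₛ d')

/-- `S ⊆ (k × k) ∪ ({k} × m)`. -/
def nodesBounded (k m S : U) : SetFormula U :=
  ∀ₛ x, x ∈ₛ S →ₛ ∃ₛ a, ∃ₛ b, isPair x a b ∧ₛ ((a ∈ₛ k ∧ₛ b ∈ₛ k) ∨ₛ (a =ₛ k ∧ₛ b ∈ₛ m))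

/-- `R` is a tree order on `S`: a strict partial order such that the predecessors of each node are
well-ordered. -/
def isTreeOrder (S R : U) : SetFormula U :=
  (∀ₛ z, z ∈ₛ R →ₛ ∃ₛ x, ∃ₛ y, x ∈ₛ S ∧ₛ y ∈ₛ S ∧ₛ isPair z x y) ∧ₛ
  (∀ₛ x, ¬ₛ (pairMem x x R)) ∧ₛ
  (∀ₛ x, ∀ₛ y, ∀ₛ z, pairMem x y R →ₛ pairMem y z R →ₛ pairMem x z R) ∧ₛ
  (∀ₛ y, ∀ₛ A, (∃ₛ x, x ∈ₛ A) →ₛ (∀ₛ x, x ∈ₛ A →ₛ pairMem x y R) →ₛ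
    ∃ₛ n, n ∈ₛ A ∧ₛ ∀ₛ x, x ∈ₛ A →ₛ x =ₛ n ∨ₛ pairMem n x R)

/-- `p` is a function with domain `R`, and `π_{xy} : o(x) + 1 → o(y) + 1` for `x ≺ y`. -/
def isMapFamily (R p : U) : SetFormula U :=
  (∀ₛ s, s ∈ₛ p →ₛ ∃ₛ z, ∃ₛ f, z ∈ₛ R ∧ₛ isPair s z f) ∧ₛ
  (∀ₛ z, z ∈ₛ R →ₛ ∃ₛ f, pairMem z f p) ∧ₛ
  (∀ₛ z, ∀ₛ f, ∀ₛ f', pairMem z f p →ₛ pairMem z f' p →ₛ f =ₛ f') ∧ₛ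
  (∀ₛ x, ∀ₛ y, ∀ₛ a, ∀ₛ b, ∀ₛ c, ∀ₛ d, ∀ₛ f,
    isPair x a b →ₛ isPair y c d →ₛ pairMem x y R →ₛ isMap p x y f →ₛ
    ∃ₛ b', ∃ₛ d', isSucc b' b ∧ₛ isSucc d' d ∧ₛ isFun f b' d')

def leftAlignment (k m S : U) : SetFormula U :=
  isTheta S k m ∧ₛ ∀ₛ a, a ∈ₛ k →ₛ ∃ₛ t, isTheta S a t ∧ₛ isOrd t ∧ₛ ¬ₛ (isZero t) ∧ₛ t ∈ₛ k

def monotonicity (R : U) : SetFormula U :=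
  ∀ₛ x, ∀ₛ y, ∀ₛ a, ∀ₛ b, ∀ₛ c, ∀ₛ d,
    isPair x a b →ₛ isPair y c d →ₛ pairMem x y R →ₛ a ∈ₛ c

def commutativity (R p : U) : SetFormula U :=
  ∀ₛ x, ∀ₛ y, ∀ₛ z, ∀ₛ f, ∀ₛ g, ∀ₛ h, pairMem x y R →ₛ pairMem y z R →ₛ
    isMap p x y f →ₛ isMap p y z g →ₛ isMap p x z h →ₛ
    ∀ₛ r, ∀ₛ t, pairMem r t h ↔ₛ ∃ₛ s, pairMem r s f ∧ₛ pairMem s t g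

def axiomM1 (R p : U) : SetFormula U :=
  ∀ₛ x, ∀ₛ y, ∀ₛ a, ∀ₛ b, ∀ₛ c, ∀ₛ d, ∀ₛ f,
    isPair x a b →ₛ isPair y c d →ₛ pairMem x y R →ₛ isMap p x y f →ₛ
    isSLOOP f b ∧ₛ pairMem b d f

def axiomM2 (R p : U) : SetFormula U :=
  ∀ₛ x, ∀ₛ y, ∀ₛ a, ∀ₛ b, ∀ₛ c, ∀ₛ d, ∀ₛ f,
    isPair x a b →ₛ isPair y c d →ₛ pairMem x y R →ₛ isMap p x y f →ₛ
    ∀ₛ n, ∀ₛ n', ∀ₛ s, ∀ₛ z, n ∈ₛ b →ₛ pairMem n n' f →ₛ isPair s a n →ₛ isPair z c n' →ₛ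
      pairMem s z R ∧ₛ ∀ₛ g, isMap p s z g →ₛ
        ∀ₛ r, ∀ₛ t, pairMem r t g ↔ₛ (r ∈ₛ n ∨ₛ r =ₛ n) ∧ₛ pairMem r t f

def axiomM3 (S R : U) : SetFormula U :=
  ∀ₛ y, ∀ₛ c, ∀ₛ d, y ∈ₛ S →ₛ isPair y c d →ₛ levelsClosed R y c

def axiomM4 (S R : U) : SetFormula U :=
  ∀ₛ y, ∀ₛ c, ∀ₛ d, ∀ₛ t, y ∈ₛ S →ₛ isPair y c d →ₛ isTheta S c t →ₛ ¬ₛ (isSucc t d) →ₛ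
    levelsUnbounded R y c

def axiomM5 (S R p : U) : SetFormula U :=
  ∀ₛ y, ∀ₛ c, ∀ₛ d, y ∈ₛ S →ₛ isPair y c d →ₛ levelsUnbounded R y c →ₛ
    ∀ₛ t, t ∈ₛ d ↔ₛ ∃ₛ x, ∃ₛ a, ∃ₛ b, ∃ₛ f, ∃ₛ r,
      isPair x a b ∧ₛ pairMem x y R ∧ₛ isMap p x y f ∧ₛ r ∈ₛ b ∧ₛ pairMem r t f

def axiomM6 (R p : U) : SetFormula U :=
  ∀ₛ x, ∀ₛ y, ∀ₛ a, ∀ₛ b, ∀ₛ c, ∀ₛ d, ∀ₛ f,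
    isPair x a b →ₛ isPair y c d →ₛ pairMem x y R →ₛ isMap p x y f →ₛ isLimit b →ₛ
    ∀ₛ n, ∀ₛ z, isSupImage n f b →ₛ isPair z c n →ₛ
      pairMem x z R ∧ₛ ∀ₛ g, isMap p x z g →ₛ
        ∀ₛ r, ∀ₛ t, r ∈ₛ b →ₛ (pairMem r t g ↔ₛ pairMem r t f)

def axiomM7 (R p : U) : SetFormula U :=
  ∀ₛ x, ∀ₛ y, ∀ₛ a, ∀ₛ b, ∀ₛ c, ∀ₛ d, ∀ₛ f, ∀ₛ e,
    isPair x a b →ₛ isPair y c d →ₛ pairMem x y R →ₛ isMap p x y f →ₛ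
    a ∈ₛ e →ₛ e ∈ₛ c →ₛ isLimit b →ₛ isSupImage d f b →ₛ
    (∀ₛ n, ∀ₛ n', n ∈ₛ b →ₛ pairMem n n' f →ₛ
      ∃ₛ g, ∃ₛ s, ∃ₛ z, isPair s e g ∧ₛ isPair z c n' ∧ₛ pairMem s z R) →ₛ
    ∃ₛ g, ∃ₛ s, isPair s e g ∧ₛ pairMem s y R

/-- `⟨S, R, p⟩` is a `(k, 1)`-morass. -/
def isMorass (k S R p : U) : SetFormula U :=
  isUncountableRegular k ∧ₛ
  (∃ₛ m, isSuccCardinal m k ∧ₛ nodesBounded k m S ∧ₛ leftAlignment k m S) ∧ₛ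
  isTreeOrder S R ∧ₛ isMapFamily R p ∧ₛ monotonicity R ∧ₛ commutativity R p ∧ₛ
  axiomM1 R p ∧ₛ axiomM2 R p ∧ₛ axiomM3 S R ∧ₛ axiomM4 S R ∧ₛ axiomM5 S R p ∧ₛ
  axiomM6 R p ∧ₛ axiomM7 R p

/-- `e < k` is a mangal of the morass with nodes `S` and tree order `R`. -/
def isMangal (k S R e : U) : SetFormula U :=
  e ∈ₛ k ∧ₛ ∀ₛ x, ∀ₛ y, ∀ₛ a, ∀ₛ b, ∀ₛ c, ∀ₛ d,
    isPair x a b →ₛ isPair y c d →ₛ pairMem x y R →ₛ a ∈ₛ e →ₛ e ∈ₛ c →ₛ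
    ∃ₛ z, ∃ₛ g, isPair z e g ∧ₛ z ∈ₛ S ∧ₛ pairMem x z R ∧ₛ pairMem z y R

/-- `⟨S, R, p⟩` is a `k`-mangrove: a `(k, 1)`-morass whose mangals are cofinal in `k`. -/
def isMangrove (k S R p : U) : SetFormula U :=
  isMorass k S R p ∧ₛ ∀ₛ a, a ∈ₛ k →ₛ ∃ₛ e, isMangal k S R e ∧ₛ a ∈ₛ e

end SetFormula

/-! ## Names and forcing -/

/-- `P`-names: sets (indexed by a type in `Type u`) of pairs consisting of a `P`-name and a
condition. With a generic filter `G`, a name is evaluated as the set of the values of those `elt i`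
with `cond i ∈ G`. -/
inductive PName (P : Type w) : Type (max (u + 1) w)
  | mk (ι : Type u) (elt : ι → PName P) (cond : ι → P) : PName P

namespace PName

variable {P : Type w}

/-- The name `{⟨n i, c i⟩ | i}` for a family indexed by a small type in any universe. -/
noncomputable def ofFamily {I : Type v} [Small.{u} I] (n : I → PName.{u, w} P) (c : I → P) :
    PName.{u, w} P :=
  .mk (Shrink.{u} I) (fun i => n ((equivShrink I).symm i)) (fun i => c ((equivShrink I).symm i))

section Order

variable [Preorder P]

/-- `p ⊩ x = y`: every element of `x` is forced to be an element of `y`, and conversely. -/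
def ForcesEq : PName.{u, w} P → PName.{u, w} P → P → Prop
  | .mk ι A a, .mk κ B b, p =>
    (∀ i : ι, ∀ q ≤ p, q ≤ a i → ∃ r ≤ q, ∃ j : κ, r ≤ b j ∧ ForcesEq (A i) (B j) r) ∧
    (∀ j : κ, ∀ q ≤ p, q ≤ b j → ∃ r ≤ q, ∃ i : ι, r ≤ a i ∧ ForcesEq (A i) (B j) r)

/-- `p ⊩ x ∈ y`: it is dense below `p` to lie below the condition of an element of `y` that is
forced to equal `x`. -/
def ForcesMem (x : PName.{u, w} P) : PName.{u, w} P → P → Prop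
  | .mk κ B b, p => ∀ q ≤ p, ∃ r ≤ q, ∃ j : κ, r ≤ b j ∧ ForcesEq x (B j) r

/-- The forcing relation `p ⊩ φ` over the universe `V`, for a formula `φ` with `P`-names as
parameters and quantifiers over all `P`-names. -/
def Forces : SetFormula (PName.{u, w} P) → P → Prop
  | .mem x y, p => ForcesMem x y p
  | .eq x y, p => ForcesEq x y p
  | .neg φ, p => ∀ q ≤ p, ¬ Forces φ q
  | .and φ ψ, p => Forces φ p ∧ Forces ψ p
  | .all φ, p => ∀ x, Forces (φ x) p

end Order

section Top

variable [Preorder P] [OrderTop P]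

/-- The canonical name for the unordered pair. -/
def upair (x y : PName.{u, w} P) : PName.{u, w} P :=
  .mk (ULift.{u} Bool) (fun i => if i.down then x else y) (fun _ => ⊤)

/-- The canonical name for the ordered pair `⟨x, y⟩ = {{x}, {x, y}}`. -/
def pair (x y : PName.{u, w} P) : PName.{u, w} P := upair (upair x x) (upair x y)

/-- The canonical (check) name of an ordinal of the ground model. -/
noncomputable def ordinal (α : Ordinal.{u}) : PName.{u, w} P :=
  ofFamily (I := Set.Iio α) (fun β => ordinal β.1) (fun _ => ⊤)
termination_by α
decreasing_by exact β.2

end Top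

/-- `V[G] ⊨ φ` for every `P`-generic `G` over `V`: the largest condition forces `φ`. -/
def HoldsInGenericExtension [Preorder P] [OrderTop P] (φ : SetFormula (PName.{u, w} P)) : Prop :=
  Forces φ ⊤

end PName

/-! ## Morass conditions, in the ground model -/

open Cardinal Order

/-- A node `⟨α, β⟩`, with level `α` and order `β`. -/
abbrev MorassNode := Ordinal.{u} × Ordinal.{u}

namespace MorassNode

def l (x : MorassNode.{u}) : Ordinal.{u} := x.1
def o (x : MorassNode.{u}) : Ordinal.{u} := x.2

end MorassNode

open MorassNode in
/-- The underlying data `⟨S, ≺, π⟩` of a morass condition, with the index `lam` of its top level.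
`map x y` is meaningful on arguments `γ ≤ o x` when `rel x y`. -/
structure MorassData where
  nodes : Set MorassNode.{u}
  rel : MorassNode.{u} → MorassNode.{u} → Prop
  map : MorassNode.{u} → MorassNode.{u} → Ordinal.{u} → Ordinal.{u}
  lam : Ordinal.{u}

namespace MorassData

open MorassNode

variable (p : MorassData.{u})

/-- `θ_α = {β | ⟨α, β⟩ ∈ S}` where this set is an ordinal. -/
noncomputable def theta (α : Ordinal.{u}) : Ordinal.{u} := sInf {β | (α, β) ∉ p.nodes}

/-- `{l(x) | x ≺ y}`. -/
def levelsBelow (y : MorassNode.{u}) : Set Ordinal.{u} := {α | ∃ x, p.rel x y ∧ l x = α}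

/-- `y` is an immediate successor of `x`. -/
def immRel (x y : MorassNode.{u}) : Prop := p.rel x y ∧ ∀ z, ¬ (p.rel x z ∧ p.rel z y)

/-- The set `A` is unbounded in the ordinal `δ`. -/
def UnboundedIn (A : Set Ordinal.{u}) (δ : Ordinal.{u}) : Prop := ∀ ε < δ, ∃ α ∈ A, ε < α ∧ α < δ

/-- The set `A` is closed in the ordinal `δ`. -/
def ClosedIn (A : Set Ordinal.{u}) (δ : Ordinal.{u}) : Prop :=
  ∀ γ < δ, IsSuccLimit γ → UnboundedIn A γ → γ ∈ A

/-- `f`, restricted to the ordinal `α`, preserves successors, limits, zero and order. -/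
def IsSLOOP (f : Ordinal.{u} → Ordinal.{u}) (α : Ordinal.{u}) : Prop :=
  (∀ γ, γ + 1 < α → f (γ + 1) = f γ + 1) ∧
  (∀ γ < α, IsSuccLimit γ → IsSuccLimit (f γ)) ∧
  (0 < α → f 0 = 0) ∧
  (∀ γ δ, γ < δ → δ < α → f γ < f δ)

/-- `α ≤ lam` is a mangal. -/
def IsMangal (α : Ordinal.{u}) : Prop :=
  α ≤ p.lam ∧ ∀ x y, p.rel x y → l x < α → α < l y →
    ∃ z ∈ p.nodes, l z = α ∧ p.rel x z ∧ p.rel z y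

end MorassData

open MorassNode MorassData in
/-- A `(κ, 1)`-morass condition. -/
structure MorassCondition (κ : Cardinal.{u}) extends MorassData.{u} where
  /-- Values outside the domains of the maps are normalised to `0`, so that a condition is
  determined by the restrictions of `map x y` to `o x + 1` for `x ≺ y`. -/
  map_eq_zero : ∀ x y γ, ¬ (rel x y ∧ γ ≤ o x) → map x y γ = 0
  lam_lt : lam < κ.ord
  nodes_bounded : ∀ x ∈ nodes, (l x ≤ lam ∧ o x < κ.ord) ∨ (l x = κ.ord ∧ o x < (succ κ).ord)
  /- Tree order -/
  rel_nodes : ∀ x y, rel x y → x ∈ nodes ∧ y ∈ nodes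
  rel_irrefl : ∀ x, ¬ rel x x
  rel_trans : ∀ x y z, rel x y → rel y z → rel x z
  rel_wellOrder : ∀ y, ∀ A : Set MorassNode.{u}, A.Nonempty → (∀ x ∈ A, rel x y) →
    ∃ m ∈ A, ∀ x ∈ A, x = m ∨ rel m x
  /- The maps are functions `π_{xy} : o(x) + 1 → o(y) + 1` -/
  map_le : ∀ x y, rel x y → ∀ γ ≤ o x, map x y γ ≤ o y
  /- Left-alignment up to `lam`, and the top set `S = {β | ⟨κ, β⟩ ∈ nodes}` -/
  left_alignment : ∀ α ≤ lam, (∀ β, (α, β) ∈ nodes ↔ β < toMorassData.theta α) ∧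
    0 < toMorassData.theta α ∧ toMorassData.theta α < κ.ord
  zero_mem_top : (κ.ord, 0) ∈ nodes
  succ_mem_top : ∀ β, (κ.ord, β) ∈ nodes ↔ (κ.ord, β + 1) ∈ nodes
  /- `τ` is the order type of `S`, and `f` is the order-preserving bijection from `τ` to `S` -/
  top_enum : ∃ (τ : Ordinal.{u}) (f : Ordinal.{u} → Ordinal.{u}),
    StrictMonoOn f (Set.Iio τ) ∧ f '' Set.Iio τ = {β | (κ.ord, β) ∈ nodes} ∧
    τ ≤ toMorassData.theta lam ∧ ∀ ν < τ, rel (lam, ν) (κ.ord, f ν)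
  monotonicity : ∀ x y, rel x y → l x < l y
  commutativity : ∀ x y z, rel x y → rel y z → ∀ γ ≤ o x, map y z (map x y γ) = map x z γ
  m1 : ∀ x y, rel x y → IsSLOOP (map x y) (o x + 1) ∧ map x y (o x) = o y
  m2 : ∀ x y, rel x y → ∀ ν < o x, rel (l x, ν) (l y, map x y ν) ∧
    ∀ γ ≤ ν, map (l x, ν) (l y, map x y ν) γ = map x y γ
  m3 : ∀ y ∈ nodes, ClosedIn (toMorassData.levelsBelow y) (l y)
  m4 : ∀ y ∈ nodes, l y ≤ lam → o y + 1 ≠ toMorassData.theta (l y) →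
    UnboundedIn (toMorassData.levelsBelow y) (l y)
  m5 : ∀ y ∈ nodes, UnboundedIn (toMorassData.levelsBelow y) (l y) →
    Set.Iio (o y) = {β | ∃ x, rel x y ∧ β ∈ map x y '' Set.Iio (o x)}
  m6 : ∀ x y, toMorassData.immRel x y → l y ≤ lam → IsSuccLimit (o x) →
    ∀ ν, IsLUB (map x y '' Set.Iio (o x)) ν →
      rel x (l y, ν) ∧ ∀ γ < o x, map x (l y, ν) γ = map x y γ
  m7 : ∀ x y, toMorassData.immRel x y → l y ≤ lam → ∀ α, l x < α → α < l y →
    IsSuccLimit (o x) → IsLUB (map x y '' Set.Iio (o x)) (o y) →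
    (∀ ν < o x, ∃ γ, rel (α, γ) (l y, map x y ν)) → ∃ γ, rel (α, γ) y

namespace MorassCondition

open MorassNode

variable {κ : Cardinal.{u}}

/-- The extension relation `q ≤ p`. -/
instance : LE (MorassCondition κ) where
  le q p :=
    p.nodes ⊆ q.nodes ∧
    (∀ x, l x ≤ p.lam → o x < κ.ord → (x ∈ p.nodes ↔ x ∈ q.nodes)) ∧
    (∀ x ∈ p.nodes, ∀ y ∈ p.nodes, (p.rel x y ↔ q.rel x y)) ∧
    (∀ x y, p.rel x y → ∀ γ ≤ o x, p.map x y γ = q.map x y γ) ∧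
    q.IsMangal p.lam

theorem le_def {p q : MorassCondition κ} : q ≤ p ↔
    p.nodes ⊆ q.nodes ∧
    (∀ x, l x ≤ p.lam → o x < κ.ord → (x ∈ p.nodes ↔ x ∈ q.nodes)) ∧
    (∀ x ∈ p.nodes, ∀ y ∈ p.nodes, (p.rel x y ↔ q.rel x y)) ∧
    (∀ x y, p.rel x y → ∀ γ ≤ o x, p.map x y γ = q.map x y γ) ∧
    q.IsMangal p.lam := Iff.rfl

theorem isMangal_lam (p : MorassCondition κ) : p.IsMangal p.lam := by
  refine ⟨le_rfl, fun x y hxy hx hy => ?_⟩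
  have hyn := (p.rel_nodes x y hxy).2
  rcases p.nodes_bounded y hyn with h | h
  · exact absurd hy (not_lt.2 h.1)
  obtain ⟨τ, f, -, hf, -, hr⟩ := p.top_enum
  have hy' : o y ∈ {β | (κ.ord, β) ∈ p.nodes} := by
    have : y = (κ.ord, o y) := Prod.ext h.1 rfl
    change (κ.ord, o y) ∈ p.nodes
    rwa [← this]
  rw [← hf] at hy'
  obtain ⟨ν, hν, hfν⟩ := hy'
  have hz : p.rel (p.lam, ν) y := by
    have : y = (κ.ord, f ν) := Prod.ext h.1 hfν.symm
    rw [this]; exact hr ν hν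
  refine ⟨(p.lam, ν), (p.rel_nodes _ _ hz).1, rfl, ?_, hz⟩
  obtain ⟨m, hm, hall⟩ := p.rel_wellOrder y {x, (p.lam, ν)} ⟨x, by simp⟩ (by
    rintro w (rfl | rfl)
    · exact hxy
    · exact hz)
  have hne : x ≠ (p.lam, ν) := by
    rintro rfl
    exact lt_irrefl _ hx
  rcases hm with rfl | rfl
  · rcases hall (p.lam, ν) (by simp) with h' | h'
    · exact absurd h'.symm hne
    · exact h'
  · rcases hall x (by simp) with h' | h'
    · exact absurd h' hne
    · exact absurd (p.monotonicity _ _ h') (not_lt.2 hx.le)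

instance : Preorder (MorassCondition κ) where
  le_refl p := ⟨subset_rfl, fun _ _ _ => Iff.rfl, fun _ _ _ _ => Iff.rfl, fun _ _ _ _ _ => rfl,
    p.isMangal_lam⟩
  le_trans r q p hrq hqp := by
    obtain ⟨a1, a2, a3, a4, a5, a6⟩ := hrq
    obtain ⟨b1, b2, b3, b4, b5, b6⟩ := hqp
    refine ⟨b1.trans a1, fun x hx hx' => (b2 x hx hx').trans (a2 x (hx.trans b5) hx'),
      fun x hx y hy => (b3 x hx y hy).trans (a3 x (b1 hx) y (b1 hy)), fun x y hxy γ hγ => ?_,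
      b5.trans a5, ?_⟩
    · have hn := p.rel_nodes x y hxy
      rw [b4 x y hxy γ hγ, a4 x y ((b3 x hn.1 y hn.2).1 hxy) γ hγ]
    · have key : ∀ x y, r.rel x y → l x < p.lam → p.lam < l y → l y ≤ q.lam →
          ∃ z ∈ r.nodes, l z = p.lam ∧ r.rel x z ∧ r.rel z y := by
        intro x y hxy hx hy hyq
        have hn := r.rel_nodes x y hxy
        have low : ∀ w ∈ r.nodes, l w ≤ q.lam → w ∈ q.nodes := by
          intro w hw hwq
          rcases r.nodes_bounded w hw with h | h
          · exact (a2 w hwq h.2).2 hw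
          · exact absurd (h.1 ▸ hwq) (not_le.2 q.lam_lt)
        have hxq := low x hn.1 (hx.le.trans b5)
        have hyq' := low y hn.2 hyq
        obtain ⟨z, hz, hzl, h1, h2⟩ := b6 x y ((a3 x hxq y hyq').2 hxy) hx hy
        exact ⟨z, a1 hz, hzl, (a3 x hxq z hz).1 h1, (a3 z hz y hyq').1 h2⟩
      intro x y hxy hx hy
      rcases le_or_gt (l y) q.lam with h | h
      · exact key x y hxy hx hy h
      rcases b5.lt_or_eq with hlt | heq
      · obtain ⟨z', -, hz'l, h1, h2⟩ := a6 x y hxy (hx.trans hlt) h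
        obtain ⟨z, hz, hzl, h3, h4⟩ := key x z' h1 hx (hz'l ▸ hlt) hz'l.le
        exact ⟨z, hz, hzl, h3, r.rel_trans _ _ _ h4 h2⟩
      · rw [heq] at hx hy ⊢
        exact a6 x y hxy hx hy

theorem node_lt (p : MorassCondition κ) {x : MorassNode.{u}} (hx : x ∈ p.nodes) :
    x.1 < (succ κ).ord ∧ x.2 < (succ κ).ord := by
  have hκ : κ.ord < (succ κ).ord := Cardinal.ord_lt_ord.2 (Order.lt_succ κ)
  rcases p.nodes_bounded x hx with h | h
  · exact ⟨(h.1.trans_lt p.lam_lt).trans hκ, h.2.trans hκ⟩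
  · exact ⟨lt_of_eq_of_lt h.1 hκ, h.2⟩

instance small_nodes (p : MorassCondition κ) : Small.{u} p.nodes := by
  let f : p.nodes → Set.Iio (succ κ).ord × Set.Iio (succ κ).ord :=
    fun x => (⟨x.1.1, (p.node_lt x.2).1⟩, ⟨x.1.2, (p.node_lt x.2).2⟩)
  refine small_of_injective (f := f) fun x y h => ?_
  simp only [f, Prod.mk.injEq] at h
  exact Subtype.ext (Prod.ext (congrArg Subtype.val h.1) (congrArg Subtype.val h.2))

/-- The pairs `⟨x, y⟩` with `x ≺ y`. -/
def edges (p : MorassCondition κ) : Set (MorassNode.{u} × MorassNode.{u}) :=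
  {e | p.rel e.1 e.2}

instance small_edges (p : MorassCondition κ) : Small.{u} p.edges := by
  let f : p.edges → p.nodes × p.nodes :=
    fun e => (⟨e.1.1, (p.rel_nodes _ _ e.2).1⟩, ⟨e.1.2, (p.rel_nodes _ _ e.2).2⟩)
  refine small_of_injective (f := f) fun x y h => ?_
  simp only [f, Prod.mk.injEq, Subtype.mk.injEq] at h
  exact Subtype.ext (Prod.ext h.1 h.2)

/-- The morass conditions form a set. -/
instance small : Small.{u} (MorassCondition κ) := by
  let D := Set.Iio (succ κ).ord
  have hκ : κ.ord < (succ κ).ord := Cardinal.ord_lt_ord.2 (Order.lt_succ κ)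
  let F : MorassCondition κ →
      Set (D × D) × Set ((D × D) × (D × D)) × Set (((D × D) × (D × D)) × D × D) × D :=
    fun p => ({x | (x.1.1, x.2.1) ∈ p.nodes},
      {e | p.rel (e.1.1.1, e.1.2.1) (e.2.1.1, e.2.2.1)},
      {t | p.map (t.1.1.1.1, t.1.1.2.1) (t.1.2.1.1, t.1.2.2.1) t.2.1.1 = t.2.2.1},
      ⟨p.lam, p.lam_lt.trans hκ⟩)
  refine small_of_injective (f := F) fun p q h => ?_
  obtain ⟨h1, h2, h3, h4⟩ : _ ∧ _ ∧ _ ∧ _ := by simpa only [F, Prod.mk.injEq] using h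
  have hl : p.lam = q.lam := congrArg Subtype.val h4
  have hn : p.nodes = q.nodes := by
    ext x
    constructor
    · intro hx
      have := (Set.ext_iff.1 h1 (⟨x.1, (p.node_lt hx).1⟩, ⟨x.2, (p.node_lt hx).2⟩)).1 hx
      exact this
    · intro hx
      have := (Set.ext_iff.1 h1 (⟨x.1, (q.node_lt hx).1⟩, ⟨x.2, (q.node_lt hx).2⟩)).2 hx
      exact this
  have hr : p.rel = q.rel := by
    funext x y
    refine propext ⟨fun hxy => ?_, fun hxy => ?_⟩
    · have b := p.rel_nodes x y hxy
      have := (Set.ext_iff.1 h2 ((⟨x.1, (p.node_lt b.1).1⟩, ⟨x.2, (p.node_lt b.1).2⟩),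
        (⟨y.1, (p.node_lt b.2).1⟩, ⟨y.2, (p.node_lt b.2).2⟩))).1 hxy
      exact this
    · have b := q.rel_nodes x y hxy
      have := (Set.ext_iff.1 h2 ((⟨x.1, (q.node_lt b.1).1⟩, ⟨x.2, (q.node_lt b.1).2⟩),
        (⟨y.1, (q.node_lt b.2).1⟩, ⟨y.2, (q.node_lt b.2).2⟩))).2 hxy
      exact this
  have hm : p.map = q.map := by
    funext x y γ
    by_cases hc : p.rel x y ∧ γ ≤ o x
    · have b := p.rel_nodes x y hc.1
      have := (Set.ext_iff.1 h3 (((⟨x.1, (p.node_lt b.1).1⟩, ⟨x.2, (p.node_lt b.1).2⟩),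
        (⟨y.1, (p.node_lt b.2).1⟩, ⟨y.2, (p.node_lt b.2).2⟩)),
        ⟨γ, hc.2.trans_lt (p.node_lt b.1).2⟩,
        ⟨p.map x y γ, (p.map_le x y hc.1 γ hc.2).trans_lt (p.node_lt b.2).2⟩)).1 rfl
      exact this.symm
    · rw [p.map_eq_zero x y γ hc, q.map_eq_zero x y γ (by rwa [← hr])]
  obtain ⟨⟨n, r, m, a⟩, _⟩ := p
  obtain ⟨⟨n', r', m', a'⟩, _⟩ := q
  simp only at hl hn hr hm
  subst hl hn hr hm
  rfl

end MorassCondition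

/-- The mangrove forcing `ℙ_κ`: the morass conditions with an extra largest element. -/
abbrev MangroveForcing (κ : Cardinal.{u}) := WithTop (MorassCondition κ)

/-! ## The direct limit of the generic filter -/

namespace MangroveForcing

open PName MorassNode

variable {κ : Cardinal.{u}}

/-- The canonical name of a node of the ground model. -/
noncomputable def nodeName (x : MorassNode.{u}) : PName.{u, u + 1} (MangroveForcing κ) :=
  pair (ordinal (l x)) (ordinal (o x))

/-- The canonical name of the function `π_{xy}^p : o(x) + 1 → o(y) + 1` of the ground model. -/
noncomputable def mapName (p : MorassCondition κ) (x y : MorassNode.{u}) :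
    PName.{u, u + 1} (MangroveForcing κ) :=
  ofFamily (I := Set.Iic (o x)) (fun γ => pair (ordinal γ.1) (ordinal (p.map x y γ.1)))
    (fun _ => ⊤)

variable (κ)

/-- The name of `S^G = ⋃_{p ∈ G} S^p`. -/
noncomputable def limitNodes : PName.{u, u + 1} (MangroveForcing κ) :=
  ofFamily (I := Σ p : MorassCondition κ, p.nodes)
    (fun t => nodeName t.2.1) (fun t => (t.1 : MangroveForcing κ))

/-- The name of `≺^G = {⟨x, y⟩ | x ≺^p y for some p ∈ G}`. -/
noncomputable def limitRel : PName.{u, u + 1} (MangroveForcing κ) :=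
  ofFamily (I := Σ p : MorassCondition κ, p.edges)
    (fun t => pair (nodeName t.2.1.1) (nodeName t.2.1.2)) (fun t => (t.1 : MangroveForcing κ))

/-- The name of the family `π^G`, that is, of
`{⟨⟨x, y⟩, π_{xy}^p⟩ | p ∈ G and x ≺^p y}`. -/
noncomputable def limitMaps : PName.{u, u + 1} (MangroveForcing κ) :=
  ofFamily (I := Σ p : MorassCondition κ, p.edges)
    (fun t => pair (pair (nodeName t.2.1.1) (nodeName t.2.1.2)) (mapName t.1 t.2.1.1 t.2.1.2))
    (fun t => (t.1 : MangroveForcing κ))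

end MangroveForcing

open MorassNode MorassData
open scoped Ordinal

/-! ### The forcing relation: density and the derived connectives -/

namespace PName

open SetFormula

variable {P : Type w} [Preorder P]

/-! A condition freezes everything up to its top level. If `q ≤ p`, then `q` adds no node of level
at most `λ^p`, and no predecessor on such a level to a node of `p`. A node or edge of the limit is
therefore settled by one condition, and most morass axioms for the limit are read off a condition
that contains the nodes in question. Each axiom is verified directly in the forcing relation: given
forced hypotheses, extend until the names involved are canonical names of ground-model ordinals,
nodes and maps, and then use the axiom in the condition reached. Four points need more than this.

Density. Any condition extends to one with a prescribed larger top set `S` of size below `κ` and an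
arbitrarily high top level (`exists_le_topSet`). Above the old top level `λ` one puts levels `λ + ξ`
for `0 < ξ ≤ ω ^ ρ`, with a node of order `σ` on level `λ + ξ` exactly when `ω ^ σ ∣ ξ`; nodes of
equal order form a chain with identity maps. Divisibility by powers of `ω` gives the axioms:
multiples of `ω ^ σ` are closed (M.3), they are cofinal in multiples of `ω ^ (σ + 1)` (M.4), and for
limit `σ` a common multiple of all lower powers is a multiple of `ω ^ σ` (M.7). The old level `λ` is
attached underneath along `g = c' ∘ f`, where `f` enumerates the old top set and `c'` collapses the
new one. Since M.6 is demanded of the new edges, the node `⟨λ, ν⟩` with `ν` a limit goes below the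
new nodes of order `sup g[ν]` as well as those of order `g ν`; this is the relation `Hits`. The same
construction amalgamates several conditions with one stem, provided the attachments agree
(`exists_le_family`).

Preservation of `κ`. A decreasing sequence of limit length below `κ` with increasing top levels has
a lower bound: take the union and collapse the union of the top sets to a new level at the supremum
(`exists_le_directed`). On that level no node has an immediate predecessor, so M.6 and M.7 ask
nothing there. Hence fewer than `κ` open dense sets of conditions can be met at once
(`exists_le_forall`), and functions from smaller ordinals to `κ` stay bounded.

Preservation of `κ⁺`. By `2 ^ μ ≤ κ` there are only `κ` many stems and traces of top sets on a given
`γ < κ⁺`. Reflecting `κ` many times yields, in any family indexed by an unbounded subset of `κ⁺`,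
two conditions with the same stem whose top sets share an initial segment beyond which one lies
entirely above the other; these amalgamate (`exists_compatible`). So functions from smaller ordinals
to `κ⁺` stay bounded too.

M.6 and M.7. Conditions have these only for immediate successors. They follow for all pairs up to
the top level by induction (`m6_of_rel`, `m7_of_rel`), and pass to level `κ` because `⟨κ, β⟩` looks
like its predecessor on level `λ`, once `λ` is high enough and the supremum has been added to the
top set.

Finally, the order of the forcing makes `λ^p` a mangal of every extension of `p`, and density makes
such ordinals cofinal in `κ`. -/

theorem forcesEq_symm {x y : PName.{u, w} P} {p : P} (h : ForcesEq x y p) : ForcesEq y x p := by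
  induction x generalizing y p with
  | mk ι A a ih =>
    cases y with
    | mk κ B b =>
      obtain ⟨h1, h2⟩ := h
      refine ⟨fun j q hq hj => ?_, fun i q hq hi => ?_⟩
      · obtain ⟨r, hr, i, hi, h⟩ := h2 j q hq hj
        exact ⟨r, hr, i, hi, ih i h⟩
      · obtain ⟨r, hr, j, hj, h⟩ := h1 i q hq hi
        exact ⟨r, hr, j, hj, ih i h⟩

theorem forcesEq_refl (x : PName.{u, w} P) (p : P) : ForcesEq x x p := by
  induction x generalizing p with
  | mk ι A a ih =>
    exact ⟨fun i q _ hi => ⟨q, le_rfl, i, hi, ih i q⟩, fun i q _ hi => ⟨q, le_rfl, i, hi, ih i q⟩⟩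

theorem forcesEq_mono {x y : PName.{u, w} P} {p q : P} (h : ForcesEq x y p) (hq : q ≤ p) :
    ForcesEq x y q := by
  cases x; cases y
  exact ⟨fun i r hr => h.1 i r (hr.trans hq), fun j r hr => h.2 j r (hr.trans hq)⟩

theorem forcesEq_dense {x y : PName.{u, w} P} {p : P}
    (h : ∀ q ≤ p, ∃ r ≤ q, ForcesEq x y r) : ForcesEq x y p := by
  cases x; cases y
  refine ⟨fun i q hq hi => ?_, fun j q hq hj => ?_⟩
  · obtain ⟨r, hr, h⟩ := h q hq
    obtain ⟨s, hs, h⟩ := h.1 i r le_rfl (hr.trans hi)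
    exact ⟨s, hs.trans hr, h⟩
  · obtain ⟨r, hr, h⟩ := h q hq
    obtain ⟨s, hs, h⟩ := h.2 j r le_rfl (hr.trans hj)
    exact ⟨s, hs.trans hr, h⟩

theorem forcesEq_trans {x y z : PName.{u, w} P} {p : P} (h : ForcesEq x y p)
    (h' : ForcesEq y z p) : ForcesEq x z p := by
  induction x generalizing y z p with
  | mk ι A a ih =>
    cases y with
    | mk κ B b =>
      cases z with
      | mk μ C c =>
        refine ⟨fun i q hq hi => ?_, fun k q hq hk => ?_⟩
        · obtain ⟨r, hr, j, hj, e⟩ := h.1 i q hq hi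
          obtain ⟨s, hs, k, hk, e'⟩ := h'.1 j r (hr.trans hq) hj
          exact ⟨s, hs.trans hr, k, hk, ih i (forcesEq_mono e hs) e'⟩
        · obtain ⟨r, hr, j, hj, e⟩ := h'.2 k q hq hk
          obtain ⟨s, hs, i, hi, e'⟩ := h.2 j r (hr.trans hq) hj
          exact ⟨s, hs.trans hr, i, hi, ih i e' (forcesEq_mono e hs)⟩

theorem forcesMem_mono {x y : PName.{u, w} P} {p q : P} (h : ForcesMem x y p) (hq : q ≤ p) :
    ForcesMem x y q := by
  cases y
  exact fun r hr => h r (hr.trans hq)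

theorem forcesMem_dense {x y : PName.{u, w} P} {p : P}
    (h : ∀ q ≤ p, ∃ r ≤ q, ForcesMem x y r) : ForcesMem x y p := by
  cases y
  intro q hq
  obtain ⟨r, hr, h⟩ := h q hq
  obtain ⟨s, hs, h⟩ := h r le_rfl
  exact ⟨s, hs.trans hr, h⟩

theorem forcesMem_congr_left {x x' y : PName.{u, w} P} {p : P} (h : ForcesEq x x' p)
    (hx : ForcesMem x y p) : ForcesMem x' y p := by
  cases y
  intro q hq
  obtain ⟨r, hr, j, hj, e⟩ := hx q hq
  exact ⟨r, hr, j, hj, forcesEq_trans (forcesEq_symm (forcesEq_mono h (hr.trans hq))) e⟩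

theorem forcesMem_congr_right {x y y' : PName.{u, w} P} {p : P} (h : ForcesEq y y' p)
    (hx : ForcesMem x y p) : ForcesMem x y' p := by
  cases y; cases y'
  intro q hq
  obtain ⟨r, hr, j, hj, e⟩ := hx q hq
  obtain ⟨s, hs, k, hk, e'⟩ := h.1 j r (hr.trans hq) hj
  exact ⟨s, hs.trans hr, k, hk, forcesEq_trans (forcesEq_mono e hs) e'⟩

/-- Extensionality. It suffices to test on the elements of the two names themselves, each of which
is forced into its name by its own condition. -/
theorem forcesEq_of_mem {x y : PName.{u, w} P} {p : P}
    (h : ∀ z, ∀ q ≤ p, ForcesMem z x q ↔ ForcesMem z y q) : ForcesEq x y p := by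
  cases x with
  | mk ι A a =>
    cases y with
    | mk κ B b =>
      refine ⟨fun i q hq hi => ?_, fun j q hq hj => ?_⟩
      · have : ForcesMem (A i) (mk ι A a) q :=
          fun r hr => ⟨r, le_rfl, i, hr.trans hi, forcesEq_refl _ _⟩
        exact (h _ q hq).1 this q le_rfl
      · have : ForcesMem (B j) (mk κ B b) q :=
          fun r hr => ⟨r, le_rfl, j, hr.trans hj, forcesEq_refl _ _⟩
        obtain ⟨r, hr, i, hi, e⟩ := (h _ q hq).2 this q le_rfl
        exact ⟨r, hr, i, hi, forcesEq_symm e⟩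

theorem Forces.mono {φ : SetFormula (PName.{u, w} P)} {p q : P} (h : Forces φ p) (hq : q ≤ p) :
    Forces φ q := by
  induction φ with
  | mem x y => exact forcesMem_mono h hq
  | eq x y => exact forcesEq_mono h hq
  | neg φ _ => exact fun r hr => h r (hr.trans hq)
  | and φ ψ h1 h2 => exact ⟨h1 h.1, h2 h.2⟩
  | all φ ih => exact fun x => ih x (h x)

/-- The clauses for `∈` and `=` are density statements and the other clauses inherit this. It is
what permits every later argument to extend the condition until the names at hand are decided. -/
theorem Forces.dense {φ : SetFormula (PName.{u, w} P)} {p : P}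
    (h : ∀ q ≤ p, ∃ r ≤ q, Forces φ r) : Forces φ p := by
  induction φ generalizing p with
  | mem x y => exact forcesMem_dense h
  | eq x y => exact forcesEq_dense h
  | neg φ _ =>
    intro q hq hφ
    obtain ⟨r, hr, h⟩ := h q hq
    exact h r le_rfl (hφ.mono hr)
  | and φ ψ h1 h2 =>
    refine ⟨h1 fun q hq => ?_, h2 fun q hq => ?_⟩
    · obtain ⟨r, hr, h⟩ := h q hq
      exact ⟨r, hr, h.1⟩
    · obtain ⟨r, hr, h⟩ := h q hq
      exact ⟨r, hr, h.2⟩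
  | all φ ih =>
    refine fun x => ih x fun q hq => ?_
    obtain ⟨r, hr, h⟩ := h q hq
    exact ⟨r, hr, h x⟩

theorem Forces.of_not_neg {φ : SetFormula (PName.{u, w} P)} {p : P}
    (h : ∀ q ≤ p, ¬ Forces (¬ₛ φ) q) : Forces φ p := by
  refine Forces.dense fun q hq => ?_
  have := h q hq
  by_contra hc
  push Not at hc
  exact this fun r hr => hc r hr

theorem forces_and {φ ψ : SetFormula (PName.{u, w} P)} {p : P} :
    Forces (φ ∧ₛ ψ) p ↔ Forces φ p ∧ Forces ψ p := Iff.rfl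

/-- Implication, equivalence, disjunction and existence are coded by `¬`, `∧`, `∀`; density turns
the codes into the usual clauses, with extension of conditions for `∨` and `∃`. -/
theorem forces_imp {φ ψ : SetFormula (PName.{u, w} P)} {p : P} :
    Forces (φ →ₛ ψ) p ↔ ∀ q ≤ p, Forces φ q → Forces ψ q := by
  constructor
  · intro h q hq hφ
    exact Forces.of_not_neg fun r hr hn => h r (hr.trans hq) ⟨hφ.mono hr, hn⟩
  · rintro h q hq ⟨h1, h2⟩
    exact h2 q le_rfl (h q hq h1)

theorem forces_iff {φ ψ : SetFormula (PName.{u, w} P)} {p : P} :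
    Forces (φ ↔ₛ ψ) p ↔ ∀ q ≤ p, (Forces φ q ↔ Forces ψ q) := by
  change Forces (φ →ₛ ψ) p ∧ Forces (ψ →ₛ φ) p ↔ _
  rw [forces_imp, forces_imp]
  exact ⟨fun h q hq => ⟨h.1 q hq, h.2 q hq⟩, fun h => ⟨fun q hq => (h q hq).1,
    fun q hq => (h q hq).2⟩⟩

theorem forces_or {φ ψ : SetFormula (PName.{u, w} P)} {p : P} :
    Forces (φ ∨ₛ ψ) p ↔ ∀ q ≤ p, ∃ r ≤ q, Forces φ r ∨ Forces ψ r := by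
  constructor
  · intro h q hq
    by_contra hc
    push Not at hc
    exact h q hq ⟨fun r hr => (hc r hr).1, fun r hr => (hc r hr).2⟩
  · rintro h q hq ⟨h1, h2⟩
    obtain ⟨r, hr, h | h⟩ := h q hq
    · exact h1 r hr h
    · exact h2 r hr h

theorem forces_ex {φ : PName.{u, w} P → SetFormula (PName.{u, w} P)} {p : P} :
    Forces (.ex φ) p ↔ ∀ q ≤ p, ∃ r ≤ q, ∃ x, Forces (φ x) r := by
  constructor
  · intro h q hq
    by_contra hc
    push Not at hc
    exact h q hq fun x r hr => hc r hr x
  · intro h q hq hn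
    obtain ⟨r, hr, x, hx⟩ := h q hq
    exact hn x r hr hx

theorem Forces.ex {φ : PName.{u, w} P → SetFormula (PName.{u, w} P)} {p : P}
    (x : PName.{u, w} P) (h : Forces (φ x) p) : Forces (.ex φ) p :=
  forces_ex.2 fun q hq => ⟨q, le_rfl, x, h.mono hq⟩

theorem Forces.inl {φ ψ : SetFormula (PName.{u, w} P)} {p : P} (h : Forces φ p) :
    Forces (φ ∨ₛ ψ) p := forces_or.2 fun q hq => ⟨q, le_rfl, .inl (h.mono hq)⟩

theorem Forces.inr {φ ψ : SetFormula (PName.{u, w} P)} {p : P} (h : Forces ψ p) :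
    Forces (φ ∨ₛ ψ) p := forces_or.2 fun q hq => ⟨q, le_rfl, .inr (h.mono hq)⟩

/-! ### Pairs -/

theorem forcesMem_ofFamily {I : Type v} [Small.{u} I] {n : I → PName.{u, w} P} {c : I → P}
    {x : PName.{u, w} P} {p : P} :
    ForcesMem x (ofFamily n c) p ↔ ∀ q ≤ p, ∃ r ≤ q, ∃ i, r ≤ c i ∧ ForcesEq x (n i) r := by
  refine forall₂_congr fun q hq => exists_congr fun r => and_congr Iff.rfl ?_
  exact (equivShrink I).symm.exists_congr_left.trans
    (exists_congr fun i => by simp)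

section Top

variable [OrderTop P]

theorem forcesMem_upair {x y z : PName.{u, w} P} {p : P} :
    ForcesMem z (upair x y) p ↔ ∀ q ≤ p, ∃ r ≤ q, ForcesEq z x r ∨ ForcesEq z y r := by
  refine forall₂_congr fun q hq => exists_congr fun r => and_congr Iff.rfl ?_
  constructor
  · rintro ⟨⟨b⟩, -, h⟩
    cases b
    · exact .inr h
    · exact .inl h
  · rintro (h | h)
    · exact ⟨⟨true⟩, le_top, h⟩
    · exact ⟨⟨false⟩, le_top, h⟩

theorem forcesMem_upair_left (x y : PName.{u, w} P) (p : P) : ForcesMem x (upair x y) p :=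
  forcesMem_upair.2 fun q _ => ⟨q, le_rfl, .inl (forcesEq_refl _ _)⟩

theorem forcesMem_upair_right (x y : PName.{u, w} P) (p : P) : ForcesMem y (upair x y) p :=
  forcesMem_upair.2 fun q _ => ⟨q, le_rfl, .inr (forcesEq_refl _ _)⟩

theorem forces_isUPair {x y z : PName.{u, w} P} {p : P} :
    Forces (isUPair z x y) p ↔ ForcesEq z (upair x y) p := by
  have key : ∀ v q, Forces (v =ₛ x ∨ₛ v =ₛ y) q ↔ ForcesMem v (upair x y) q := by
    intro v q
    rw [forces_or, forcesMem_upair]; rfl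
  constructor
  · intro h
    refine forcesEq_of_mem fun v q hq => ?_
    exact (forces_iff.1 (h v) q hq).trans (key v q)
  · intro h v
    refine forces_iff.2 fun q hq => ?_
    rw [key]
    exact ⟨forcesMem_congr_right (forcesEq_mono h hq),
      forcesMem_congr_right (forcesEq_symm (forcesEq_mono h hq))⟩

theorem forces_isPair {x y z : PName.{u, w} P} {p : P} :
    Forces (isPair z x y) p ↔ ForcesEq z (pair x y) p := by
  have key : ∀ v q, Forces (isUPair v x x ∨ₛ isUPair v x y) q ↔ ForcesMem v (pair x y) q := by
    intro v q
    rw [forces_or, pair, forcesMem_upair]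
    simp only [forces_isUPair]
  constructor
  · intro h
    refine forcesEq_of_mem fun v q hq => ?_
    exact (forces_iff.1 (h v) q hq).trans (key v q)
  · intro h v
    refine forces_iff.2 fun q hq => ?_
    rw [key]
    exact ⟨forcesMem_congr_right (forcesEq_mono h hq),
      forcesMem_congr_right (forcesEq_symm (forcesEq_mono h hq))⟩

theorem forcesEq_of_upair_self {x y z : PName.{u, w} P} {p : P}
    (h : ForcesEq (upair x y) (upair z z) p) : ForcesEq x z p ∧ ForcesEq y z p := by
  have key : ∀ v, ForcesMem v (upair x y) p → ForcesEq v z p := by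
    intro v hv
    refine forcesEq_dense fun q hq => ?_
    obtain ⟨r, hr, h | h⟩ := forcesMem_upair.1 (forcesMem_congr_right h hv) q hq
    · exact ⟨r, hr, h⟩
    · exact ⟨r, hr, h⟩
  exact ⟨key _ (forcesMem_upair_left _ _ _), key _ (forcesMem_upair_right _ _ _)⟩

theorem forcesEq_upair {x y x' y' : PName.{u, w} P} {p : P} (hx : ForcesEq x x' p)
    (hy : ForcesEq y y' p) : ForcesEq (upair x y) (upair x' y') p := by
  refine forcesEq_of_mem fun z q hq => ?_
  rw [forcesMem_upair, forcesMem_upair]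
  refine forall₂_congr fun r hr => exists_congr fun s => and_congr_right fun hs => ?_
  have hx := forcesEq_mono hx ((hs.trans hr).trans hq)
  have hy := forcesEq_mono hy ((hs.trans hr).trans hq)
  refine or_congr ⟨fun h => forcesEq_trans h hx, fun h => forcesEq_trans h (forcesEq_symm hx)⟩
    ⟨fun h => forcesEq_trans h hy, fun h => forcesEq_trans h (forcesEq_symm hy)⟩

theorem forcesEq_pair {x y x' y' : PName.{u, w} P} {p : P} :
    ForcesEq (pair x y) (pair x' y') p ↔ ForcesEq x x' p ∧ ForcesEq y y' p := by
  constructor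
  · intro h
    have hx : ForcesEq x x' p := by
      refine forcesEq_dense fun q hq => ?_
      obtain ⟨r, hr, h | h⟩ := forcesMem_upair.1
        (forcesMem_congr_right h (forcesMem_upair_left _ _ _)) q hq
      · exact ⟨r, hr, (forcesEq_of_upair_self h).1⟩
      · exact ⟨r, hr, forcesEq_symm (forcesEq_of_upair_self (forcesEq_symm h)).1⟩
    refine ⟨hx, forcesEq_dense fun q hq => ?_⟩
    -- From `{x, y} = {x', y'}` and `x = x'`: either `y = y'`, or `y = x'`, and then `y'` is `x` or
    -- `y`, both equal to `y`.
    have key : ∀ r ≤ q, ForcesEq (upair x y) (upair x' y') r → ∃ s ≤ r, ForcesEq y y' s := by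
      intro r hr e
      have e' := forcesMem_congr_right e (forcesMem_upair_right x y r)
      obtain ⟨s, hs, h1 | h1⟩ := forcesMem_upair.1 e' r le_rfl
      · have e2 := forcesMem_congr_right (forcesEq_symm e) (forcesMem_upair_right x' y' r)
        obtain ⟨t, ht, h2 | h2⟩ := forcesMem_upair.1 e2 s hs
        · refine ⟨t, ht.trans hs, ?_⟩
          have h1 := forcesEq_mono h1 ht
          have hx := forcesEq_mono hx (((ht.trans hs).trans hr).trans hq)
          exact forcesEq_trans h1 (forcesEq_trans (forcesEq_symm hx) (forcesEq_symm h2))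
        · exact ⟨t, ht.trans hs, forcesEq_symm h2⟩
      · exact ⟨s, hs, h1⟩
    obtain ⟨r, hr, h1 | h1⟩ := forcesMem_upair.1
      (forcesMem_congr_right h (forcesMem_upair_right _ _ _)) q hq
    · obtain ⟨s, hs, h2 | h2⟩ := forcesMem_upair.1
        (forcesMem_congr_right (forcesEq_symm h) (forcesMem_upair_right _ _ _)) r (hr.trans hq)
      · have h1 := (forcesEq_of_upair_self (forcesEq_mono h1 hs)).2
        have h2 := (forcesEq_of_upair_self h2).2
        have hx := forcesEq_mono hx ((hs.trans hr).trans hq)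
        exact ⟨s, hs.trans hr,
          forcesEq_trans h1 (forcesEq_trans (forcesEq_symm hx) (forcesEq_symm h2))⟩
      · obtain ⟨t, ht, h⟩ := key s (hs.trans hr) (forcesEq_symm h2)
        exact ⟨t, (ht.trans hs).trans hr, h⟩
    · obtain ⟨t, ht, h⟩ := key r hr h1
      exact ⟨t, ht.trans hr, h⟩
  · rintro ⟨hx, hy⟩
    exact forcesEq_upair (forcesEq_upair hx hx) (forcesEq_upair hx hy)

theorem forces_pairMem {x y r : PName.{u, w} P} {p : P} :
    Forces (pairMem x y r) p ↔ ForcesMem (pair x y) r p := by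
  constructor
  · intro h
    refine forcesMem_dense fun q hq => ?_
    obtain ⟨s, hs, z, h1, h2⟩ := forces_ex.1 h q hq
    exact ⟨s, hs, forcesMem_congr_left (forces_isPair.1 h1) h2⟩
  · exact fun h => Forces.ex (pair x y) ⟨forces_isPair.2 (forcesEq_refl _ _), h⟩

theorem forces_isMap {m x y f : PName.{u, w} P} {p : P} :
    Forces (isMap m x y f) p ↔ ForcesMem (pair (pair x y) f) m p := by
  constructor
  · intro h
    refine forcesMem_dense fun q hq => ?_
    obtain ⟨s, hs, z, h1, h2⟩ := forces_ex.1 h q hq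
    exact ⟨s, hs, forcesMem_congr_left
      (forcesEq_pair.2 ⟨forces_isPair.1 h1, forcesEq_refl _ _⟩) (forces_pairMem.1 h2)⟩
  · exact fun h => Forces.ex (pair x y) ⟨forces_isPair.2 (forcesEq_refl _ _), forces_pairMem.2 h⟩

/-! ### Ordinals -/

theorem forcesMem_ordinal {x : PName.{u, w} P} {α : Ordinal.{u}} {p : P} :
    ForcesMem x (ordinal α) p ↔ ∀ q ≤ p, ∃ r ≤ q, ∃ β < α, ForcesEq x (ordinal β) r := by
  rw [ordinal, forcesMem_ofFamily]
  refine forall₂_congr fun q hq => exists_congr fun r => and_congr Iff.rfl ?_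
  constructor
  · rintro ⟨⟨β, hβ⟩, -, h⟩
    exact ⟨β, hβ, h⟩
  · rintro ⟨β, hβ, h⟩
    exact ⟨⟨β, hβ⟩, le_top, h⟩

theorem forcesMem_ordinal_of_lt {α β : Ordinal.{u}} (h : β < α) (p : P) :
    ForcesMem (ordinal β) (ordinal α) p :=
  forcesMem_ordinal.2 fun q _ => ⟨q, le_rfl, β, h, forcesEq_refl _ _⟩

/-- An extension would make `β` equal to some `γ < α`; since `γ < β`, it would force `γ ∈ γ`,
against the induction hypothesis. Consequently membership and equality of canonical names of
ordinals have the same answer under every condition. -/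
theorem not_forcesMem_ordinal_of_le {α β : Ordinal.{u}} (h : α ≤ β) (p : P) :
    ¬ ForcesMem (ordinal β) (ordinal α) p := by
  induction α using WellFoundedLT.induction generalizing β p with
  | ind α ih =>
    intro hm
    obtain ⟨q, hq, γ, hγ, e⟩ := forcesMem_ordinal.1 hm p le_rfl
    exact ih γ hγ le_rfl q (forcesMem_congr_right e (forcesMem_ordinal_of_lt (hγ.trans_le h) q))

theorem forcesMem_ordinal_iff {α β : Ordinal.{u}} {p : P} :
    ForcesMem (ordinal β) (ordinal α) p ↔ β < α :=
  ⟨fun h => not_le.1 fun hl => not_forcesMem_ordinal_of_le hl p h,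
    fun h => forcesMem_ordinal_of_lt h p⟩

theorem forcesEq_ordinal_iff {α β : Ordinal.{u}} {p : P} :
    ForcesEq (ordinal β : PName.{u, w} P) (ordinal α) p ↔ β = α := by
  constructor
  · intro h
    rcases lt_trichotomy β α with hl | hl | hl
    · exact absurd (forcesMem_congr_right (forcesEq_symm h) (forcesMem_ordinal_of_lt hl p))
        (not_forcesMem_ordinal_of_le le_rfl p)
    · exact hl
    · exact absurd (forcesMem_congr_right h (forcesMem_ordinal_of_lt hl p))
        (not_forcesMem_ordinal_of_le le_rfl p)
  · rintro rfl
    exact forcesEq_refl _ _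

end Top

end PName

/-! ## Small sets of ordinals and their enumerations -/

namespace MorassData

theorem IsSLOOP.comp {f h : Ordinal.{u} → Ordinal.{u}} {a b : Ordinal.{u}} (hf : IsSLOOP f b)
    (hh : IsSLOOP h (a + 1)) (hab : ∀ γ ≤ a, h γ < b) : IsSLOOP (fun γ => f (h γ)) (a + 1) := by
  obtain ⟨f1, f2, f3, f4⟩ := hf
  obtain ⟨h1, h2, h3, h4⟩ := hh
  refine ⟨fun γ hγ => ?_, fun γ hγ hl => ?_, fun _ => ?_, fun γ δ hγ hδ => ?_⟩
  · have := hab (γ + 1) (Order.lt_add_one_iff.1 hγ)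
    beta_reduce
    rw [h1 γ hγ] at this ⊢
    exact f1 _ this
  · exact f2 _ (hab γ (Order.lt_add_one_iff.1 hγ)) (h2 γ hγ hl)
  · have := h3 (by simp)
    simp only [this]
    refine f3 ?_
    have := hab 0 (by simp)
    exact (zero_le).trans_lt this
  · exact f4 _ _ (h4 γ δ hγ hδ) (hab δ (Order.lt_add_one_iff.1 hδ))

theorem IsSLOOP.congr {f h : Ordinal.{u} → Ordinal.{u}} {a : Ordinal.{u}} (hf : IsSLOOP f (a + 1))
    (e : ∀ γ ≤ a, h γ = f γ) : IsSLOOP h (a + 1) := by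
  obtain ⟨f1, f2, f3, f4⟩ := hf
  have e' : ∀ γ < a + 1, h γ = f γ := fun γ hγ => e γ (Order.lt_add_one_iff.1 hγ)
  refine ⟨fun γ hγ => ?_, fun γ hγ hl => ?_, fun h0 => ?_, fun γ δ hγ hδ => ?_⟩
  · rw [e' _ hγ, e' γ ((lt_add_one γ).trans hγ)]
    exact f1 γ hγ
  · rw [e' _ hγ]; exact f2 γ hγ hl
  · rw [e' _ h0]; exact f3 h0
  · rw [e' _ hδ, e' _ (hγ.trans hδ)]; exact f4 _ _ hγ hδ

theorem isSLOOP_id (a : Ordinal.{u}) : IsSLOOP (fun γ => γ) a :=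
  ⟨fun _ _ => rfl, fun _ _ h => h, fun _ => rfl, fun _ _ h _ => h⟩

end MorassData

theorem Ordinal.not_isSuccLimit_add_one' (a : Ordinal.{u}) : ¬ IsSuccLimit (a + 1) := by
  rw [← Order.succ_eq_add_one]
  exact Order.not_isSuccLimit_succ a

theorem Ordinal.exists_add_one_or_isSuccLimit (o : Ordinal.{u}) :
    o = 0 ∨ (∃ a, o = a + 1) ∨ IsSuccLimit o := by
  rcases eq_or_ne o 0 with h | h
  · exact .inl h
  by_cases hs : ∃ a, o = a + 1
  · exact .inr (.inl hs)
  · refine .inr (.inr ⟨by simpa using h, fun a ha => hs ⟨a, ?_⟩⟩)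
    have := ha.succ_eq
    rw [← this, Order.succ_eq_add_one]

/-- `f` is the increasing enumeration of `S` by the ordinals below `τ`, and `c` its inverse. -/
structure IsEnum (S : Set Ordinal.{u}) (τ : Ordinal.{u}) (f c : Ordinal.{u} → Ordinal.{u}) :
    Prop where
  mem : ∀ ν < τ, f ν ∈ S
  lt : ∀ β ∈ S, c β < τ
  c_f : ∀ ν < τ, c (f ν) = ν
  f_c : ∀ β ∈ S, f (c β) = β
  strictMono : ∀ ν μ, ν < μ → μ < τ → f ν < f μ

/-- `S` contains `0` and is closed under successors and predecessors. -/
structure IsTopSet (S : Set Ordinal.{u}) : Prop where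
  zero_mem : 0 ∈ S
  succ_mem : ∀ β, β ∈ S ↔ β + 1 ∈ S

/-- `S` is the surjective image of an ordinal below `κ`. -/
def IsFew (κ : Cardinal.{u}) (S : Set Ordinal.{u}) : Prop :=
  ∃ μ < κ.ord, ∃ e : Ordinal.{u} → Ordinal.{u}, S ⊆ e '' Set.Iio μ

namespace IsEnum

variable {S : Set Ordinal.{u}} {τ : Ordinal.{u}} {f c : Ordinal.{u} → Ordinal.{u}}

theorem lt_iff (h : IsEnum S τ f c) {ν μ : Ordinal.{u}} (hν : ν < τ) (hμ : μ < τ) :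
    f ν < f μ ↔ ν < μ := by
  refine ⟨fun hl => ?_, fun hl => h.strictMono _ _ hl hμ⟩
  by_contra hc
  rcases (not_lt.1 hc).lt_or_eq with hc | hc
  · exact lt_asymm hl (h.strictMono _ _ hc hν)
  · exact absurd hl (by rw [hc]; exact lt_irrefl _)

theorem c_lt_iff (h : IsEnum S τ f c) {β γ : Ordinal.{u}} (hβ : β ∈ S) (hγ : γ ∈ S) :
    c β < c γ ↔ β < γ := by
  rw [← h.lt_iff (h.lt _ hβ) (h.lt _ hγ), h.f_c _ hβ, h.f_c _ hγ]

theorem c_inj (h : IsEnum S τ f c) {β γ : Ordinal.{u}} (hβ : β ∈ S) (hγ : γ ∈ S)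
    (e : c β = c γ) : β = γ := by
  rw [← h.f_c _ hβ, ← h.f_c _ hγ, e]

theorem c_zero (h : IsEnum S τ f c) (hS : IsTopSet S) : c 0 = 0 := by
  by_contra hc
  have h1 : 0 < c 0 := pos_iff_ne_zero.2 hc
  have h2 := h.lt _ hS.zero_mem
  have h3 := h.strictMono _ _ h1 h2
  rw [h.f_c _ hS.zero_mem] at h3
  exact absurd h3 (by simp)

theorem c_succ (h : IsEnum S τ f c) (hS : IsTopSet S) {β : Ordinal.{u}} (hβ : β ∈ S) :
    c (β + 1) = c β + 1 := by
  have hβ' := (hS.succ_mem β).1 hβ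
  refine le_antisymm ?_ ?_
  · by_contra hc
    have hlt : c β + 1 < c (β + 1) := not_le.1 hc
    have hτ := hlt.trans (h.lt _ hβ')
    have h1 := h.strictMono _ _ hlt (h.lt _ hβ')
    have h2 := h.strictMono _ _ (lt_add_one (c β)) hτ
    rw [h.f_c _ hβ'] at h1
    rw [h.f_c _ hβ] at h2
    exact absurd (Order.lt_add_one_iff.1 h1) (not_le.2 h2)
  · exact Order.add_one_le_of_lt ((h.c_lt_iff hβ hβ').2 (lt_add_one β))

theorem c_limit (h : IsEnum S τ f c) (hS : IsTopSet S) {β : Ordinal.{u}} (hβ : β ∈ S)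
    (hl : IsSuccLimit β) : IsSuccLimit (c β) := by
  rcases Ordinal.exists_add_one_or_isSuccLimit (c β) with e | ⟨a, e⟩ | e
  · rw [← h.c_zero hS] at e
    have := h.c_inj hβ hS.zero_mem e
    exact absurd this (by simpa using hl.1)
  · have ha : a < τ := (lt_add_one a).trans (e ▸ h.lt _ hβ)
    have := h.c_succ hS (h.mem a ha)
    rw [h.c_f a ha, ← e] at this
    have := h.c_inj hβ ((hS.succ_mem _).1 (h.mem a ha)) this.symm
    rw [this] at hl
    exact absurd hl (Ordinal.not_isSuccLimit_add_one' _)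
  · exact e

/-- Closure of `S` under successors and predecessors is exactly what makes the enumeration and the
collapse match successors with successors and limits with limits. Neither needs to be continuous,
which is why suprema require separate care in M.6. -/
theorem isSLOOP (h : IsEnum S τ f c) (hS : IsTopSet S) : IsSLOOP f τ := by
  have h0 : f 0 = 0 := by
    rw [← h.c_zero hS, h.f_c _ hS.zero_mem, h.c_zero hS]
  have hs : ∀ γ < τ, f (γ + 1) = f γ + 1 := by
    intro γ hγ
    have := h.c_succ hS (h.mem γ hγ)
    rw [h.c_f γ hγ] at this
    rw [← this, h.f_c _ ((hS.succ_mem _).1 (h.mem γ hγ))]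
  refine ⟨fun γ hγ => hs γ ((lt_add_one γ).trans hγ), fun γ hγ hl => ?_, fun _ => h0,
    fun γ δ hγ hδ => h.strictMono _ _ hγ hδ⟩
  rcases Ordinal.exists_add_one_or_isSuccLimit (f γ) with e | ⟨a, e⟩ | e
  · have := h.c_f γ hγ
    rw [e, h.c_zero hS] at this
    exact absurd this.symm (by simpa using hl.1)
  · have ha : a ∈ S := (hS.succ_mem a).2 (e ▸ h.mem γ hγ)
    have := h.c_f γ hγ
    rw [e, h.c_succ hS ha] at this
    rw [← this] at hl
    exact absurd hl (Ordinal.not_isSuccLimit_add_one' _)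
  · exact e

/-- Composing a SLOOP function into `S` with the collapse of `S` gives a SLOOP function. -/
theorem c_comp_isSLOOP (h : IsEnum S τ f c) (hS : IsTopSet S) {g : Ordinal.{u} → Ordinal.{u}}
    {a : Ordinal.{u}} (hg : IsSLOOP g a) (hm : ∀ γ < a, g γ ∈ S) :
    IsSLOOP (fun γ => c (g γ)) a := by
  refine ⟨fun γ hγ => ?_, fun γ hγ hl => ?_, fun h0 => ?_, fun γ δ hγ hδ => ?_⟩
  · beta_reduce
    rw [hg.1 γ hγ, h.c_succ hS (hm _ ((lt_add_one γ).trans hγ))]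
  · exact h.c_limit hS (hm γ hγ) (hg.2.1 γ hγ hl)
  · beta_reduce
    rw [hg.2.2.1 h0, h.c_zero hS]
  · exact (h.c_lt_iff (hm _ (hγ.trans hδ)) (hm _ hδ)).2 (hg.2.2.2 γ δ hγ hδ)

/-- The collapse of `β` only depends on the set below `β`. -/
theorem c_eq_of_agree {S' : Set Ordinal.{u}} {τ' : Ordinal.{u}} {f' c' : Ordinal.{u} → Ordinal.{u}}
    (h : IsEnum S τ f c) (h' : IsEnum S' τ' f' c') {β : Ordinal.{u}} (hβ : β ∈ S) (hβ' : β ∈ S')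
    (e : ∀ γ < β, γ ∈ S ↔ γ ∈ S') : c β = c' β := by
  induction β using WellFoundedLT.induction with
  | ind β ih =>
    have ih' : ∀ γ < β, γ ∈ S → c γ = c' γ := fun γ hγ hS =>
      ih γ hγ hS ((e γ hγ).1 hS) fun δ hδ => e δ (hδ.trans hγ)
    rcases lt_trichotomy (c β) (c' β) with hl | hl | hl
    · have hlt := hl.trans (h'.lt _ hβ')
      have h1 := h'.strictMono _ _ hl (h'.lt _ hβ')
      rw [h'.f_c _ hβ'] at h1
      have h2 := (e _ h1).2 (h'.mem _ hlt)
      have h3 := ih' _ h1 h2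
      rw [h'.c_f _ hlt] at h3
      exact absurd (h.c_inj h2 hβ h3) h1.ne
    · exact hl
    · have hlt := hl.trans (h.lt _ hβ)
      have h1 := h.strictMono _ _ hl (h.lt _ hβ)
      rw [h.f_c _ hβ] at h1
      have h2 := h.mem _ hlt
      have h3 := ih' _ h1 h2
      rw [h.c_f _ hlt] at h3
      exact absurd (h'.c_inj ((e _ h1).1 h2) hβ' h3.symm) h1.ne

theorem tau_pos (h : IsEnum S τ f c) (hS : IsTopSet S) : 0 < τ :=
  (zero_le).trans_lt (h.lt _ hS.zero_mem)

theorem lt_ord (h : IsEnum S τ f c) {κ : Cardinal.{u}} (hS : IsFew κ S) : τ < κ.ord := by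
  obtain ⟨μ, hμ, e, he⟩ := hS
  rw [Cardinal.lt_ord] at hμ ⊢
  refine lt_of_le_of_lt ?_ hμ
  have : ∀ ν : Set.Iio τ, ∃ ξ : Set.Iio μ, e ξ = f ν := fun ν => by
    obtain ⟨ξ, hξ, hh⟩ := he (h.mem ν ν.2)
    exact ⟨⟨ξ, hξ⟩, hh⟩
  choose g hg using this
  have hinj : Function.Injective g := by
    intro a b hab
    have : f a = f b := by rw [← hg a, ← hg b, hab]
    refine Subtype.ext ?_
    rw [← h.c_f a a.2, ← h.c_f b b.2, this]
  have := Cardinal.mk_le_of_injective hinj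
  rwa [Cardinal.mk_Iio_ordinal, Cardinal.mk_Iio_ordinal, Cardinal.lift_le] at this

theorem isFew (h : IsEnum S τ f c) {κ : Cardinal.{u}} (hτ : τ < κ.ord) : IsFew κ S :=
  ⟨τ, hτ, f, fun β hβ => ⟨c β, h.lt β hβ, h.f_c β hβ⟩⟩

end IsEnum

theorem exists_isEnum {S : Set Ordinal.{u}} {b : Ordinal.{u}} (hb : ∀ β ∈ S, β < b) :
    ∃ τ f c, IsEnum S τ f c := by
  classical
  -- `Ordinal.enumOrd` enumerates unbounded sets, so the tail from `b` on is adjoined; the index of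
  -- `b` is then the order type of `S`.
  set T : Set Ordinal.{u} := S ∪ Set.Ici b with hT
  have hunb : ¬ BddAbove T := by
    rintro ⟨a, ha⟩
    have h1 : max a b + 1 ∈ T := .inr ((le_max_right a b).trans (lt_add_one _).le)
    exact absurd (ha h1) (not_le.2 ((le_max_left a b).trans_lt (lt_add_one _)))
  have hmono := Ordinal.enumOrd_strictMono hunb
  have hrange := Ordinal.range_enumOrd hunb
  set f := Ordinal.enumOrd T with hf
  have hbT : b ∈ Set.range f := by rw [hrange]; exact .inr (Set.mem_Ici.2 le_rfl)
  obtain ⟨τ, hτ⟩ := hbT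
  refine ⟨τ, f, Function.invFun f, ?_, ?_, ?_, ?_, ?_⟩
  · intro ν hν
    have h1 : f ν ∈ T := by rw [← hrange]; exact ⟨ν, rfl⟩
    rcases h1 with h1 | h1
    · exact h1
    · exact absurd (hmono hν) (not_lt.2 (hτ ▸ h1))
  · intro β hβ
    have : f (Function.invFun f β) = β := Function.invFun_eq (by
      have : β ∈ Set.range f := by rw [hrange]; exact .inl hβ
      exact this)
    rw [← hmono.lt_iff_lt, this, hτ]
    exact hb β hβ
  · exact fun ν _ => Function.leftInverse_invFun hmono.injective ν
  · intro β hβ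
    refine Function.invFun_eq (by
      have : β ∈ Set.range f := by rw [hrange]; exact .inl hβ
      exact this)
  · exact fun ν μ h _ => hmono h

theorem MorassData.theta_eq_of {p : MorassData.{u}} {α t : Ordinal.{u}}
    (h : ∀ β, (α, β) ∈ p.nodes ↔ β < t) : p.theta α = t := by
  have : {β | (α, β) ∉ p.nodes} = Set.Ici t := by
    ext β
    simp [h]
  rw [MorassData.theta, this, csInf_Ici]

/-! ## The part of a condition up to its top level -/

/-- A morass condition without the nodes of level `κ`. -/
structure Stem (κ : Cardinal.{u}) extends MorassData.{u} where
  lam_lt : lam < κ.ord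
  level_le : ∀ x ∈ nodes, l x ≤ lam
  rel_nodes : ∀ x y, rel x y → x ∈ nodes ∧ y ∈ nodes
  rel_trans : ∀ x y z, rel x y → rel y z → rel x z
  rel_linear : ∀ x x' y, rel x y → rel x' y → x = x' ∨ rel x x' ∨ rel x' x
  left_alignment : ∀ α ≤ lam, (∀ β, (α, β) ∈ nodes ↔ β < toMorassData.theta α) ∧
    0 < toMorassData.theta α ∧ toMorassData.theta α < κ.ord
  monotonicity : ∀ x y, rel x y → l x < l y
  commutativity : ∀ x y z, rel x y → rel y z → ∀ γ ≤ o x, map y z (map x y γ) = map x z γ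
  m1 : ∀ x y, rel x y → IsSLOOP (map x y) (o x + 1) ∧ map x y (o x) = o y
  m2 : ∀ x y, rel x y → ∀ ν < o x, rel (l x, ν) (l y, map x y ν) ∧
    ∀ γ ≤ ν, map (l x, ν) (l y, map x y ν) γ = map x y γ
  m3 : ∀ y ∈ nodes, ClosedIn (toMorassData.levelsBelow y) (l y)
  m4 : ∀ y ∈ nodes, o y + 1 ≠ toMorassData.theta (l y) →
    UnboundedIn (toMorassData.levelsBelow y) (l y)
  m5 : ∀ y ∈ nodes, UnboundedIn (toMorassData.levelsBelow y) (l y) →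
    Set.Iio (o y) = {β | ∃ x, rel x y ∧ β ∈ map x y '' Set.Iio (o x)}
  m6 : ∀ x y, toMorassData.immRel x y → IsSuccLimit (o x) →
    ∀ ν, IsLUB (map x y '' Set.Iio (o x)) ν →
      rel x (l y, ν) ∧ ∀ γ < o x, map x (l y, ν) γ = map x y γ
  m7 : ∀ x y, toMorassData.immRel x y → ∀ α, l x < α → α < l y →
    IsSuccLimit (o x) → IsLUB (map x y '' Set.Iio (o x)) (o y) →
    (∀ ν < o x, ∃ γ, rel (α, γ) (l y, map x y ν)) → ∃ γ, rel (α, γ) y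

namespace Stem

variable {κ : Cardinal.{u}} (s : Stem κ)

/-- The reflexive closure of the tree order. -/
def relE (x y : MorassNode.{u}) : Prop := x = y ∨ s.rel x y

open Classical in
/-- The maps of the reflexive closure of the tree order. -/
noncomputable def mapE (x y : MorassNode.{u}) (γ : Ordinal.{u}) : Ordinal.{u} :=
  if x = y then γ else s.map x y γ

variable {s} {x y z : MorassNode.{u}}

theorem mapE_self (γ : Ordinal.{u}) : s.mapE x x γ = γ := if_pos rfl

theorem ne_of_rel (h : s.rel x y) : x ≠ y := by
  rintro rfl
  exact lt_irrefl _ (s.monotonicity _ _ h)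

theorem mapE_rel (h : s.rel x y) (γ : Ordinal.{u}) : s.mapE x y γ = s.map x y γ :=
  if_neg (ne_of_rel h)

theorem rel_of_relE_rel (h : s.relE x y) (h' : s.rel y z) : s.rel x z := by
  rcases h with rfl | h
  · exact h'
  · exact s.rel_trans _ _ _ h h'

theorem rel_of_rel_relE (h : s.rel x y) (h' : s.relE y z) : s.rel x z := by
  rcases h' with rfl | h'
  · exact h
  · exact s.rel_trans _ _ _ h h'

theorem mapE_sloop (h : s.relE x y) : IsSLOOP (s.mapE x y) (o x + 1) := by
  rcases h with rfl | h
  · exact (isSLOOP_id _).congr fun γ _ => mapE_self γ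
  · exact (s.m1 x y h).1.congr fun γ _ => mapE_rel h γ

theorem mapE_top (h : s.relE x y) : s.mapE x y (o x) = o y := by
  rcases h with rfl | h
  · exact mapE_self _
  · rw [mapE_rel h]
    exact (s.m1 x y h).2

theorem mapE_lt (h : s.relE x y) {γ δ : Ordinal.{u}} (hγ : γ < δ) (hδ : δ ≤ o x) :
    s.mapE x y γ < s.mapE x y δ :=
  (mapE_sloop h).2.2.2 _ _ hγ (Order.lt_add_one_iff.2 hδ)

theorem mapE_lt_o (h : s.relE x y) {γ : Ordinal.{u}} (hγ : γ < o x) : s.mapE x y γ < o y := by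
  have := mapE_lt h hγ le_rfl
  rwa [mapE_top h] at this

theorem mapE_le_o (h : s.relE x y) {γ : Ordinal.{u}} (hγ : γ ≤ o x) : s.mapE x y γ ≤ o y := by
  rcases hγ.lt_or_eq with h' | rfl
  · exact (mapE_lt_o h h').le
  · exact (mapE_top h).le

theorem mapE_comm (h : s.relE x y) (h' : s.relE y z) {γ : Ordinal.{u}} (hγ : γ ≤ o x) :
    s.mapE y z (s.mapE x y γ) = s.mapE x z γ := by
  rcases h with rfl | h
  · rw [mapE_self]
  rcases h' with rfl | h'
  · rw [mapE_self]
  · rw [mapE_rel h, mapE_rel h', mapE_rel (s.rel_trans _ _ _ h h')]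
    exact s.commutativity _ _ _ h h' γ hγ

theorem relE_m2 (h : s.relE x y) {ν : Ordinal.{u}} (hν : ν < o x) :
    s.relE (l x, ν) (l y, s.mapE x y ν) ∧
      ∀ γ ≤ ν, s.mapE (l x, ν) (l y, s.mapE x y ν) γ = s.mapE x y γ := by
  rcases h with rfl | h
  · simp only [mapE_self]
    exact ⟨.inl rfl, fun _ _ => trivial⟩
  · have := s.m2 x y h ν hν
    rw [mapE_rel h]
    refine ⟨.inr this.1, fun γ hγ => ?_⟩
    rw [mapE_rel this.1, mapE_rel h]
    exact this.2 γ hγ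

theorem relE_linear {x' : MorassNode.{u}} (h : s.relE x y) (h' : s.relE x' y) :
    x = x' ∨ s.rel x x' ∨ s.rel x' x := by
  rcases h with rfl | h
  · rcases h' with rfl | h'
    · exact .inl rfl
    · exact .inr (.inr h')
  · rcases h' with rfl | h'
    · exact .inr (.inl h)
    · exact s.rel_linear _ _ _ h h'

theorem level_le_of_relE (h : s.relE x y) : l x ≤ l y := by
  rcases h with rfl | h
  · exact le_rfl
  · exact (s.monotonicity _ _ h).le

theorem relE_of_linear {x' : MorassNode.{u}} (h : s.relE x y) (h' : s.relE x' y)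
    (hl : l x ≤ l x') : s.relE x x' := by
  rcases relE_linear h h' with rfl | h1 | h1
  · exact .inl rfl
  · exact .inr h1
  · exact absurd (s.monotonicity _ _ h1) (not_lt.2 hl)

/-- `t` is an end-extension of `s`. -/
structure Extends (t s : Stem κ) : Prop where
  lam_le : s.lam ≤ t.lam
  nodes : ∀ x, l x ≤ s.lam → (x ∈ s.nodes ↔ x ∈ t.nodes)
  rel : ∀ x y, l y ≤ s.lam → (s.rel x y ↔ t.rel x y)
  map : ∀ x y, s.rel x y → ∀ γ ≤ o x, s.map x y γ = t.map x y γ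

variable (s) in
open Classical in
/-- The underlying data of the condition with given stem and top set. -/
noncomputable def topData (S : Set Ordinal.{u}) (f c : Ordinal.{u} → Ordinal.{u}) :
    MorassData.{u} where
  nodes := s.nodes ∪ {x | l x = κ.ord ∧ o x ∈ S}
  rel x y := s.rel x y ∨ (l y = κ.ord ∧ o y ∈ S ∧ s.relE x (s.lam, c (o y)))
  map x y γ :=
    if (s.rel x y ∨ (l y = κ.ord ∧ o y ∈ S ∧ s.relE x (s.lam, c (o y)))) ∧ γ ≤ o x then
      if l y = κ.ord then f (s.mapE x (s.lam, c (o y)) γ) else s.map x y γ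
    else 0
  lam := s.lam

variable {S : Set Ordinal.{u}} {τ : Ordinal.{u}} {f c : Ordinal.{u} → Ordinal.{u}}

theorem level_lt (hx : x ∈ s.nodes) : l x < κ.ord := (s.level_le x hx).trans_lt s.lam_lt

theorem topData_map_low (h : s.rel x y) {γ : Ordinal.{u}} (hγ : γ ≤ o x) :
    (s.topData S f c).map x y γ = s.map x y γ := by
  have h1 := (level_lt (s.rel_nodes _ _ h).2).ne
  simp [topData, h, hγ, h1]

theorem topData_image_low (h : s.rel x y) :
    (s.topData S f c).map x y '' Set.Iio (o x) = s.map x y '' Set.Iio (o x) :=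
  Set.image_congr fun _ hγ => topData_map_low h (Set.mem_Iio.1 hγ).le

theorem topData_map_top {β : Ordinal.{u}} (hβ : β ∈ S) (h : s.relE x (s.lam, c β))
    {γ : Ordinal.{u}} (hγ : γ ≤ o x) :
    (s.topData S f c).map x (κ.ord, β) γ = f (s.mapE x (s.lam, c β) γ) := by
  have : (s.rel x (κ.ord, β) ∨ (l (κ.ord, β) = κ.ord ∧ o (κ.ord, β) ∈ S ∧
      s.relE x (s.lam, c (o (κ.ord, β))))) ∧ γ ≤ o x :=
    ⟨.inr ⟨rfl, hβ, h⟩, hγ⟩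
  exact (if_pos this).trans (if_pos rfl)

theorem topData_rel_cases {x y : MorassNode.{u}} (h : (s.topData S f c).rel x y) :
    s.rel x y ∨ ∃ β ∈ S, s.relE x (s.lam, c β) ∧ y = (κ.ord, β) := by
  rcases h with h | ⟨h1, h2, h3⟩
  · exact .inl h
  · exact .inr ⟨o y, h2, h3, Prod.ext h1 rfl⟩

theorem topData_rel_low (hy : l y ≤ s.lam) : (s.topData S f c).rel x y ↔ s.rel x y := by
  refine ⟨fun h => ?_, fun h => .inl h⟩
  rcases h with h | ⟨h, -⟩
  · exact h
  · exact absurd s.lam_lt (not_lt.2 (h ▸ hy))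

theorem topData_rel_top {β : Ordinal.{u}} (hβ : β ∈ S) :
    (s.topData S f c).rel x (κ.ord, β) ↔ s.relE x (s.lam, c β) := by
  refine ⟨fun h => ?_, fun h => .inr ⟨rfl, hβ, h⟩⟩
  rcases h with h | ⟨-, -, h⟩
  · exact absurd (level_lt (s.rel_nodes _ _ h).2) (lt_irrefl _)
  · exact h

theorem topData_nodes_low (hy : l y ≤ s.lam) : y ∈ (s.topData S f c).nodes ↔ y ∈ s.nodes := by
  refine ⟨fun h => ?_, fun h => .inl h⟩
  rcases h with h | ⟨h, -⟩
  · exact h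
  · exact absurd s.lam_lt (not_lt.2 (h ▸ hy))

theorem topData_theta {α : Ordinal.{u}} (hα : α ≤ s.lam) :
    (s.topData S f c).theta α = s.theta α :=
  MorassData.theta_eq_of fun β => by
    rw [topData_nodes_low (show l (α, β) ≤ s.lam from hα)]
    exact (s.left_alignment α hα).1 β

theorem topData_levelsBelow (hy : l y ≤ s.lam) :
    (s.topData S f c).levelsBelow y = s.levelsBelow y := by
  ext α
  exact exists_congr fun x => and_congr_left fun _ => topData_rel_low hy

theorem topData_immRel (hy : l y ≤ s.lam) (h : (s.topData S f c).immRel x y) : s.immRel x y := by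
  refine ⟨(topData_rel_low hy).1 h.1, fun z hz => h.2 z ⟨.inl hz.1, .inl hz.2⟩⟩

theorem top_node_mem (hS : IsEnum S τ f c) (hτ : τ ≤ s.theta s.lam) {β : Ordinal.{u}}
    (hβ : β ∈ S) : (s.lam, c β) ∈ s.nodes :=
  ((s.left_alignment _ le_rfl).1 _).2 ((hS.lt β hβ).trans_le hτ)

theorem top_mapE_lt (hS : IsEnum S τ f c) {β : Ordinal.{u}} (hβ : β ∈ S)
    (h : s.relE x (s.lam, c β)) {γ : Ordinal.{u}} (hγ : γ ≤ o x) :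
    s.mapE x (s.lam, c β) γ < τ := (mapE_le_o h hγ).trans_lt (hS.lt β hβ)

theorem isSLOOP_topData (hS : IsEnum S τ f c) (hT : IsTopSet S)
    (h : (s.topData S f c).rel x y) : IsSLOOP ((s.topData S f c).map x y) (o x + 1) ∧
      (s.topData S f c).map x y (o x) = o y := by
  replace h := topData_rel_cases h
  rcases h with h | ⟨β, hβ, h, rfl⟩
  · refine ⟨(s.m1 x y h).1.congr fun γ hγ => topData_map_low h hγ, ?_⟩
    rw [topData_map_low h le_rfl]
    exact (s.m1 x y h).2
  · refine ⟨((hS.isSLOOP hT).comp (mapE_sloop h) fun γ hγ => top_mapE_lt hS hβ h hγ).congr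
      fun γ hγ => topData_map_top hβ h hγ, ?_⟩
    rw [topData_map_top hβ h le_rfl, mapE_top h]
    exact hS.f_c β hβ

/-- The condition with given stem and top set. -/
noncomputable def toCondition (s : Stem κ) (hS : IsEnum S τ f c) (hT : IsTopSet S)
    (hτ : τ ≤ s.theta s.lam) (hb : ∀ β ∈ S, β < (succ κ).ord) : MorassCondition κ where
  toMorassData := s.topData S f c
  map_eq_zero x y γ h := if_neg h
  lam_lt := s.lam_lt
  nodes_bounded := by
    rintro x (hx | hx)
    · refine .inl ⟨s.level_le x hx, ?_⟩
      have h1 := s.left_alignment (l x) (s.level_le x hx)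
      exact ((h1.1 (o x)).1 hx).trans h1.2.2
    · exact .inr ⟨hx.1, hb _ hx.2⟩
  rel_nodes := by
    intro x y h
    replace h := topData_rel_cases h
    rcases h with h | ⟨β, hβ, h, rfl⟩
    · exact ⟨.inl (s.rel_nodes _ _ h).1, .inl (s.rel_nodes _ _ h).2⟩
    · refine ⟨.inl ?_, .inr ⟨rfl, hβ⟩⟩
      rcases h with rfl | h
      · exact top_node_mem hS hτ hβ
      · exact (s.rel_nodes _ _ h).1
  rel_irrefl := by
    intro x h
    replace h := topData_rel_cases h
    rcases h with h | ⟨β, hβ, h, rfl⟩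
    · exact ne_of_rel h rfl
    · exact absurd (level_le_of_relE h) (not_le.2 s.lam_lt)
  rel_trans := by
    intro x y z h1 h2
    replace h2 := topData_rel_cases h2
    rcases h2 with h2 | ⟨β, hβ, h2, rfl⟩
    · replace h1 := topData_rel_cases h1
      rcases h1 with h1 | ⟨β, hβ, h1, rfl⟩
      · exact .inl (s.rel_trans _ _ _ h1 h2)
      · exact absurd (level_lt (s.rel_nodes _ _ h2).1) (lt_irrefl _)
    · replace h1 := topData_rel_cases h1
      rcases h1 with h1 | ⟨β', hβ', h1, rfl⟩
      · exact (topData_rel_top hβ).2 (.inr (rel_of_rel_relE h1 h2))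
      · exact absurd (level_le_of_relE h2) (not_le.2 s.lam_lt)
  rel_wellOrder := by
    intro y A hA h
    have hlow : ∀ x ∈ A, ∀ x' ∈ A, l x ≤ l x' → x' = x ∨ (s.topData S f c).rel x x' := by
      intro x hx x' hx' hl
      have := h x hx
      have h2 := h x' hx'
      rcases topData_rel_cases this with h1 | ⟨β, hβ, h1, rfl⟩
      · rw [topData_rel_low (s.level_le _ (s.rel_nodes _ _ h1).2)] at h2
        rcases relE_of_linear (.inr h1) (.inr h2) hl with e | e
        · exact .inl e.symm
        · exact .inr (.inl e)
      · rw [topData_rel_top hβ] at h2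
        rcases relE_of_linear h1 h2 hl with e | e
        · exact .inl e.symm
        · exact .inr (.inl e)
    -- Predecessors of one node are linearly ordered with increasing levels, so the one of least
    -- level is the least.
    obtain ⟨m, hm, hmin⟩ := (InvImage.wf (fun x : MorassNode.{u} => l x)
      (wellFounded_lt (α := Ordinal.{u}))).has_min A hA
    exact ⟨m, hm, fun x hx => hlow m hm x hx (not_lt.1 (hmin x hx))⟩
  map_le := by
    intro x y h γ hγ
    obtain ⟨h1, h2⟩ := isSLOOP_topData hS hT h
    rcases hγ.lt_or_eq with hγ | rfl
    · exact (h2 ▸ h1.2.2.2 _ _ hγ (lt_add_one _)).le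
    · exact h2.le
  left_alignment := by
    intro α hα
    rw [topData_theta hα]
    refine ⟨fun β => ?_, (s.left_alignment α hα).2⟩
    rw [topData_nodes_low (show l (α, β) ≤ s.lam from hα)]
    exact (s.left_alignment α hα).1 β
  zero_mem_top := .inr ⟨rfl, hT.zero_mem⟩
  succ_mem_top := by
    have key : ∀ β, (κ.ord, β) ∈ (s.topData S f c).nodes ↔ β ∈ S := by
      refine fun β => ⟨fun h => ?_, fun h => .inr ⟨rfl, h⟩⟩
      rcases h with h | h
      · exact absurd (level_lt h) (lt_irrefl _)
      · exact h.2
    intro β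
    rw [key, key]
    exact hT.succ_mem β
  top_enum := by
    have key : ∀ β, (κ.ord, β) ∈ (s.topData S f c).nodes ↔ β ∈ S := by
      refine fun β => ⟨fun h => ?_, fun h => .inr ⟨rfl, h⟩⟩
      rcases h with h | h
      · exact absurd (level_lt h) (lt_irrefl _)
      · exact h.2
    refine ⟨τ, f, fun ν _ μ hμ h => hS.strictMono _ _ h hμ, ?_, ?_, fun ν hν => ?_⟩
    · ext β
      rw [Set.mem_ofPred_eq, key]
      constructor
      · rintro ⟨ν, hν, rfl⟩
        exact hS.mem ν hν
      · exact fun h => ⟨c β, hS.lt β h, hS.f_c β h⟩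
    · rw [show (s.topData S f c).lam = s.lam from rfl, topData_theta le_rfl]
      exact hτ
    · rw [topData_rel_top (hS.mem ν hν), hS.c_f ν hν]
      exact .inl rfl
  monotonicity := by
    intro x y h
    replace h := topData_rel_cases h
    rcases h with h | ⟨β, hβ, h, rfl⟩
    · exact s.monotonicity _ _ h
    · exact (level_le_of_relE h).trans_lt s.lam_lt
  commutativity := by
    intro x y z h1 h2 γ hγ
    replace h2 := topData_rel_cases h2
    rcases h2 with h2 | ⟨β, hβ, h2, rfl⟩
    · replace h1 := topData_rel_cases h1
      rcases h1 with h1 | ⟨β, hβ, h1, rfl⟩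
      · have := mapE_le_o (.inr h1 : s.relE x y) hγ
        rw [mapE_rel h1] at this
        rw [topData_map_low h1 hγ, topData_map_low h2 this,
          topData_map_low (s.rel_trans _ _ _ h1 h2) hγ]
        exact s.commutativity _ _ _ h1 h2 γ hγ
      · exact absurd (level_lt (s.rel_nodes _ _ h2).1) (lt_irrefl _)
    · replace h1 := topData_rel_cases h1
      rcases h1 with h1 | ⟨β', hβ', h1, rfl⟩
      · have := mapE_le_o (.inr h1 : s.relE x y) hγ
        rw [mapE_rel h1] at this
        rw [topData_map_low h1 hγ, topData_map_top hβ h2 this,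
          topData_map_top hβ (.inr (rel_of_rel_relE h1 h2)) hγ, ← mapE_rel h1,
          mapE_comm (.inr h1) h2 hγ]
      · exact absurd (level_le_of_relE h2) (not_le.2 s.lam_lt)
  m1 x y h := isSLOOP_topData hS hT h
  m2 := by
    intro x y h ν hν
    replace h := topData_rel_cases h
    rcases h with h | ⟨β, hβ, h, rfl⟩
    · obtain ⟨h1, h2⟩ := s.m2 x y h ν hν
      rw [topData_map_low h hν.le]
      refine ⟨.inl h1, fun γ hγ => ?_⟩
      rw [topData_map_low h1 hγ, topData_map_low h (hγ.trans hν.le)]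
      exact h2 γ hγ
    · have hlt := top_mapE_lt hS hβ h hν.le
      obtain ⟨h1, h2⟩ := relE_m2 h hν
      rw [topData_map_top hβ h hν.le]
      have h3 : s.relE (l x, ν) (s.lam, c (f (s.mapE x (s.lam, c β) ν))) := by
        rw [hS.c_f _ hlt]; exact h1
      refine ⟨(topData_rel_top (hS.mem _ hlt)).2 h3, fun γ hγ => ?_⟩
      refine (topData_map_top (hS.mem _ hlt) h3 hγ).trans ?_
      rw [topData_map_top hβ h (hγ.trans hν.le), hS.c_f _ hlt]
      exact congrArg f (h2 γ hγ)
  m3 := by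
    rintro y (hy | ⟨hy1, hy2⟩)
    · rw [topData_levelsBelow (s.level_le y hy)]
      exact s.m3 y hy
    · obtain ⟨yl, β⟩ := y
      obtain rfl : yl = κ.ord := hy1
      have hβ : β ∈ S := hy2
      intro γ hγ hl hu
      -- The levels below a top node are `λ` and the levels below its predecessor on level `λ`, so
      -- nothing accumulates above `λ`.
      have hlev : ∀ α, α ∈ (s.topData S f c).levelsBelow (κ.ord, β) ↔
          α = s.lam ∨ α ∈ s.levelsBelow (s.lam, c β) := by
        intro α
        constructor
        · rintro ⟨x, hx, rfl⟩
          rw [topData_rel_top hβ] at hx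
          rcases hx with rfl | hx
          · exact .inl rfl
          · exact .inr ⟨x, hx, rfl⟩
        · rintro (rfl | ⟨x, hx, rfl⟩)
          · exact ⟨_, (topData_rel_top hβ).2 (.inl rfl), rfl⟩
          · exact ⟨x, (topData_rel_top hβ).2 (.inr hx), rfl⟩
      rw [hlev]
      rcases lt_trichotomy γ s.lam with h | h | h
      · refine .inr (s.m3 _ (top_node_mem hS hτ hβ) γ h hl fun ε hε => ?_)
        obtain ⟨α, hα, h1, h2⟩ := hu ε hε
        rcases (hlev α).1 hα with rfl | hα
        · exact absurd h (not_lt.2 h2.le)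
        · exact ⟨α, hα, h1, h2⟩
      · exact .inl h
      · obtain ⟨α, hα, h1, h2⟩ := hu s.lam h
        rcases (hlev α).1 hα with rfl | ⟨x, hx, rfl⟩
        · exact absurd h1 (lt_irrefl _)
        · exact absurd (s.level_le x (s.rel_nodes _ _ hx).1) (not_le.2 h1)
  m4 := by
    intro y hy hl h
    rw [topData_theta hl] at h
    rw [topData_levelsBelow hl]
    exact s.m4 y ((topData_nodes_low hl).1 hy) h
  m5 := by
    rintro y hy hu
    rcases hy with hy | ⟨hy1, hy2⟩
    · have hl := s.level_le y hy
      rw [topData_levelsBelow hl] at hu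
      rw [s.m5 y hy hu]
      ext β
      refine exists_congr fun x => ?_
      rw [topData_rel_low hl]
      refine and_congr_right fun h => ?_
      rw [topData_image_low h]
    · obtain ⟨yl, β⟩ := y
      obtain rfl : yl = κ.ord := hy1
      -- Levels below a top node are bounded by `λ < κ`, so M.5 is vacuous there.
      obtain ⟨α, ⟨x, hx, rfl⟩, h1, h2⟩ := hu s.lam s.lam_lt
      rw [topData_rel_top (show β ∈ S from hy2)] at hx
      exact absurd (level_le_of_relE hx) (not_le.2 h1)
  m6 := by
    intro x y h hl hx ν hν
    have hi := topData_immRel hl h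
    rw [topData_image_low hi.1] at hν
    obtain ⟨h1, h2⟩ := s.m6 x y hi hx ν hν
    refine ⟨.inl h1, fun γ hγ => ?_⟩
    rw [topData_map_low h1 hγ.le, topData_map_low hi.1 hγ.le]
    exact h2 γ hγ
  m7 := by
    intro x y h hl α h1 h2 hx hν hα
    have hi := topData_immRel hl h
    rw [topData_image_low hi.1] at hν
    obtain ⟨γ, hγ⟩ := s.m7 x y hi α h1 h2 hx hν fun ν hν => by
      obtain ⟨γ, hγ⟩ := hα ν hν
      rw [topData_map_low hi.1 hν.le] at hγ
      exact ⟨γ, (topData_rel_low (y := (l y, s.map x y ν)) hl).1 hγ⟩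
    exact ⟨γ, .inl hγ⟩

end Stem

theorem Stem.topSet_toCondition {κ : Cardinal.{u}} (s : Stem κ) {S : Set Ordinal.{u}}
    {τ : Ordinal.{u}} {f c : Ordinal.{u} → Ordinal.{u}} (hS : IsEnum S τ f c) (hT : IsTopSet S)
    (hτ : τ ≤ s.theta s.lam) (hb : ∀ β ∈ S, β < (succ κ).ord) :
    {β | (κ.ord, β) ∈ (s.toCondition hS hT hτ hb).nodes} = S := by
  ext β
  refine ⟨fun h => ?_, fun h => .inr ⟨rfl, h⟩⟩
  rcases h with h | h
  · exact absurd (Stem.level_lt h) (lt_irrefl _)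
  · exact h.2

/-! ### Conditions as stems with a top set -/

namespace MorassCondition

variable {κ : Cardinal.{u}} {p q : MorassCondition κ} {x y : MorassNode.{u}}

/-- The top set `{β | ⟨κ, β⟩ ∈ S^p}`. -/
def topSet (p : MorassCondition κ) : Set Ordinal.{u} := {β | (κ.ord, β) ∈ p.nodes}

theorem isTopSet (p : MorassCondition κ) : IsTopSet p.topSet :=
  ⟨p.zero_mem_top, p.succ_mem_top⟩

theorem exists_isEnum (p : MorassCondition κ) : ∃ (τ : Ordinal.{u})
    (f c : Ordinal.{u} → Ordinal.{u}), IsEnum p.topSet τ f c ∧ τ ≤ p.theta p.lam ∧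
      ∀ ν < τ, p.rel (p.lam, ν) (κ.ord, f ν) := by
  classical
  obtain ⟨τ, f, h1, h2, h3, h4⟩ := p.top_enum
  have key : ∀ β ∈ p.topSet, ∃ ν < τ, f ν = β := by
    intro β hβ
    have : β ∈ f '' Set.Iio τ := h2 ▸ hβ
    exact this
  choose! c hc hc' using key
  refine ⟨τ, f, c, ⟨fun ν hν => ?_, hc, fun ν hν => ?_, hc', fun ν μ h hμ => ?_⟩, h3, h4⟩
  · have : f ν ∈ f '' Set.Iio τ := ⟨ν, hν, rfl⟩
    rw [h2] at this
    exact this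
  · have : f ν ∈ p.topSet := by
      have : f ν ∈ f '' Set.Iio τ := ⟨ν, hν, rfl⟩
      rw [h2] at this
      exact this
    exact h1.injOn (hc _ this) hν (hc' _ this)
  · exact h1 (h.trans hμ) hμ h

theorem topSet_lt (p : MorassCondition κ) {β : Ordinal.{u}} (hβ : β ∈ p.topSet) :
    β < (succ κ).ord := (p.node_lt hβ).2

theorem rel_linear (p : MorassCondition κ) {x x' y : MorassNode.{u}} (h : p.rel x y)
    (h' : p.rel x' y) : x = x' ∨ p.rel x x' ∨ p.rel x' x := by
  obtain ⟨m, hm, hall⟩ := p.rel_wellOrder y {x, x'} ⟨x, by simp⟩ (by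
    rintro w (rfl | rfl)
    · exact h
    · exact h')
  rcases hm with rfl | rfl
  · rcases hall x' (by simp) with h | h
    · exact .inl h.symm
    · exact .inr (.inl h)
  · rcases hall x (by simp) with h | h
    · exact .inl h
    · exact .inr (.inr h)

theorem rel_of_level_lt (p : MorassCondition κ) {x x' y : MorassNode.{u}} (h : p.rel x y)
    (h' : p.rel x' y) (hl : l x < l x') : p.rel x x' := by
  rcases p.rel_linear h h' with rfl | h | h
  · exact absurd hl (lt_irrefl _)
  · exact h
  · exact absurd (p.monotonicity _ _ h) (not_lt.2 hl.le)

theorem eq_of_level_eq (p : MorassCondition κ) {x x' y : MorassNode.{u}} (h : p.rel x y)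
    (h' : p.rel x' y) (hl : l x = l x') : x = x' := by
  rcases p.rel_linear h h' with h | h | h
  · exact h
  · exact absurd (p.monotonicity _ _ h) (not_lt.2 hl.ge)
  · exact absurd (p.monotonicity _ _ h) (not_lt.2 hl.le)

/-- Nodes of `p` have level at most `λ^p` or `κ`. -/
theorem level_cases (p : MorassCondition κ) (hx : x ∈ p.nodes) :
    (l x ≤ p.lam ∧ o x < κ.ord) ∨ ∃ β ∈ p.topSet, x = (κ.ord, β) := by
  rcases p.nodes_bounded x hx with h | h
  · exact .inl h
  · have e : x = (κ.ord, o x) := Prod.ext h.1 rfl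
    exact .inr ⟨o x, show (κ.ord, o x) ∈ p.nodes from e ▸ hx, e⟩

theorem level_le_kappa (p : MorassCondition κ) (hx : x ∈ p.nodes) : l x ≤ κ.ord := by
  rcases p.nodes_bounded x hx with h | h
  · exact (h.1.trans_lt p.lam_lt).le
  · exact h.1.le

theorem level_lt_of_rel (p : MorassCondition κ) (h : p.rel x y) :
    l x ≤ p.lam ∧ o x < κ.ord := by
  rcases p.nodes_bounded x (p.rel_nodes _ _ h).1 with h' | h'
  · exact h'
  · exact absurd (p.monotonicity _ _ h)
      (not_lt.2 (h'.1 ▸ p.level_le_kappa (p.rel_nodes _ _ h).2))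

variable {τ : Ordinal.{u}} {f c : Ordinal.{u} → Ordinal.{u}}

/-- The predecessors of `⟨κ, β⟩` are linearly ordered and one of them, `⟨λ, c β⟩`, sits on the
highest possible level. So a top node carries no tree information beyond this predecessor. -/
theorem rel_top_iff (hS : IsEnum p.topSet τ f c)
    (hr : ∀ ν < τ, p.rel (p.lam, ν) (κ.ord, f ν)) {β : Ordinal.{u}} (hβ : β ∈ p.topSet) :
    p.rel x (κ.ord, β) ↔ x = (p.lam, c β) ∨ p.rel x (p.lam, c β) := by
  have hc := hr _ (hS.lt β hβ)
  rw [hS.f_c β hβ] at hc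
  constructor
  · intro h
    rcases p.rel_linear h hc with h1 | h1 | h1
    · exact .inl h1
    · exact .inr h1
    · exact absurd (p.monotonicity _ _ h1) (not_lt.2 (p.level_lt_of_rel h).1)
  · rintro (rfl | h)
    · exact hc
    · exact p.rel_trans _ _ _ h hc

/-- M.2 puts `⟨λ, γ⟩` below the top node whose order is the value at `γ`, and a top node has only
one predecessor on level `λ`, namely its collapse. Hence all maps from level `λ` to level `κ` are
restrictions of the enumeration. -/
theorem map_top (hS : IsEnum p.topSet τ f c)
    (hr : ∀ ν < τ, p.rel (p.lam, ν) (κ.ord, f ν)) {ν : Ordinal.{u}} (hν : ν < τ) {γ : Ordinal.{u}}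
    (hγ : γ ≤ ν) : p.map (p.lam, ν) (κ.ord, f ν) γ = f γ := by
  have h := hr ν hν
  rcases hγ.lt_or_eq with hγ' | rfl
  · have h2 := (p.m2 _ _ h γ hγ').1
    set β := p.map (p.lam, ν) (κ.ord, f ν) γ with hβ
    have hm : β ∈ p.topSet := (p.rel_nodes _ _ h2).2
    have h3 := hr _ (hS.lt β hm)
    rw [hS.f_c β hm] at h3
    have e := p.eq_of_level_eq h2 h3 rfl
    have e' : γ = c β := congrArg Prod.snd e
    rw [e', hS.f_c β hm]
  · exact (p.m1 _ _ h).2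

/-- The part of a condition up to its top level. -/
def stem (p : MorassCondition κ) : Stem κ where
  nodes := {x | x ∈ p.nodes ∧ l x ≤ p.lam}
  rel x y := p.rel x y ∧ l y ≤ p.lam
  map := p.map
  lam := p.lam
  lam_lt := p.lam_lt
  level_le x hx := hx.2
  rel_nodes x y h := ⟨⟨(p.rel_nodes _ _ h.1).1, (p.level_lt_of_rel h.1).1⟩,
    (p.rel_nodes _ _ h.1).2, h.2⟩
  rel_trans x y z h1 h2 := ⟨p.rel_trans _ _ _ h1.1 h2.1, h2.2⟩
  rel_linear x x' y h1 h2 := by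
    rcases p.rel_linear h1.1 h2.1 with h | h | h
    · exact .inl h
    · exact .inr (.inl ⟨h, (p.level_lt_of_rel h2.1).1⟩)
    · exact .inr (.inr ⟨h, (p.level_lt_of_rel h1.1).1⟩)
  left_alignment α hα := by
    have := p.left_alignment α hα
    have e : MorassData.theta ⟨{x | x ∈ p.nodes ∧ l x ≤ p.lam},
        fun x y => p.rel x y ∧ l y ≤ p.lam, p.map, p.lam⟩ α = p.theta α :=
      MorassData.theta_eq_of fun β => ⟨fun h => (this.1 β).1 h.1, fun h => ⟨(this.1 β).2 h, hα⟩⟩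
    rw [e]
    exact ⟨fun β => ⟨fun h => (this.1 β).1 h.1, fun h => ⟨(this.1 β).2 h, hα⟩⟩, this.2⟩
  monotonicity x y h := p.monotonicity x y h.1
  commutativity x y z h1 h2 := p.commutativity x y z h1.1 h2.1
  m1 x y h := p.m1 x y h.1
  m2 x y h ν hν := ⟨⟨(p.m2 x y h.1 ν hν).1, h.2⟩, (p.m2 x y h.1 ν hν).2⟩
  m3 y hy γ hγ hl hu := by
    obtain ⟨x, h1, h2⟩ := p.m3 y hy.1 γ hγ hl fun ε hε => by
      obtain ⟨α, ⟨x, hx, h0⟩, h1⟩ := hu ε hε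
      exact ⟨α, ⟨x, hx.1, h0⟩, h1⟩
    exact ⟨x, ⟨h1, hy.2⟩, h2⟩
  m4 y hy h ε hε := by
    have e : MorassData.theta ⟨{x | x ∈ p.nodes ∧ l x ≤ p.lam},
        fun x y => p.rel x y ∧ l y ≤ p.lam, p.map, p.lam⟩ (l y) = p.theta (l y) :=
      MorassData.theta_eq_of fun β => ⟨fun h => ((p.left_alignment _ hy.2).1 β).1 h.1,
        fun h => ⟨((p.left_alignment _ hy.2).1 β).2 h, hy.2⟩⟩
    rw [e] at h
    obtain ⟨α, ⟨x, hx, h0⟩, h1⟩ := p.m4 y hy.1 hy.2 h ε hε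
    exact ⟨α, ⟨x, ⟨hx, hy.2⟩, h0⟩, h1⟩
  m5 y hy hu := by
    rw [p.m5 y hy.1 fun ε hε => by
      obtain ⟨α, ⟨x, hx, h0⟩, h1⟩ := hu ε hε
      exact ⟨α, ⟨x, hx.1, h0⟩, h1⟩]
    ext β
    exact exists_congr fun x => and_congr_left fun _ => (and_iff_left hy.2).symm
  m6 x y h hx ν hν := by
    have h' : p.immRel x y := ⟨h.1.1, fun z hz =>
      h.2 z ⟨⟨hz.1, (p.level_lt_of_rel hz.2).1⟩, hz.2, h.1.2⟩⟩
    obtain ⟨h1, h2⟩ := p.m6 x y h' h.1.2 hx ν hν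
    exact ⟨⟨h1, h.1.2⟩, h2⟩
  m7 x y h α h1 h2 hx hν hα := by
    have h' : p.immRel x y := ⟨h.1.1, fun z hz =>
      h.2 z ⟨⟨hz.1, (p.level_lt_of_rel hz.2).1⟩, hz.2, h.1.2⟩⟩
    obtain ⟨γ, hγ⟩ := p.m7 x y h' h.1.2 α h1 h2 hx hν fun ν hν => by
      obtain ⟨γ, hγ⟩ := hα ν hν
      exact ⟨γ, hγ.1⟩
    exact ⟨γ, hγ, h.1.2⟩

theorem stem_theta (p : MorassCondition κ) {α : Ordinal.{u}} (hα : α ≤ p.lam) :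
    p.stem.theta α = p.theta α :=
  MorassData.theta_eq_of fun β => ⟨fun h => ((p.left_alignment _ hα).1 β).1 h.1,
    fun h => ⟨((p.left_alignment _ hα).1 β).2 h, hα⟩⟩

/-- A criterion for a condition with given stem and top set to extend `p`. -/
theorem toCondition_le {t : Stem κ} {S' : Set Ordinal.{u}} {τ' : Ordinal.{u}}
    {f' c' : Ordinal.{u} → Ordinal.{u}} (hS' : IsEnum S' τ' f' c') (hT' : IsTopSet S')
    (hτ' : τ' ≤ t.theta t.lam) (hb' : ∀ β ∈ S', β < (succ κ).ord)
    (hS : IsEnum p.topSet τ f c) (hr : ∀ ν < τ, p.rel (p.lam, ν) (κ.ord, f ν))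
    (hext : t.Extends p.stem) (hlt : p.lam < t.lam) (hm : t.IsMangal p.lam)
    (hsub : p.topSet ⊆ S')
    (hnew : ∀ ν < τ, t.rel (p.lam, ν) (t.lam, c' (f ν)) ∧
      ∀ γ ≤ ν, t.map (p.lam, ν) (t.lam, c' (f ν)) γ = c' (f γ)) :
    t.toCondition hS' hT' hτ' hb' ≤ p := by
  have low : ∀ x, l x ≤ p.lam → (x ∈ p.nodes ↔ x ∈ t.nodes) := fun x hx =>
    (and_iff_left hx).symm.trans (hext.nodes x hx)
  have lowrel : ∀ x y, l y ≤ p.lam → (p.rel x y ↔ t.rel x y) := fun x y hy =>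
    (and_iff_left hy).symm.trans (hext.rel x y hy)
  have lowmap : ∀ x y, p.rel x y → l y ≤ p.lam → ∀ γ ≤ o x, p.map x y γ = t.map x y γ :=
    fun x y h hy => hext.map x y ⟨h, hy⟩
  have hnew' : ∀ β ∈ p.topSet, t.rel (p.lam, c β) (t.lam, c' β) ∧
      ∀ γ ≤ c β, t.map (p.lam, c β) (t.lam, c' β) γ = c' (f γ) := by
    intro β hβ
    have := hnew (c β) (hS.lt β hβ)
    rwa [hS.f_c β hβ] at this
  -- In both conditions the predecessors of `⟨κ, β⟩` up to `λ^p` are `⟨λ^p, c β⟩` and what lies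
  -- below it.
  have toprel : ∀ β ∈ p.topSet, ∀ x, l x ≤ p.lam → (p.rel x (κ.ord, β) ↔
      t.relE x (t.lam, c' β)) := by
    intro β hβ x hx
    rw [rel_top_iff hS hr hβ, lowrel x (p.lam, c β) le_rfl]
    constructor
    · exact fun h => .inr (Stem.rel_of_relE_rel h (hnew' β hβ).1)
    · exact fun h => Stem.relE_of_linear h (.inr (hnew' β hβ).1) hx
  rw [le_def]
  refine ⟨fun x hx => ?_, fun x hx _ => ?_, fun x hx y hy => ?_, fun x y hxy γ hγ => ?_,
    hm.1, fun x y hxy h1 h2 => ?_⟩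
  · rcases p.level_cases hx with ⟨h, -⟩ | ⟨β, hβ, rfl⟩
    · exact .inl ((low x h).1 hx)
    · exact .inr ⟨rfl, hsub hβ⟩
  · rw [low x hx]
    exact (Stem.topData_nodes_low (hx.trans hm.1)).symm
  · rcases p.level_cases hy with ⟨h, -⟩ | ⟨β, hβ, rfl⟩
    · rw [lowrel x y h]
      exact (Stem.topData_rel_low (h.trans hm.1)).symm
    · refine Iff.trans ?_ (Stem.topData_rel_top (hsub hβ)).symm
      rcases p.level_cases hx with ⟨h, -⟩ | ⟨β', hβ', rfl⟩
      · exact toprel β hβ x h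
      · refine iff_of_false (fun h => ?_) (fun h => ?_)
        · exact lt_irrefl κ.ord (p.monotonicity _ _ h)
        · exact absurd (Stem.level_le_of_relE h) (not_le.2 t.lam_lt)
  · rcases p.level_cases (p.rel_nodes _ _ hxy).2 with ⟨h, -⟩ | ⟨β, hβ, rfl⟩
    · rw [lowmap x y hxy h γ hγ]
      exact (Stem.topData_map_low ((lowrel x y h).1 hxy) hγ).symm
    · have hx := (p.level_lt_of_rel hxy).1
      have h1 := (toprel β hβ x hx).1 hxy
      refine Eq.trans ?_ (Stem.topData_map_top (hsub hβ) h1 hγ).symm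
      obtain ⟨h2, h3⟩ := hnew' β hβ
      -- Both maps factor through `⟨λ^p, c β⟩`. From there the old one is `f` and the new one is `f'
      -- ∘ c' ∘ f`, which is `f` again.
      have h4 : t.relE x (p.lam, c β) := Stem.relE_of_linear h1 (.inr h2) hx
      have h7 := Stem.mapE_le_o h4 hγ
      rw [← Stem.mapE_comm h4 (.inr h2) hγ, Stem.mapE_rel h2, h3 _ h7]
      have h8 : f (t.mapE x (p.lam, c β) γ) ∈ p.topSet :=
        hS.mem _ (h7.trans_lt (hS.lt β hβ))
      rw [hS'.f_c _ (hsub h8)]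
      have h9 := hr (c β) (hS.lt β hβ)
      rcases h4 with rfl | h4
      · rw [Stem.mapE_self]
        have := map_top hS hr (hS.lt β hβ) hγ
        rwa [hS.f_c β hβ] at this
      · have h5 := (lowrel x (p.lam, c β) le_rfl).2 h4
        rw [hS.f_c β hβ] at h9
        rw [← p.commutativity _ _ _ h5 h9 γ hγ, Stem.mapE_rel h4,
          lowmap _ _ h5 le_rfl γ hγ]
        rw [Stem.mapE_rel h4] at h7
        have := map_top hS hr (hS.lt β hβ) (γ := t.map x (p.lam, c β) γ) h7
        rwa [hS.f_c β hβ] at this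
  · rcases Stem.topData_rel_cases hxy with h | ⟨β, hβ, h, rfl⟩
    · obtain ⟨z, hz, e, h3, h4⟩ := hm.2 x y h h1 h2
      exact ⟨z, .inl hz, e, .inl h3, .inl h4⟩
    · have : t.rel x (t.lam, c' β) := by
        rcases h with rfl | h
        · exact absurd h1 (not_lt.2 hm.1)
        · exact h
      obtain ⟨z, hz, e, h3, h4⟩ := hm.2 x _ this h1 hlt
      exact ⟨z, .inl hz, e, .inl h3, (Stem.topData_rel_top hβ).2 (.inr h4)⟩

end MorassCondition

/-! ## Powers of `ω` -/

namespace Ordinal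

/-- The remainder modulo `ω ^ σ` lies below some `ω ^ ρ` with `ρ < σ` and is divisible by it, hence
zero. This yields M.7 on the new levels. -/
theorem omega0_opow_dvd_of_forall_lt {σ ξ : Ordinal.{u}} (hσ : IsSuccLimit σ)
    (h : ∀ ρ < σ, ω ^ ρ ∣ ξ) : ω ^ σ ∣ ξ := by
  have hr : ξ % ω ^ σ < ω ^ σ := Ordinal.mod_lt _ (Ordinal.opow_pos _ omega0_pos).ne'
  have hd := Ordinal.div_add_mod ξ (ω ^ σ)
  obtain ⟨ρ, hρ, hlt⟩ := (Ordinal.lt_opow_of_isSuccLimit omega0_ne_zero hσ).1 hr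
  have h1 : ω ^ ρ ∣ ω ^ σ * (ξ / ω ^ σ) :=
    (Ordinal.opow_dvd_opow _ hρ.le).trans (dvd_mul_right _ _)
  have h2 := h ρ hρ
  rw [← hd, Ordinal.dvd_add_iff h1] at h2
  have h3 : ξ % ω ^ σ = 0 := by
    by_contra h0
    exact absurd (Ordinal.le_of_dvd h0 h2) (not_le.2 hlt)
  rw [h3, add_zero] at hd
  exact ⟨_, hd.symm⟩

/-- If `δ` were not a multiple, no multiple would lie strictly between `ω ^ σ * (δ / ω ^ σ)` and
`δ`. This yields M.3 on the new levels. -/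
theorem omega0_opow_dvd_of_unbounded {σ δ : Ordinal.{u}}
    (h : ∀ ε < δ, ∃ η, ω ^ σ ∣ η ∧ ε < η ∧ η < δ) : ω ^ σ ∣ δ := by
  have hpos : (0 : Ordinal.{u}) < ω ^ σ := Ordinal.opow_pos _ omega0_pos
  have hr : δ % ω ^ σ < ω ^ σ := Ordinal.mod_lt _ hpos.ne'
  have hd := Ordinal.div_add_mod δ (ω ^ σ)
  by_cases h0 : δ % ω ^ σ = 0
  · rw [h0, add_zero] at hd
    exact ⟨_, hd.symm⟩
  have hlt : ω ^ σ * (δ / ω ^ σ) < δ := by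
    conv_rhs => rw [← hd]
    exact lt_add_of_pos_right _ (pos_iff_ne_zero.2 h0)
  obtain ⟨η, ⟨m, rfl⟩, h1, h2⟩ := h _ hlt
  have h3 : δ / ω ^ σ < m := (mul_lt_mul_iff_right₀ hpos).1 h1
  have h4 : m ≤ δ / ω ^ σ := (Ordinal.mul_le_iff_le_div hpos.ne').1 h2.le
  exact absurd h3 (not_lt.2 h4)

/-- Here `ξ = ω ^ σ * (ω * k)` and `ω * k` is a limit, so the next multiple of `ω ^ σ` after `ε` is
still below `ξ`. This yields M.4 on the new levels. -/
theorem exists_omega0_opow_dvd_between {σ ξ ε : Ordinal.{u}} (h : ω ^ (σ + 1) ∣ ξ) (hε : ε < ξ) :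
    ∃ η, ω ^ σ ∣ η ∧ ε < η ∧ η < ξ := by
  have hpos : (0 : Ordinal.{u}) < ω ^ σ := Ordinal.opow_pos _ omega0_pos
  obtain ⟨k, rfl⟩ := h
  rw [Ordinal.opow_add, Ordinal.opow_one, mul_assoc] at hε ⊢
  have hk : 0 < k := pos_iff_ne_zero.2 (by
    rintro rfl
    simp at hε)
  have h1 : ε / ω ^ σ < ω * k := (Ordinal.lt_mul_iff_div_lt hpos.ne').1 hε
  have hl : IsSuccLimit (ω * k) := by
    rcases exists_add_one_or_isSuccLimit (ω * k) with e | ⟨a, e⟩ | e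
    · rw [e] at h1
      exact absurd h1 (by simp)
    · have h1 : ω ∣ a + 1 := ⟨k, e.symm⟩
      have hd := Ordinal.div_add_mod a ω
      have hm : a % ω < ω := Ordinal.mod_lt _ omega0_ne_zero
      rw [← hd, add_assoc, Ordinal.dvd_add_iff (dvd_mul_right _ _)] at h1
      have h2 : a % ω + 1 < ω := isSuccLimit_omega0.add_one_lt hm
      exact absurd (Ordinal.le_of_dvd (by simp) h1) (not_le.2 h2)
    · exact e
  have h2 : ε / ω ^ σ + 1 < ω * k := hl.add_one_lt h1
  exact ⟨ω ^ σ * (ε / ω ^ σ + 1), dvd_mul_right _ _, not_le.1 fun hc =>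
      absurd ((Ordinal.mul_le_iff_le_div hpos.ne').1 hc) (not_le.2 (lt_add_one _)),
    (mul_lt_mul_iff_right₀ hpos).2 h2⟩

theorem lt_sInf_compl_iff {A : Set Ordinal.{u}} (hA : ∀ β ∈ A, ∀ γ ≤ β, γ ∈ A) {b : Ordinal.{u}}
    (hb : b ∉ A) (β : Ordinal.{u}) : β ∈ A ↔ β < sInf {γ | γ ∉ A} := by
  constructor
  · intro h
    by_contra hc
    have := csInf_mem (s := {γ | γ ∉ A}) ⟨b, hb⟩
    exact this (hA β h _ (not_lt.1 hc))
  · intro h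
    by_contra hc
    exact absurd (csInf_le' (s := {γ | γ ∉ A}) hc) (not_le.2 h)

end Ordinal

/-! ## Extending a stem -/

namespace Stem

variable {κ : Cardinal.{u}}

/-- A way to put the nodes of the top level of a stem below new nodes: for `σ` in `dom`, the nodes
of order `σ` get the node of order `nu σ` as a predecessor, with the map `h σ`. -/
structure Bottom (s : Stem κ) where
  dom : Set Ordinal.{u}
  nu : Ordinal.{u} → Ordinal.{u}
  h : Ordinal.{u} → Ordinal.{u} → Ordinal.{u}
  nu_lt : ∀ σ ∈ dom, nu σ < s.theta s.lam
  sloop : ∀ σ ∈ dom, IsSLOOP (h σ) (nu σ + 1)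
  h_top : ∀ σ ∈ dom, h σ (nu σ) = σ
  m2 : ∀ σ ∈ dom, ∀ μ < nu σ, h σ μ ∈ dom ∧ nu (h σ μ) = μ ∧ ∀ γ ≤ μ, h (h σ μ) γ = h σ γ
  m6 : ∀ σ ∈ dom, IsSuccLimit (nu σ) → ∀ ν, IsLUB (h σ '' Set.Iio (nu σ)) ν →
    ν ∈ dom ∧ nu ν = nu σ ∧ ∀ γ < nu σ, h ν γ = h σ γ

/-- The nodes added above the top level of a stem. -/
def IsNew (s : Stem κ) (ρ : Ordinal.{u}) (x : MorassNode.{u}) : Prop :=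
  s.lam < l x ∧ l x ≤ s.lam + ω ^ ρ ∧ ω ^ (o x) ∣ l x - s.lam

open Classical in
/-- The data of the stem extended by levels up to `lam + ω ^ ρ`. -/
noncomputable def extendData (s : Stem κ) (B : s.Bottom) (ρ : Ordinal.{u}) : MorassData.{u} where
  nodes := s.nodes ∪ {x | s.IsNew ρ x}
  rel x y := s.rel x y ∨ (s.IsNew ρ y ∧ s.IsNew ρ x ∧ l x < l y ∧ o x = o y) ∨
    (s.IsNew ρ y ∧ o y ∈ B.dom ∧ s.relE x (s.lam, B.nu (o y)))
  map x y γ := if s.IsNew ρ x then γ else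
    if s.IsNew ρ y then B.h (o y) (s.mapE x (s.lam, B.nu (o y)) γ) else s.map x y γ
  lam := s.lam + ω ^ ρ

variable {s : Stem κ} {B : s.Bottom} {ρ : Ordinal.{u}} {x y z : MorassNode.{u}}

theorem not_isNew (h : l x ≤ s.lam) : ¬ s.IsNew ρ x := fun h' => absurd h'.1 (not_lt.2 h)

theorem IsNew.of_le (h : s.IsNew ρ x) {σ : Ordinal.{u}} (hσ : σ ≤ o x) : s.IsNew ρ (l x, σ) :=
  ⟨h.1, h.2.1, (Ordinal.opow_dvd_opow _ hσ).trans h.2.2⟩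

theorem rel_level (h : s.rel x y) : l x ≤ s.lam ∧ l y ≤ s.lam :=
  ⟨s.level_le _ (s.rel_nodes _ _ h).1, s.level_le _ (s.rel_nodes _ _ h).2⟩

theorem extend_rel_low (hy : l y ≤ s.lam) : (s.extendData B ρ).rel x y ↔ s.rel x y := by
  refine ⟨fun h => ?_, fun h => .inl h⟩
  rcases h with h | ⟨h, -⟩ | ⟨h, -⟩
  · exact h
  · exact absurd h (not_isNew hy)
  · exact absurd h (not_isNew hy)

theorem extend_rel_new (hx : s.IsNew ρ x) :
    (s.extendData B ρ).rel x y ↔ s.IsNew ρ y ∧ l x < l y ∧ o x = o y := by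
  refine ⟨fun h => ?_, fun h => .inr (.inl ⟨h.1, hx, h.2⟩)⟩
  rcases h with h | ⟨h, -, h'⟩ | ⟨h, -, h'⟩
  · exact absurd hx (not_isNew (rel_level h).1)
  · exact ⟨h, h'⟩
  · exact absurd hx (not_isNew (level_le_of_relE h'))

theorem extend_rel_old (hx : l x ≤ s.lam) (hy : s.IsNew ρ y) :
    (s.extendData B ρ).rel x y ↔ o y ∈ B.dom ∧ s.relE x (s.lam, B.nu (o y)) := by
  refine ⟨fun h => ?_, fun h => .inr (.inr ⟨hy, h⟩)⟩
  rcases h with h | ⟨-, h, -⟩ | ⟨-, h⟩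
  · exact absurd hy (not_isNew (rel_level h).2)
  · exact absurd h (not_isNew hx)
  · exact h

theorem extend_cases (h : (s.extendData B ρ).rel x y) : s.rel x y ∨
    (s.IsNew ρ y ∧ s.IsNew ρ x ∧ l x < l y ∧ o x = o y) ∨
    (s.IsNew ρ y ∧ l x ≤ s.lam ∧ o y ∈ B.dom ∧ s.relE x (s.lam, B.nu (o y))) := by
  rcases h with h | h | ⟨h, h', h''⟩
  · exact .inl h
  · exact .inr (.inl h)
  · exact .inr (.inr ⟨h, level_le_of_relE h'', h', h''⟩)

theorem extend_map_low (h : s.rel x y) (γ : Ordinal.{u}) :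
    (s.extendData B ρ).map x y γ = s.map x y γ :=
  (if_neg (not_isNew (rel_level h).1)).trans (if_neg (not_isNew (rel_level h).2))

theorem extend_map_new (hx : s.IsNew ρ x) (γ : Ordinal.{u}) :
    (s.extendData B ρ).map x y γ = γ := if_pos hx

theorem extend_map_old (hx : l x ≤ s.lam) (hy : s.IsNew ρ y) (γ : Ordinal.{u}) :
    (s.extendData B ρ).map x y γ = B.h (o y) (s.mapE x (s.lam, B.nu (o y)) γ) :=
  (if_neg (not_isNew hx)).trans (if_pos hy)

theorem extend_node_low (hy : l y ≤ s.lam) : y ∈ (s.extendData B ρ).nodes ↔ y ∈ s.nodes :=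
  ⟨fun h => h.elim id fun h => absurd h (not_isNew hy), fun h => .inl h⟩

theorem extend_node_new (hy : s.lam < l y) : y ∈ (s.extendData B ρ).nodes ↔ s.IsNew ρ y :=
  ⟨fun h => h.elim (fun h => absurd (s.level_le y h) (not_le.2 hy)) id, fun h => .inr h⟩

theorem extend_image_low (h : s.rel x y) {A : Set Ordinal.{u}} :
    (s.extendData B ρ).map x y '' A = s.map x y '' A :=
  Set.image_congr fun _ _ => extend_map_low h _

theorem extend_theta_low {α : Ordinal.{u}} (hα : α ≤ s.lam) :
    (s.extendData B ρ).theta α = s.theta α :=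
  MorassData.theta_eq_of fun β => by
    rw [extend_node_low (show l (α, β) ≤ s.lam from hα)]
    exact (s.left_alignment α hα).1 β

theorem le_of_omega0_opow_dvd {σ ξ : Ordinal.{u}} (hξ : ξ ≠ 0) (h : ω ^ σ ∣ ξ) : σ ≤ ξ :=
  (Ordinal.right_le_opow σ Ordinal.one_lt_omega0).trans (Ordinal.le_of_dvd hξ h)

theorem sub_ne_zero_of_new (h : s.IsNew ρ x) : l x - s.lam ≠ 0 := by
  rw [Ne, Ordinal.sub_eq_zero_iff_le, not_le]
  exact h.1

/-- Divisibility by `ω ^ σ` passes down to smaller exponents, so the orders on a level form an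
initial segment. It is bounded because `ω ^ σ ∣ ξ` with `ξ ≠ 0` forces `σ ≤ ξ`. -/
theorem extend_theta_new {α : Ordinal.{u}} (h1 : s.lam < α) :
    (∀ β, (α, β) ∈ (s.extendData B ρ).nodes ↔ β < (s.extendData B ρ).theta α) ∧
    (s.extendData B ρ).theta α ≤ α - s.lam + 1 := by
  have key : ∀ β, (α, β) ∈ (s.extendData B ρ).nodes ↔ s.IsNew ρ (α, β) :=
    fun β => extend_node_new h1
  have h0 : α - s.lam ≠ 0 := by
    rw [Ne, Ordinal.sub_eq_zero_iff_le, not_le]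
    exact h1
  have hb : α - s.lam + 1 ∉ {β | (α, β) ∈ (s.extendData B ρ).nodes} := by
    intro h
    exact absurd (le_of_omega0_opow_dvd h0 ((key _).1 h).2.2) (not_le.2 (lt_add_one _))
  refine ⟨fun β => ?_, csInf_le' hb⟩
  refine Ordinal.lt_sInf_compl_iff (A := {β | (α, β) ∈ (s.extendData B ρ).nodes}) ?_ hb β
  intro β hβ γ hγ
  exact (key γ).2 (((key β).1 hβ).of_le hγ)

theorem old_node (hB : o y ∈ B.dom) : (s.lam, B.nu (o y)) ∈ s.nodes :=
  ((s.left_alignment _ le_rfl).1 _).2 (B.nu_lt _ hB)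

theorem add_opow_lt_ord (hκ : ℵ₀ < κ) {a ρ : Ordinal.{u}} (ha : a < κ.ord) (hρ : ρ < κ.ord) :
    a + ω ^ ρ < κ.ord := by
  refine Ordinal.isPrincipal_add_ord hκ.le ha ?_
  exact Ordinal.isPrincipal_opow_ord hκ.le (by
    rw [← Cardinal.ord_aleph0]; exact Cardinal.ord_lt_ord.2 hκ) hρ

/-- The stem extended by levels up to `lam + ω ^ ρ`. -/
noncomputable def extend (s : Stem κ) (B : s.Bottom) (ρ : Ordinal.{u}) (hκ : ℵ₀ < κ)
    (hρ : ρ < κ.ord) : Stem κ where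
  toMorassData := s.extendData B ρ
  lam_lt := add_opow_lt_ord hκ s.lam_lt hρ
  level_le := by
    rintro x (hx | hx)
    · exact (s.level_le x hx).trans le_self_add
    · exact hx.2.1
  rel_nodes := by
    intro x y h
    rcases extend_cases h with h | ⟨h1, h2, -⟩ | ⟨h1, -, h2, h3⟩
    · exact ⟨.inl (s.rel_nodes _ _ h).1, .inl (s.rel_nodes _ _ h).2⟩
    · exact ⟨.inr h2, .inr h1⟩
    · refine ⟨.inl ?_, .inr h1⟩
      rcases h3 with rfl | h3
      · exact old_node h2
      · exact (s.rel_nodes _ _ h3).1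
  rel_trans := by
    intro x y z hxy hyz
    rcases extend_cases hyz with h | ⟨h1, h2, h3, h4⟩ | ⟨h1, h2, h3, h4⟩
    · exact .inl (s.rel_trans _ _ _ ((extend_rel_low (rel_level h).1).1 hxy) h)
    · rcases extend_cases hxy with g | ⟨g1, g2, g3, g4⟩ | ⟨g1, g2, g3, g4⟩
      · exact absurd h2 (not_isNew (rel_level g).2)
      · exact (extend_rel_new g2).2 ⟨h1, g3.trans h3, g4.trans h4⟩
      · refine (extend_rel_old g2 h1).2 ?_
        rw [← h4]
        exact ⟨g3, g4⟩
    · refine .inr (.inr ⟨h1, h3, .inr (rel_of_rel_relE ((extend_rel_low h2).1 hxy) h4)⟩)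
  rel_linear := by
    intro x x' y hx hx'
    rcases extend_cases hx with h | ⟨h1, h2, h3, h4⟩ | ⟨h1, h2, h3, h4⟩
    · rcases s.rel_linear _ _ _ h ((extend_rel_low (rel_level h).2).1 hx') with e | e | e
      · exact .inl e
      · exact .inr (.inl (.inl e))
      · exact .inr (.inr (.inl e))
    · rcases extend_cases hx' with g | ⟨g1, g2, g3, g4⟩ | ⟨g1, g2, g3, g4⟩
      · exact absurd h1 (not_isNew (rel_level g).2)
      · rcases lt_trichotomy (l x) (l x') with e | e | e
        · exact .inr (.inl ((extend_rel_new h2).2 ⟨g2, e, h4.trans g4.symm⟩))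
        · exact .inl (Prod.ext e (h4.trans g4.symm))
        · exact .inr (.inr ((extend_rel_new g2).2 ⟨h2, e, g4.trans h4.symm⟩))
      · refine .inr (.inr ((extend_rel_old g2 h2).2 ?_))
        rw [h4]
        exact ⟨g3, g4⟩
    · rcases extend_cases hx' with g | ⟨g1, g2, g3, g4⟩ | ⟨g1, g2, g3, g4⟩
      · exact absurd h1 (not_isNew (rel_level g).2)
      · refine .inr (.inl ((extend_rel_old h2 g2).2 ?_))
        rw [g4]
        exact ⟨h3, h4⟩
      · rcases relE_linear h4 g4 with e | e | e
        · exact .inl e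
        · exact .inr (.inl (.inl e))
        · exact .inr (.inr (.inl e))
  left_alignment := by
    intro α hα
    rcases le_or_gt α s.lam with h | h
    · rw [extend_theta_low h]
      refine ⟨fun β => ?_, (s.left_alignment α h).2⟩
      rw [extend_node_low (show l (α, β) ≤ s.lam from h)]
      exact (s.left_alignment α h).1 β
    · obtain ⟨h1, h2⟩ := extend_theta_new (B := B) (ρ := ρ) h
      refine ⟨h1, (h1 0).1 ((extend_node_new h).2 ⟨h, hα, ?_⟩), h2.trans_lt ?_⟩
      · change ω ^ (0 : Ordinal.{u}) ∣ _
        rw [Ordinal.opow_zero]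
        exact one_dvd _
      · have h3 : α < κ.ord := lt_of_le_of_lt hα (add_opow_lt_ord hκ s.lam_lt hρ)
        exact (Cardinal.isSuccLimit_ord hκ.le).add_one_lt ((Ordinal.sub_le_self _ _).trans_lt h3)
  monotonicity := by
    intro x y hxy
    rcases extend_cases hxy with h | ⟨h1, h2, h3, h4⟩ | ⟨h1, h2, h3, h4⟩
    · exact s.monotonicity _ _ h
    · exact h3
    · exact h2.trans_lt h1.1
  commutativity := by
    intro x y z hxy hyz γ hγ
    rcases extend_cases hyz with h | ⟨h1, h2, h3, h4⟩ | ⟨h1, h2, h3, h4⟩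
    · have hxy' := (extend_rel_low (rel_level h).1).1 hxy
      rw [extend_map_low h, extend_map_low hxy', extend_map_low (s.rel_trans _ _ _ hxy' h)]
      exact s.commutativity _ _ _ hxy' h γ hγ
    · rw [extend_map_new h2]
      rcases extend_cases hxy with g | ⟨g1, g2, g3, g4⟩ | ⟨g1, g2, g3, g4⟩
      · exact absurd h2 (not_isNew (rel_level g).2)
      · rw [extend_map_new g2, extend_map_new g2]
      · rw [extend_map_old g2 h1, extend_map_old g2 h2, h4]
    · have hxy' := (extend_rel_low h2).1 hxy
      have hx := (rel_level hxy').1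
      rw [extend_map_old h2 h1, extend_map_old hx h1, extend_map_low hxy', ← mapE_rel hxy',
        mapE_comm (.inr hxy') h4 hγ]
  m1 := by
    intro x y hxy
    rcases extend_cases hxy with h | ⟨h1, h2, h3, h4⟩ | ⟨h1, h2, h3, h4⟩
    · rw [extend_map_low h]
      exact ⟨(s.m1 x y h).1.congr fun γ _ => extend_map_low h γ, (s.m1 x y h).2⟩
    · rw [extend_map_new h2]
      exact ⟨(isSLOOP_id _).congr fun γ _ => extend_map_new h2 γ, h4⟩
    · rw [extend_map_old h2 h1, mapE_top h4]
      refine ⟨((B.sloop _ h3).comp (mapE_sloop h4) fun γ hγ => ?_).congr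
        fun γ _ => extend_map_old h2 h1 γ, B.h_top _ h3⟩
      exact Order.lt_add_one_iff.2 (mapE_le_o h4 hγ)
  m2 := by
    intro x y hxy ν hν
    rcases extend_cases hxy with h | ⟨h1, h2, h3, h4⟩ | ⟨h1, h2, h3, h4⟩
    · obtain ⟨g1, g2⟩ := s.m2 x y h ν hν
      rw [extend_map_low h]
      refine ⟨.inl g1, fun γ hγ => ?_⟩
      rw [extend_map_low g1, extend_map_low h]
      exact g2 γ hγ
    · rw [extend_map_new h2]
      have hn := h2.of_le hν.le
      refine ⟨(extend_rel_new hn).2 ⟨h1.of_le (h4 ▸ hν.le), h3, rfl⟩, fun γ hγ => ?_⟩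
      rw [extend_map_new hn, extend_map_new h2]
    · rw [extend_map_old h2 h1]
      have hμ : s.mapE x (s.lam, B.nu (o y)) ν < B.nu (o y) := mapE_lt_o h4 hν
      obtain ⟨b1, b2, b3⟩ := B.m2 _ h3 _ hμ
      obtain ⟨g1, g2⟩ := relE_m2 h4 hν
      have hle : B.h (o y) (s.mapE x (s.lam, B.nu (o y)) ν) ≤ o y := by
        have := (B.sloop _ h3).2.2.2 _ _ hμ (lt_add_one _)
        rw [B.h_top _ h3] at this
        exact this.le
      have hn := h1.of_le hle
      have hx : l (l x, ν) ≤ s.lam := h2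
      refine ⟨(extend_rel_old hx hn).2 ⟨b1, ?_⟩, fun γ hγ => ?_⟩
      · change s.relE (l x, ν) (s.lam, B.nu (B.h (o y) (s.mapE x (s.lam, B.nu (o y)) ν)))
        rw [b2]
        exact g1
      · rw [extend_map_old hx hn, extend_map_old h2 h1]
        change B.h (B.h (o y) (s.mapE x (s.lam, B.nu (o y)) ν)) (s.mapE (l x, ν)
          (s.lam, B.nu (B.h (o y) (s.mapE x (s.lam, B.nu (o y)) ν))) γ) = _
        rw [b2]
        have g3 := g2 γ hγ
        rw [show l (s.lam, B.nu (o y)) = s.lam from rfl] at g3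
        rw [g3]
        refine b3 _ ?_
        rcases hγ.lt_or_eq with hγ | rfl
        · exact (mapE_lt h4 hγ hν.le).le
        · exact le_rfl
  m3 := by
    intro y hy d hd hl hu
    rcases hy with hy | hy
    · obtain ⟨x, hx, e⟩ := s.m3 y hy d hd hl fun ε hε => by
        obtain ⟨α, ⟨x, hx, e⟩, hα⟩ := hu ε hε
        exact ⟨α, ⟨x, (extend_rel_low (s.level_le y hy)).1 hx, e⟩, hα⟩
      exact ⟨x, .inl hx, e⟩
    · have hy : s.IsNew ρ y := hy
      -- A limit of predecessor levels below `λ` is handled by the attached node on level `λ`; at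
      -- `λ` itself it is that node; above `λ`, closure of the multiples of `ω ^ (o y)` applies.
      rcases lt_trichotomy d s.lam with h | h | h
      · obtain ⟨α, ⟨x, hx, e⟩, h1, h2⟩ := hu 0 (pos_iff_ne_zero.2 (by simpa using hl.1))
        have hxl : l x ≤ s.lam := e ▸ (h2.trans h).le
        obtain ⟨hD, hE⟩ := (extend_rel_old hxl hy).1 hx
        obtain ⟨x', hx', e'⟩ := s.m3 _ (old_node hD) d h hl fun ε hε => by
          obtain ⟨α, ⟨x, hx, e⟩, h1, h2⟩ := hu ε hε
          have hxl : l x < s.lam := e ▸ (h2.trans h)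
          obtain ⟨-, hE⟩ := (extend_rel_old hxl.le hy).1 hx
          refine ⟨α, ⟨x, ?_, e⟩, h1, h2⟩
          rcases hE with rfl | hE
          · exact absurd hxl (lt_irrefl _)
          · exact hE
        exact ⟨x', (extend_rel_old (e' ▸ h.le) hy).2 ⟨hD, .inr hx'⟩, e'⟩
      · obtain ⟨α, ⟨x, hx, e⟩, h1, h2⟩ := hu 0 (pos_iff_ne_zero.2 (by simpa using hl.1))
        have hxl : l x ≤ s.lam := e ▸ (h2.trans_eq h).le
        obtain ⟨hD, hE⟩ := (extend_rel_old hxl hy).1 hx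
        exact ⟨(s.lam, B.nu (o y)), (extend_rel_old (le_refl s.lam) hy).2 ⟨hD, .inl rfl⟩, h.symm⟩
      · have hnew : s.IsNew ρ (d, o y) := by
          refine ⟨h, hd.le.trans hy.2.1, Ordinal.omega0_opow_dvd_of_unbounded fun ε hε => ?_⟩
          have hε' : s.lam + ε < d := Ordinal.lt_sub.1 hε
          obtain ⟨α, ⟨x, hx, e⟩, h1, h2⟩ := hu _ hε'
          have hxl : s.lam < l x := e ▸ (le_self_add.trans_lt h1)
          rcases extend_cases hx with g | ⟨g1, g2, g3, g4⟩ | ⟨g1, g2, g3, g4⟩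
          · exact absurd (rel_level g).1 (not_le.2 hxl)
          · refine ⟨l x - s.lam, g4 ▸ g2.2.2, Ordinal.lt_sub.2 (e ▸ h1), ?_⟩
            change l x - s.lam < d - s.lam
            rw [← add_lt_add_iff_left s.lam, Ordinal.add_sub_cancel_of_le hxl.le,
              Ordinal.add_sub_cancel_of_le h.le]
            exact e ▸ h2
          · exact absurd g2 (not_le.2 hxl)
        exact ⟨(d, o y), (extend_rel_new hnew).2 ⟨hy, hd, rfl⟩, rfl⟩
  m4 := by
    intro y hy ht
    rcases hy with hy | hy
    · rw [extend_theta_low (s.level_le y hy)] at ht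
      intro ε hε
      obtain ⟨α, ⟨x, hx, e⟩, hα⟩ := s.m4 y hy ht ε hε
      exact ⟨α, ⟨x, .inl hx, e⟩, hα⟩
    · have hy : s.IsNew ρ y := hy
      obtain ⟨h1, h2⟩ := extend_theta_new (B := B) (ρ := ρ) hy.1
      have h3 : o y < (s.extendData B ρ).theta (l y) := (h1 _).1 (.inr hy)
      -- As `y` is not the last node of its level, the next order also occurs, so `ω ^ (o y + 1)`
      -- divides `l y - λ` and multiples of `ω ^ (o y)` are cofinal below it.
      have h4 : s.IsNew ρ (l y, o y + 1) :=
        (extend_node_new (B := B) (y := (l y, o y + 1)) hy.1).1 ((h1 (o y + 1)).2 (lt_of_le_of_ne (Order.add_one_le_of_lt h3) ht))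
      intro ε hε
      have hε' : ε - s.lam < l y - s.lam := by
        rcases le_or_gt s.lam ε with g | g
        · rw [← add_lt_add_iff_left s.lam, Ordinal.add_sub_cancel_of_le g,
            Ordinal.add_sub_cancel_of_le hy.1.le]
          exact hε
        · rw [Ordinal.sub_eq_zero_iff_le.2 g.le]
          exact pos_iff_ne_zero.2 (sub_ne_zero_of_new hy)
      obtain ⟨η, g1, g2, g3⟩ := Ordinal.exists_omega0_opow_dvd_between h4.2.2 hε'
      have hlt : s.lam + η < l y := Ordinal.lt_sub.1 g3
      have hnew : s.IsNew ρ (s.lam + η, o y) := by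
        refine ⟨?_, hlt.le.trans hy.2.1, ?_⟩
        · exact lt_add_of_pos_right _ ((zero_le).trans_lt g2)
        · change _ ∣ s.lam + η - s.lam
          rw [Ordinal.add_sub_cancel]
          exact g1
      refine ⟨s.lam + η, ⟨(s.lam + η, o y), (extend_rel_new hnew).2 ⟨hy, hlt, rfl⟩, rfl⟩, ?_, hlt⟩
      rcases le_or_gt s.lam ε with g | g
      · rw [← Ordinal.add_sub_cancel_of_le g]
        exact (add_lt_add_iff_left _).2 g2
      · exact g.trans_le le_self_add
  m5 := by
    intro y hy hu
    rcases hy with hy | hy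
    · have hl := s.level_le y hy
      rw [s.m5 y hy fun ε hε => by
        obtain ⟨α, ⟨x, hx, e⟩, hα⟩ := hu ε hε
        exact ⟨α, ⟨x, (extend_rel_low hl).1 hx, e⟩, hα⟩]
      ext β
      refine exists_congr fun x => ?_
      rw [extend_rel_low hl]
      refine and_congr_right fun h => ?_
      rw [extend_image_low h]
    · have hy : s.IsNew ρ y := hy
      ext β
      constructor
      · intro hβ
        -- Unboundedness gives a predecessor above `λ`; it has the same order as `y` and its map is
        -- the identity.
        obtain ⟨α, ⟨x, hx, e⟩, h1, h2⟩ := hu _ hy.1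
        rcases extend_cases hx with g | ⟨g1, g2, g3, g4⟩ | ⟨g1, g2, g3, g4⟩
        · exact absurd (rel_level g).1 (not_le.2 (e ▸ h1))
        · exact ⟨x, hx, β, g4 ▸ hβ, extend_map_new g2 _⟩
        · exact absurd g2 (not_le.2 (e ▸ h1))
      · rintro ⟨x, hx, γ, hγ, rfl⟩
        have hγ : γ < o x := hγ
        change _ < o y
        rcases extend_cases hx with g | ⟨g1, g2, g3, g4⟩ | ⟨g1, g2, g3, g4⟩
        · exact absurd hy (not_isNew (rel_level g).2)
        · rw [extend_map_new g2]
          exact g4 ▸ hγ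
        · rw [extend_map_old g2 g1]
          conv_rhs => rw [← B.h_top _ g3]
          exact (B.sloop _ g3).2.2.2 _ _ (mapE_lt_o g4 hγ) (lt_add_one _)
  m6 := by
    intro x y hi hx ν hν
    rcases extend_cases hi.1 with h | ⟨h1, h2, h3, h4⟩ | ⟨h1, h2, h3, h4⟩
    · rw [extend_image_low h] at hν
      have hi' : s.immRel x y := ⟨h, fun z hz => hi.2 z ⟨.inl hz.1, .inl hz.2⟩⟩
      obtain ⟨g1, g2⟩ := s.m6 x y hi' hx ν hν
      refine ⟨.inl g1, fun γ hγ => ?_⟩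
      rw [extend_map_low g1, extend_map_low h]
      exact g2 γ hγ
    · rw [Set.image_congr fun γ _ => extend_map_new h2 γ, Set.image_id'] at hν
      have e : ν = o y := by
        rw [← h4]
        exact hν.unique hx.isLUB_Iio
      subst e
      exact ⟨hi.1, fun _ _ => rfl⟩
    · have hxe : x = (s.lam, B.nu (o y)) := by
        rcases h4 with h4 | h4
        · exact h4
        · exact absurd ⟨.inl h4, (extend_rel_old (le_refl s.lam) h1).2 ⟨h3, .inl rfl⟩⟩
            (hi.2 (s.lam, B.nu (o y)))
      subst hxe
      have hmap : ∀ γ, (s.extendData B ρ).map (s.lam, B.nu (o y)) y γ = B.h (o y) γ := fun γ => by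
        rw [extend_map_old h2 h1, mapE_self]
      rw [Set.image_congr fun γ _ => hmap γ] at hν
      obtain ⟨g1, g2, g3⟩ := B.m6 _ h3 hx ν hν
      have hle : ν ≤ o y := by
        refine hν.2 ?_
        rintro _ ⟨γ, hγ, rfl⟩
        conv_rhs => rw [← B.h_top _ h3]
        exact ((B.sloop _ h3).2.2.2 _ _ (Set.mem_Iio.1 hγ) (lt_add_one _)).le
      have hn := h1.of_le hle
      have e : (s.lam, B.nu (o y)) = (s.lam, B.nu (o (l y, ν))) := by
        rw [show o (l y, ν) = ν from rfl, g2]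
      refine ⟨(extend_rel_old (le_refl s.lam) hn).2 ⟨g1, .inl e⟩, fun γ hγ => ?_⟩
      rw [hmap, extend_map_old h2 hn, ← e, mapE_self]
      exact g3 γ hγ
  m7 := by
    intro x y hi α hα1 hα2 hx hν hα
    rcases extend_cases hi.1 with h | ⟨h1, h2, h3, h4⟩ | ⟨h1, h2, h3, h4⟩
    · rw [extend_image_low h] at hν
      have hi' : s.immRel x y := ⟨h, fun z hz => hi.2 z ⟨.inl hz.1, .inl hz.2⟩⟩
      obtain ⟨γ, hγ⟩ := s.m7 x y hi' α hα1 hα2 hx hν fun ν hν => by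
        obtain ⟨γ, hγ⟩ := hα ν hν
        rw [extend_map_low h] at hγ
        exact ⟨γ, (extend_rel_low (y := (l y, s.map x y ν)) (rel_level h).2).1 hγ⟩
      exact ⟨γ, .inl hγ⟩
    · refine ⟨o y, ?_⟩
      have hαl : s.lam < α := h2.1.trans hα1
      have hn : s.IsNew ρ (α, o y) := by
        -- The hypothesis of M.7 says that `ω ^ σ` divides `α - λ` for every `σ` below the limit `o
        -- y`.
        refine ⟨hαl, hα2.le.trans h1.2.1, Ordinal.omega0_opow_dvd_of_forall_lt (h4 ▸ hx) ?_⟩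
        intro σ hσ
        obtain ⟨γ, hγ⟩ := hα σ (h4 ▸ hσ)
        rw [extend_map_new h2] at hγ
        rcases extend_cases hγ with g | ⟨g1, g2, g3, g4⟩ | ⟨g1, g2, g3, g4⟩
        · exact absurd (rel_level g).1 (not_le.2 hαl)
        · exact (show γ = σ from g4) ▸ g2.2.2
        · exact absurd g2 (not_le.2 hαl)
      exact (extend_rel_new hn).2 ⟨h1, hα2, rfl⟩
    · refine ⟨o y, ?_⟩
      have hxe : x = (s.lam, B.nu (o y)) := by
        rcases h4 with h4 | h4
        · exact h4
        · exact absurd ⟨.inl h4, (extend_rel_old (le_refl s.lam) h1).2 ⟨h3, .inl rfl⟩⟩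
            (hi.2 (s.lam, B.nu (o y)))
      subst hxe
      have hmap : ∀ γ, (s.extendData B ρ).map (s.lam, B.nu (o y)) y γ = B.h (o y) γ := fun γ => by
        rw [extend_map_old h2 h1, mapE_self]
      rw [Set.image_congr fun γ _ => hmap γ] at hν
      have hαl : s.lam < α := hα1
      have hlim : IsSuccLimit (o y) := by
        have := (B.sloop _ h3).2.1 _ (lt_add_one _) hx
        change IsSuccLimit (B.h (o y) (B.nu (o y))) at this
        rwa [B.h_top _ h3] at this
      have hn : s.IsNew ρ (α, o y) := by
        -- Only exponents in the range of the attaching map are supplied, but these are cofinal in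
        -- `o y`.
        refine ⟨hαl, hα2.le.trans h1.2.1, Ordinal.omega0_opow_dvd_of_forall_lt hlim ?_⟩
        intro σ hσ
        obtain ⟨_, ⟨ν, hν', rfl⟩, hσν⟩ := (lt_isLUB_iff hν).1 hσ
        obtain ⟨γ, hγ⟩ := hα ν hν'
        rw [hmap] at hγ
        rcases extend_cases hγ with g | ⟨g1, g2, g3, g4⟩ | ⟨g1, g2, g3, g4⟩
        · exact absurd (rel_level g).1 (not_le.2 hαl)
        · have : ω ^ γ ∣ α - s.lam := g2.2.2
          refine (Ordinal.opow_dvd_opow _ ?_).trans this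
          rw [show γ = _ from g4]
          exact hσν.le
        · exact absurd g2 (not_le.2 hαl)
      exact (extend_rel_new hn).2 ⟨h1, hα2, rfl⟩

theorem extend_lam_lt (s : Stem κ) (B : s.Bottom) (ρ : Ordinal.{u}) (hκ : ℵ₀ < κ)
    (hρ : ρ < κ.ord) : s.lam < (s.extend B ρ hκ hρ).lam :=
  lt_add_of_pos_right _ (Ordinal.opow_pos _ Ordinal.omega0_pos)

theorem le_extend_lam (s : Stem κ) (B : s.Bottom) (ρ : Ordinal.{u}) (hκ : ℵ₀ < κ)
    (hρ : ρ < κ.ord) : ρ ≤ (s.extend B ρ hκ hρ).lam :=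
  (Ordinal.right_le_opow ρ Ordinal.one_lt_omega0).trans le_add_self

theorem extend_extends (s : Stem κ) (B : s.Bottom) (ρ : Ordinal.{u}) (hκ : ℵ₀ < κ)
    (hρ : ρ < κ.ord) : (s.extend B ρ hκ hρ).Extends s where
  lam_le := (extend_lam_lt s B ρ hκ hρ).le
  nodes _ hx := (extend_node_low hx).symm
  rel _ _ hy := (extend_rel_low hy).symm
  map _ _ h γ _ := (extend_map_low h γ).symm

/-- Every edge from an old to a new node passes through an attached node on the old top level. -/
theorem extend_isMangal (s : Stem κ) (B : s.Bottom) (ρ : Ordinal.{u}) (hκ : ℵ₀ < κ)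
    (hρ : ρ < κ.ord) : (s.extend B ρ hκ hρ).IsMangal s.lam := by
  refine ⟨(extend_lam_lt s B ρ hκ hρ).le, fun x y hxy h1 h2 => ?_⟩
  rcases extend_cases hxy with h | ⟨h, h', -⟩ | ⟨h, h', h3, h4⟩
  · exact absurd (rel_level h).2 (not_le.2 h2)
  · exact absurd h'.1 (not_lt.2 h1.le)
  · rcases h4 with rfl | h4
    · exact absurd h1 (lt_irrefl _)
    · exact ⟨_, .inl (old_node h3), rfl, .inl h4, (extend_rel_old (le_refl s.lam) h).2
        ⟨h3, .inl rfl⟩⟩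

/-- The height `ω ^ ρ` is chosen for this: its last level carries all orders up to `ρ`, leaving room
for a top set of order type at most `ρ + 1`. -/
theorem isNew_top (s : Stem κ) {ρ σ : Ordinal.{u}} (h : σ ≤ ρ) :
    s.IsNew ρ (s.lam + ω ^ ρ, σ) := by
  refine ⟨lt_add_of_pos_right _ (Ordinal.opow_pos _ Ordinal.omega0_pos), le_rfl, ?_⟩
  change _ ∣ s.lam + ω ^ ρ - s.lam
  rw [Ordinal.add_sub_cancel]
  exact Ordinal.opow_dvd_opow _ h

theorem le_extend_theta (s : Stem κ) (B : s.Bottom) (ρ : Ordinal.{u}) (hκ : ℵ₀ < κ)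
    (hρ : ρ < κ.ord) {τ : Ordinal.{u}} (hτ : τ ≤ ρ + 1) :
    τ ≤ (s.extend B ρ hκ hρ).theta (s.extend B ρ hκ hρ).lam := by
  by_contra hc
  have h1 := Order.lt_add_one_iff.1 ((not_le.1 hc).trans_le hτ)
  have h2 := ((s.extend B ρ hκ hρ).left_alignment _ le_rfl).1
    ((s.extend B ρ hκ hρ).theta (s.extend B ρ hκ hρ).lam)
  exact lt_irrefl _ (h2.1 (.inr (isNew_top s h1)))

theorem extend_rel_top (s : Stem κ) (B : s.Bottom) (ρ : Ordinal.{u}) (hκ : ℵ₀ < κ)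
    (hρ : ρ < κ.ord) {σ : Ordinal.{u}} (hσ : σ ∈ B.dom) (h : σ ≤ ρ) :
    (s.extend B ρ hκ hρ).rel (s.lam, B.nu σ) ((s.extend B ρ hκ hρ).lam, σ) ∧
    ∀ γ, (s.extend B ρ hκ hρ).map (s.lam, B.nu σ) ((s.extend B ρ hκ hρ).lam, σ) γ = B.h σ γ := by
  have h1 := isNew_top s h
  refine ⟨(extend_rel_old (le_refl s.lam) h1).2 ⟨hσ, .inl rfl⟩, fun γ => ?_⟩
  refine (extend_map_old (le_refl s.lam) h1 γ).trans ?_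
  exact congrArg _ (mapE_self γ)

end Stem

/-! ### Attaching functions and amalgamation of conditions with a common stem -/

/-- `σ` is the value `g ν`, or the supremum of `g` below the limit `ν`. -/
def Hits (τ : Ordinal.{u}) (g : Ordinal.{u} → Ordinal.{u}) (ν σ : Ordinal.{u}) : Prop :=
  ν < τ ∧ (σ = g ν ∨ (IsSuccLimit ν ∧ IsLUB (g '' Set.Iio ν) σ))

namespace Hits

variable {τ : Ordinal.{u}} {g : Ordinal.{u} → Ordinal.{u}} {ν ν' σ γ : Ordinal.{u}}

theorem lt (hg : IsSLOOP g τ) (h : Hits τ g ν σ) (hγ : γ < ν) : g γ < σ := by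
  rcases h.2 with rfl | ⟨hl, hs⟩
  · exact hg.2.2.2 _ _ hγ h.1
  · have h1 := hl.add_one_lt hγ
    exact (hg.2.2.2 _ _ (lt_add_one γ) (h1.trans h.1)).trans_le (hs.1 ⟨_, h1, rfl⟩)

theorem le (hg : IsSLOOP g τ) (h : Hits τ g ν σ) : σ ≤ g ν := by
  rcases h.2 with rfl | ⟨hl, hs⟩
  · exact le_rfl
  · refine hs.2 ?_
    rintro _ ⟨γ, hγ, rfl⟩
    exact (hg.2.2.2 _ _ hγ h.1).le

/-- A hit at `ν` lies above all earlier values of `g` and at most at `g ν`; for different `ν` these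
ranges are disjoint. -/
theorem unique (hg : IsSLOOP g τ) (h : Hits τ g ν σ) (h' : Hits τ g ν' σ) : ν = ν' := by
  rcases lt_trichotomy ν ν' with e | e | e
  · exact absurd (h.le hg) (not_le.2 (h'.lt hg e))
  · exact e
  · exact absurd (h'.le hg) (not_le.2 (h.lt hg e))

theorem isSuccLimit (hg : IsSLOOP g τ) (h : Hits τ g ν σ) (hν : IsSuccLimit ν) :
    IsSuccLimit σ := by
  rcases h.2 with rfl | ⟨-, hs⟩
  · exact hg.2.1 _ h.1 hν
  rcases Ordinal.exists_add_one_or_isSuccLimit σ with rfl | ⟨a, rfl⟩ | e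
  · have := h.lt hg (pos_iff_ne_zero.2 (by simpa using hν.1) : 0 < ν)
    exact absurd this (by simp)
  · obtain ⟨_, ⟨γ, hγ, rfl⟩, hlt⟩ := (lt_isLUB_iff hs).1 (lt_add_one a)
    exact absurd (Order.add_one_le_of_lt hlt) (not_le.2 (h.lt hg hγ))
  · exact e

end Hits

namespace Stem

variable {κ : Cardinal.{u}}

open Classical in
/-- The bottom relation given by a coherent family of functions. -/
noncomputable def Bottom.ofFamily (s : Stem κ) {I : Type} (τ : I → Ordinal.{u})
    (g : I → Ordinal.{u} → Ordinal.{u}) (hτ : ∀ i, τ i ≤ s.theta s.lam)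
    (hg : ∀ i, IsSLOOP (g i) (τ i))
    (coh : ∀ i j ν ν' σ, Hits (τ i) (g i) ν σ → Hits (τ j) (g j) ν' σ →
      ν = ν' ∧ ∀ γ < ν, g i γ = g j γ) :
    {B : s.Bottom // ∀ i ν σ, Hits (τ i) (g i) ν σ →
      σ ∈ B.dom ∧ B.nu σ = ν ∧ B.h σ ν = σ ∧ ∀ γ < ν, B.h σ γ = g i γ} := by
  let D : Set Ordinal.{u} := {σ | ∃ i ν, Hits (τ i) (g i) ν σ}
  let nu : Ordinal.{u} → Ordinal.{u} := fun σ =>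
    if h : ∃ i ν, Hits (τ i) (g i) ν σ then h.choose_spec.choose else 0
  -- The last value is redefined to be `σ`, since a supremum `σ` may be smaller than `g ν`.
  let hh : Ordinal.{u} → Ordinal.{u} → Ordinal.{u} := fun σ γ =>
    if h : ∃ i ν, Hits (τ i) (g i) ν σ then if γ = nu σ then σ else g h.choose γ else 0
  -- Coherence makes the chosen index and argument irrelevant.
  have key : ∀ i ν σ, Hits (τ i) (g i) ν σ →
      nu σ = ν ∧ hh σ ν = σ ∧ ∀ γ < ν, hh σ γ = g i γ := by
    intro i ν σ h
    have hex : ∃ i ν, Hits (τ i) (g i) ν σ := ⟨i, ν, h⟩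
    have hnu : nu σ = ν := by
      simp only [nu, dif_pos hex]
      exact (coh _ _ _ _ _ hex.choose_spec.choose_spec h).1
    refine ⟨hnu, ?_, fun γ hγ => ?_⟩
    · simp only [hh, dif_pos hex, hnu, if_true]
    · simp only [hh, dif_pos hex, hnu, if_neg hγ.ne]
      exact ((coh _ _ _ _ _ h hex.choose_spec.choose_spec).2 γ hγ).symm
  refine ⟨⟨D, nu, hh, ?_, ?_, ?_, ?_, ?_⟩, fun i ν σ h => ⟨⟨i, ν, h⟩, key i ν σ h⟩⟩
  · rintro σ ⟨i, ν, h⟩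
    rw [(key i ν σ h).1]
    exact h.1.trans_le (hτ i)
  · rintro σ ⟨i, ν, h⟩
    obtain ⟨k1, k2, k3⟩ := key i ν σ h
    rw [k1]
    have hle : ∀ γ < ν + 1, γ < ν ∨ γ = ν := fun γ hγ =>
      (Order.lt_add_one_iff.1 hγ).lt_or_eq
    refine ⟨fun γ hγ => ?_, fun γ hγ hl => ?_, fun _ => ?_, fun γ δ hγ hδ => ?_⟩
    · rw [k3 γ (lt_of_not_ge fun hc => absurd hγ (not_lt.2 (by gcongr)))]
      rcases hle _ hγ with h1 | h1
      · rw [k3 _ h1]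
        exact (hg i).1 γ (h1.trans h.1)
      · rw [h1, k2]
        -- At a successor `ν` only the value `g ν` itself is a hit.
        rcases h.2 with h2 | ⟨h2, -⟩
        · rw [h2, ← h1]
          exact (hg i).1 γ (h1 ▸ h.1)
        · rw [← h1] at h2
          exact absurd h2 (Ordinal.not_isSuccLimit_add_one' _)
    · rcases hle _ hγ with h1 | rfl
      · rw [k3 _ h1]
        exact (hg i).2.1 γ (h1.trans h.1) hl
      · rw [k2]
        exact h.isSuccLimit (hg i) hl
    · rcases eq_or_ne ν 0 with rfl | h0
      · rw [k2]
        rcases h.2 with h2 | ⟨h2, -⟩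
        · rw [h2]
          exact (hg i).2.2.1 h.1
        · exact absurd h2.1 (by simp)
      · have h0 := pos_iff_ne_zero.2 h0
        rw [k3 0 h0]
        exact (hg i).2.2.1 (h0.trans h.1)
    · rcases hle _ hδ with h1 | rfl
      · rw [k3 _ h1, k3 _ (hγ.trans h1)]
        exact (hg i).2.2.2 _ _ hγ (h1.trans h.1)
      · rw [k2, k3 _ hγ]
        exact h.lt (hg i) hγ
  · rintro σ ⟨i, ν, h⟩
    obtain ⟨k1, k2, k3⟩ := key i ν σ h
    rw [k1, k2]
  · rintro σ ⟨i, ν, h⟩ μ hμ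
    obtain ⟨k1, k2, k3⟩ := key i ν σ h
    rw [k1] at hμ
    have h' : Hits (τ i) (g i) μ (g i μ) := ⟨hμ.trans h.1, .inl rfl⟩
    obtain ⟨l1, l2, l3⟩ := key i μ _ h'
    rw [k3 μ hμ]
    refine ⟨⟨i, μ, h'⟩, l1, fun γ hγ => ?_⟩
    rcases hγ.lt_or_eq with hγ | rfl
    · rw [l3 γ hγ, k3 γ (hγ.trans hμ)]
    · rw [l2, k3 _ hμ]
  · rintro σ ⟨i, ν, h⟩ hl σ' hσ'
    obtain ⟨k1, k2, k3⟩ := key i ν σ h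
    rw [k1] at hl hσ'
    rw [Set.image_congr (s := Set.Iio ν) fun γ hγ => k3 γ (Set.mem_Iio.1 hγ)] at hσ'
    -- The supremum demanded by M.6 is itself a hit at `ν`; suprema were put into the domain for
    -- this purpose.
    have h' : Hits (τ i) (g i) ν σ' := ⟨h.1, .inr ⟨hl, hσ'⟩⟩
    obtain ⟨l1, l2, l3⟩ := key i ν _ h'
    rw [k1]
    refine ⟨⟨i, ν, h'⟩, l1, fun γ hγ => ?_⟩
    rw [l3 γ hγ, k3 γ hγ]

end Stem

namespace MorassCondition

variable {κ : Cardinal.{u}}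

/-- A coherent family of conditions whose stems are all equal to that of `s` has a common
extension with any larger top set. -/
theorem exists_le_family (hκ : ℵ₀ < κ) (s : Stem κ) {I : Type} (p : I → MorassCondition κ)
    (τ : I → Ordinal.{u}) (f c : I → Ordinal.{u} → Ordinal.{u})
    (hlam : ∀ i, (p i).lam = s.lam) (hext : ∀ i, s.Extends (p i).stem)
    (hp : ∀ i, IsEnum (p i).topSet (τ i) (f i) (c i)) (hτ : ∀ i, τ i ≤ s.theta s.lam)
    (hr : ∀ i, ∀ ν < τ i, (p i).rel ((p i).lam, ν) (κ.ord, f i ν))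
    {S' : Set Ordinal.{u}} {τ' : Ordinal.{u}} {f' c' : Ordinal.{u} → Ordinal.{u}}
    (hS' : IsEnum S' τ' f' c') (hT' : IsTopSet S') (hτ' : τ' < κ.ord)
    (hb' : ∀ β ∈ S', β < (succ κ).ord) (hsub : ∀ i, (p i).topSet ⊆ S')
    (coh : ∀ i j ν ν' σ, Hits (τ i) (fun ν => c' (f i ν)) ν σ →
      Hits (τ j) (fun ν => c' (f j ν)) ν' σ → ν = ν' ∧ ∀ γ < ν, c' (f i γ) = c' (f j γ))
    {α : Ordinal.{u}} (hα : α < κ.ord) :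
    ∃ q : MorassCondition κ, (∀ i, q ≤ p i) ∧ s.lam < q.lam ∧ α ≤ q.lam ∧ q.topSet = S' := by
  obtain ⟨B, hB⟩ := Stem.Bottom.ofFamily s τ (fun i ν => c' (f i ν)) hτ
    (fun i => hS'.c_comp_isSLOOP hT' ((hp i).isSLOOP (p i).isTopSet)
      fun γ hγ => hsub i ((hp i).mem γ hγ)) coh
  -- The exponent must reach `τ'` so that the last level can carry the new top set, and `α` so that
  -- it is high enough.
  have hρ : max τ' α < κ.ord := max_lt hτ' hα
  have htop := s.le_extend_theta B _ hκ hρ ((le_max_left τ' α).trans (lt_add_one _).le)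
  refine ⟨(s.extend B _ hκ hρ).toCondition hS' hT' htop hb', fun i => ?_,
    s.extend_lam_lt B _ hκ hρ, (le_max_right τ' α).trans (s.le_extend_lam B _ hκ hρ),
    Stem.topSet_toCondition _ _ _ _ _⟩
  have h1 := s.extend_extends B _ hκ hρ
  refine toCondition_le hS' hT' htop hb' (hp i) (hr i) ?_ ?_ ?_ (hsub i) fun ν hν => ?_
  · have h2 := hext i
    refine ⟨h2.lam_le.trans h1.lam_le, fun x hx => (h2.nodes x hx).trans
      (h1.nodes x (hx.trans h2.lam_le)), fun x y hy => (h2.rel x y hy).trans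
      (h1.rel x y (hy.trans h2.lam_le)), fun x y hxy γ hγ => (h2.map x y hxy γ hγ).trans
      (h1.map x y ((h2.rel x y hxy.2).1 hxy) γ hγ)⟩
  · rw [hlam i]
    exact s.extend_lam_lt B _ hκ hρ
  · rw [hlam i]
    exact s.extend_isMangal B _ hκ hρ
  · obtain ⟨b1, b2, b3, b4⟩ := hB i ν (c' (f i ν)) ⟨hν, .inl rfl⟩
    have hle : c' (f i ν) ≤ max τ' α :=
      (hS'.lt _ (hsub i ((hp i).mem ν hν))).le.trans (le_max_left _ _)
    obtain ⟨h3, h4⟩ := s.extend_rel_top B _ hκ hρ b1 hle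
    rw [b2] at h3 h4
    rw [hlam i]
    refine ⟨h3, fun γ hγ => ?_⟩
    rw [h4]
    rcases hγ.lt_or_eq with hγ | rfl
    · exact b4 γ hγ
    · exact b3

theorem stem_extends_self (p : MorassCondition κ) : p.stem.Extends p.stem :=
  ⟨le_rfl, fun _ _ => Iff.rfl, fun _ _ _ => Iff.rfl, fun _ _ _ _ _ => rfl⟩

/-- Any condition can be extended to one with a given larger top set and with arbitrarily large
top level. -/
theorem exists_le_topSet (hκ : ℵ₀ < κ) (p : MorassCondition κ) {S : Set Ordinal.{u}}
    (hf : IsFew κ S) (hT : IsTopSet S) (hb : ∀ β ∈ S, β < (succ κ).ord) (hsub : p.topSet ⊆ S)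
    {α : Ordinal.{u}} (hα : α < κ.ord) :
    ∃ q ≤ p, p.lam < q.lam ∧ α ≤ q.lam ∧ q.topSet = S := by
  obtain ⟨τ, f, c, h1, h2, h3⟩ := p.exists_isEnum
  obtain ⟨τ', f', c', hS⟩ := _root_.exists_isEnum hb
  have hsl : IsSLOOP (fun ν => c' (f ν)) τ := hS.c_comp_isSLOOP hT (h1.isSLOOP p.isTopSet)
    fun γ hγ => hsub (h1.mem γ hγ)
  obtain ⟨q, hq, h⟩ := exists_le_family hκ p.stem (fun _ : Unit => p) (fun _ => τ) (fun _ => f)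
    (fun _ => c) (fun _ => rfl) (fun _ => p.stem_extends_self) (fun _ => h1)
    (fun _ => h2.trans_eq (p.stem_theta le_rfl).symm) (fun _ => h3) hS hT (hS.lt_ord hf) hb
    (fun _ => hsub) (fun _ _ ν ν' σ hh hh' => ⟨hh.unique hsl hh', fun _ _ => rfl⟩) hα
  exact ⟨q, hq (), h⟩

theorem isFew_topSet (p : MorassCondition κ) : IsFew κ p.topSet := by
  obtain ⟨τ, f, c, h1, h2, h3⟩ := p.exists_isEnum
  exact h1.isFew (h2.trans_lt (p.left_alignment _ le_rfl).2.2)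

theorem isFew_union (hκ : ℵ₀ ≤ κ) {S T : Set Ordinal.{u}} (hS : IsFew κ S) (hT : IsFew κ T) :
    IsFew κ (S ∪ T) := by
  obtain ⟨μ, hμ, e, he⟩ := hS
  obtain ⟨μ', hμ', e', he'⟩ := hT
  classical
  refine ⟨μ + μ', Ordinal.isPrincipal_add_ord hκ hμ hμ',
    fun ξ => if ξ < μ then e ξ else e' (ξ - μ), ?_⟩
  rintro β (hβ | hβ)
  · obtain ⟨ξ, hξ, rfl⟩ := he hβ
    exact ⟨ξ, Set.mem_Iio.2 (lt_of_lt_of_le hξ le_self_add), if_pos hξ⟩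
  · obtain ⟨ξ, hξ, rfl⟩ := he' hβ
    refine ⟨μ + ξ, Set.mem_Iio.2 ((add_lt_add_iff_left _).2 hξ), ?_⟩
    beta_reduce
    rw [if_neg (not_lt.2 le_self_add), Ordinal.add_sub_cancel]

/-- Two conditions with the same stem are compatible if their top sets have a common initial
segment, above which the second lies beyond the first. -/
theorem exists_le_of_stem (hκ : ℵ₀ < κ) (p q : MorassCondition κ) (hlam : p.lam = q.lam)
    (hpq : p.stem.Extends q.stem) (h1 : ∀ β ∈ q.topSet, β ∉ p.topSet → ∀ γ ∈ p.topSet, γ < β)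
    (h2 : ∀ β ∈ q.topSet, β ∈ p.topSet → ∀ γ ∈ p.topSet, γ < β → γ ∈ q.topSet) :
    ∃ r, r ≤ p ∧ r ≤ q := by
  obtain ⟨τ, f, c, p1, p2, p3⟩ := p.exists_isEnum
  obtain ⟨τ', f', c', q1, q2, q3⟩ := q.exists_isEnum
  have hb : ∀ β ∈ p.topSet ∪ q.topSet, β < (succ κ).ord := by
    rintro β (h | h)
    · exact p.topSet_lt h
    · exact q.topSet_lt h
  have hT : IsTopSet (p.topSet ∪ q.topSet) := ⟨.inl p.isTopSet.zero_mem, fun β =>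
    or_congr (p.isTopSet.succ_mem β) (q.isTopSet.succ_mem β)⟩
  obtain ⟨τ'', F, C, hS⟩ := _root_.exists_isEnum hb
  have hτ'' := hS.lt_ord (isFew_union hκ.le p.isFew_topSet q.isFew_topSet)
  have slp : IsSLOOP (fun ν => C (f ν)) τ := hS.c_comp_isSLOOP hT (p1.isSLOOP p.isTopSet)
    fun γ hγ => .inl (p1.mem γ hγ)
  have slq : IsSLOOP (fun ν => C (f' ν)) τ' := hS.c_comp_isSLOOP hT (q1.isSLOOP q.isTopSet)
    fun γ hγ => .inr (q1.mem γ hγ)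
  -- By `h1` the first top set is an initial segment of the union, so its collapse does not change.
  have idp : ∀ ν < τ, C (f ν) = ν := by
    intro ν hν
    have hm := p1.mem ν hν
    rw [hS.c_eq_of_agree p1 (.inl hm) hm fun γ hγ => ⟨fun h => ?_, .inl⟩, p1.c_f ν hν]
    rcases h with h | h
    · exact h
    · by_contra hc
      exact absurd hγ (h1 γ h hc _ hm).not_gt
  -- A value below `τ` comes from an element common to both top sets, and by `h2` the union agrees
  -- with the second top set below it.
  have idq : ∀ ν < τ', C (f' ν) < τ → C (f' ν) = ν := by
    intro ν hν hlt
    have hm := q1.mem ν hν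
    have hmp : f' ν ∈ p.topSet := by
      have e := hS.c_inj (.inl (p1.mem _ hlt)) (.inr hm) (idp _ hlt)
      rw [← e]
      exact p1.mem _ hlt
    rw [hS.c_eq_of_agree q1 (.inr hm) hm fun γ hγ => ⟨fun h => ?_, .inr⟩, q1.c_f ν hν]
    rcases h with h | h
    · exact h2 _ hm hmp γ h hγ
    · exact h
  -- Attaching the first condition is the identity, so `σ = ν < τ`. The second then takes values
  -- below `τ` at arguments below `ν'`, hence is the identity there as well, and both give `σ`.
  have cross : ∀ ν ν' σ, Hits τ (fun ν => C (f ν)) ν σ → Hits τ' (fun ν => C (f' ν)) ν' σ →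
      ν = ν' ∧ ∀ γ < ν, C (f γ) = C (f' γ) := by
    intro ν ν' σ hp hq
    have hσ : σ = ν := by
      rcases hp.2 with h | ⟨hl, hs⟩
      · exact h.trans (idp ν hp.1)
      · rw [Set.image_congr (s := Set.Iio ν) fun γ hγ => idp γ (lt_trans hγ hp.1), Set.image_id'] at hs
        exact hs.unique hl.isLUB_Iio
    subst hσ
    have hid : ∀ γ < ν', C (f' γ) = γ := fun γ hγ =>
      idq γ (hγ.trans hq.1) ((hq.lt slq hγ).trans hp.1)
    have e : σ = ν' := by
      rcases hq.2 with h | ⟨hl, hs⟩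
      · exact h.trans (idq ν' hq.1 (lt_of_eq_of_lt h.symm hp.1))
      · rw [Set.image_congr (s := Set.Iio ν') fun γ hγ => hid γ hγ, Set.image_id'] at hs
        exact hs.unique hl.isLUB_Iio
    refine ⟨e, fun γ hγ => ?_⟩
    rw [idp γ (hγ.trans hp.1), hid γ (e ▸ hγ)]
  have hth : q.theta q.lam = p.stem.theta p.stem.lam := by
    refine MorassData.theta_eq_of fun β => ?_
    rw [show p.stem.lam = q.lam from hlam]
    refine Iff.trans ?_ ((p.stem.left_alignment q.lam hlam.ge).1 β)
    exact (and_iff_left (le_refl q.lam)).symm.trans (hpq.nodes (q.lam, β) le_rfl)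
  obtain ⟨r, hr, -⟩ := exists_le_family hκ p.stem (fun b : Bool => if b then p else q)
    (fun b => if b then τ else τ') (fun b => if b then f else f') (fun b => if b then c else c')
    (by rintro (_ | _); exacts [hlam.symm, rfl])
    (by rintro (_ | _); exacts [hpq, p.stem_extends_self])
    (by rintro (_ | _); exacts [q1, p1])
    (by rintro (_ | _); exacts [q2.trans_eq hth, p2.trans_eq (p.stem_theta le_rfl).symm])
    (by rintro (_ | _); exacts [q3, p3])
    hS hT hτ'' hb (by rintro (_ | _); exacts [Set.subset_union_right, Set.subset_union_left])
    (by
      rintro (_ | _) (_ | _) ν ν' σ h h'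
      · exact ⟨h.unique slq h', fun _ _ => rfl⟩
      · obtain ⟨e, h3⟩ := cross ν' ν σ h' h
        exact ⟨e.symm, fun γ hγ => (h3 γ (e ▸ hγ)).symm⟩
      · exact cross ν ν' σ h h'
      · exact ⟨h.unique slp h', fun _ _ => rfl⟩)
    (α := 0) (lt_of_le_of_lt (zero_le) hτ'')
  exact ⟨r, hr true, hr false⟩

end MorassCondition

/-! ### Existence of conditions -/

/-- The stem with a single node, at level `0`. -/
noncomputable def Stem.single (κ : Cardinal.{u}) (hκ : ℵ₀ < κ) : Stem κ where
  nodes := {(0, 0)}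
  rel _ _ := False
  map _ _ _ := 0
  lam := 0
  lam_lt := (Cardinal.isSuccLimit_ord hκ.le).pos
  level_le := by
    rintro x rfl
    exact le_rfl
  rel_nodes _ _ h := h.elim
  rel_trans _ _ _ h := h.elim
  rel_linear _ _ _ h := h.elim
  left_alignment := by
    intro α hα
    obtain rfl : α = 0 := le_antisymm hα zero_le
    have h : ∀ β : Ordinal.{u}, ((0, β) : MorassNode.{u}) ∈ ({(0, 0)} : Set MorassNode.{u}) ↔
        β < 1 := by
      intro β
      rw [Set.mem_singleton_iff, Prod.mk.injEq, Order.lt_one_iff]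
      simp
    rw [MorassData.theta_eq_of h]
    exact ⟨h, zero_lt_one, zero_add (1 : Ordinal.{u}) ▸ (Cardinal.isSuccLimit_ord hκ.le).add_one_lt
      (Cardinal.isSuccLimit_ord hκ.le).pos⟩
  monotonicity _ _ h := h.elim
  commutativity _ _ _ h := h.elim
  m1 _ _ h := h.elim
  m2 _ _ h := h.elim
  m3 := by
    rintro y rfl γ hγ
    exact absurd hγ (by simp [l])
  m4 := by
    rintro y rfl - ε hε
    exact absurd hε (by simp [l])
  m5 := by
    rintro y rfl -
    ext β
    simp [o]
  m6 _ _ h := h.1.elim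
  m7 _ _ h := h.1.elim

theorem isTopSet_Iio_omega0 : IsTopSet (Set.Iio ω) where
  zero_mem := Ordinal.omega0_pos
  succ_mem β := ⟨fun h => Ordinal.isSuccLimit_omega0.add_one_lt h,
    fun h => (lt_add_one β).trans h⟩

/-- Amalgamating the empty family over the one-node stem, with top set `ω`. Without it the largest
element would be alone and the conditions would not be dense. -/
theorem MorassCondition.nonempty {κ : Cardinal.{u}} (hκ : ℵ₀ < κ) :
    Nonempty (MorassCondition κ) := by
  have hω : ω < κ.ord := by
    rw [← Cardinal.ord_aleph0]
    exact Cardinal.ord_lt_ord.2 hκ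
  obtain ⟨q, -⟩ := MorassCondition.exists_le_family hκ (Stem.single κ hκ) (I := Empty)
    (fun i => i.elim) (fun i => i.elim) (fun i => i.elim) (fun i => i.elim) (fun i => i.elim)
    (fun i => i.elim) (fun i => i.elim) (fun i => i.elim) (fun i => i.elim)
    (S' := Set.Iio ω) (τ' := ω) (f' := id) (c' := id)
    ⟨fun _ h => h, fun _ h => h, fun _ _ => rfl, fun _ _ => rfl, fun _ _ h _ => h⟩
    isTopSet_Iio_omega0 hω
    (fun β hβ => (lt_trans hβ hω).trans (Cardinal.ord_lt_ord.2 (Order.lt_succ κ)))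
    (fun i => i.elim) (fun i => i.elim) (α := 0) (Ordinal.omega0_pos.trans hω)
  exact ⟨q⟩

/-! ### What an extension preserves, and directed unions -/

namespace MorassCondition

variable {κ : Cardinal.{u}}

section Le

variable {p q : MorassCondition κ} {x y : MorassNode.{u}}

theorem nodes_of_le (h : q ≤ p) (hx : x ∈ p.nodes) : x ∈ q.nodes := h.1 hx

theorem lam_le_of_le (h : q ≤ p) : p.lam ≤ q.lam := h.2.2.2.2.1

theorem rel_of_le (h : q ≤ p) (hxy : p.rel x y) : q.rel x y :=
  (h.2.2.1 x (p.rel_nodes _ _ hxy).1 y (p.rel_nodes _ _ hxy).2).1 hxy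

theorem map_of_le (h : q ≤ p) (hxy : p.rel x y) : q.map x y = p.map x y := by
  funext γ
  by_cases hγ : γ ≤ o x
  · exact (h.2.2.2.1 x y hxy γ hγ).symm
  · rw [p.map_eq_zero x y γ fun h' => hγ h'.2, q.map_eq_zero x y γ fun h' => hγ h'.2]

theorem node_of_le (h : q ≤ p) (hx : x ∈ q.nodes) (hl : l x ≤ p.lam) : x ∈ p.nodes := by
  rcases q.nodes_bounded x hx with h' | h'
  · exact (h.2.1 x hl h'.2).2 hx
  · exact absurd p.lam_lt (not_lt.2 (h'.1 ▸ hl))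

/-- No nodes are added on levels up to `λ^p`, so the predecessors of `y` there are already final in
`p`, even when `y` has level `κ`. -/
theorem rel_of_le' (h : q ≤ p) (hxy : q.rel x y) (hy : y ∈ p.nodes) (hl : l x ≤ p.lam) :
    p.rel x y :=
  (h.2.2.1 x (node_of_le h (q.rel_nodes _ _ hxy).1 hl) y hy).2 hxy

theorem level_cases' (p : MorassCondition κ) (hx : x ∈ p.nodes) (h : l x < κ.ord) :
    l x ≤ p.lam ∧ o x < κ.ord := by
  rcases p.nodes_bounded x hx with h' | h'
  · exact h'
  · exact absurd h (h'.1 ▸ lt_irrefl _)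

end Le

/-! ### Directed unions of conditions -/

section Directed

variable (C : Set (MorassCondition κ))

/-- The union of the tree orders of the conditions in `C`. -/
def unionRel (x y : MorassNode.{u}) : Prop := ∃ p ∈ C, p.rel x y

open Classical in
/-- The union of the maps of the conditions in `C`. -/
noncomputable def unionMap (x y : MorassNode.{u}) : Ordinal.{u} → Ordinal.{u} :=
  if h : ∃ p ∈ C, p.rel x y then h.choose.map x y else fun _ => 0

variable {C} {p : MorassCondition κ} {x y z : MorassNode.{u}}
  (hd : ∀ p ∈ C, ∀ q ∈ C, ∃ r ∈ C, r ≤ p ∧ r ≤ q)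

include hd

theorem unionMap_eq (hp : p ∈ C) (h : p.rel x y) : unionMap C x y = p.map x y := by
  have hex : ∃ p ∈ C, p.rel x y := ⟨p, hp, h⟩
  rw [unionMap, dif_pos hex]
  obtain ⟨r, -, h1, h2⟩ := hd p hp _ hex.choose_spec.1
  rw [← map_of_le h1 h, ← map_of_le h2 hex.choose_spec.2]

theorem rel_of_unionRel (hp : p ∈ C) (h : unionRel C x y) (hy : y ∈ p.nodes)
    (hl : l x ≤ p.lam) : p.rel x y := by
  obtain ⟨q, hq, h⟩ := h
  obtain ⟨r, -, h1, h2⟩ := hd p hp q hq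
  exact rel_of_le' h1 (rel_of_le h2 h) hy hl

theorem exists_rel_rel {x' y' : MorassNode.{u}} (h : unionRel C x y) (h' : unionRel C x' y') :
    ∃ p ∈ C, p.rel x y ∧ p.rel x' y' := by
  obtain ⟨p, hp, h⟩ := h
  obtain ⟨q, hq, h'⟩ := h'
  obtain ⟨r, hr, h1, h2⟩ := hd p hp q hq
  exact ⟨r, hr, rel_of_le h1 h, rel_of_le h2 h'⟩

theorem unionRel_trans (h : unionRel C x y) (h' : unionRel C y z) : unionRel C x z := by
  obtain ⟨p, hp, h1, h2⟩ := exists_rel_rel hd h h'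
  exact ⟨p, hp, p.rel_trans _ _ _ h1 h2⟩

theorem unionRel_m2 (h : unionRel C x y) {ν : Ordinal.{u}} (hν : ν < o x) :
    unionRel C (l x, ν) (l y, unionMap C x y ν) ∧
      ∀ γ ≤ ν, unionMap C (l x, ν) (l y, unionMap C x y ν) γ = unionMap C x y γ := by
  obtain ⟨p, hp, h⟩ := h
  obtain ⟨h1, h2⟩ := p.m2 x y h ν hν
  rw [unionMap_eq hd hp h]
  refine ⟨⟨p, hp, h1⟩, fun γ hγ => ?_⟩
  rw [unionMap_eq hd hp h1]
  exact h2 γ hγ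

omit hd in
/-- The node whose predecessors in a directed union determine those of `y` in the stem with top
level `lam`: a node of level `lam` is replaced by a node of level `κ`. -/
noncomputable def lift (κ : Cardinal.{u}) (lam : Ordinal.{u}) (f : Ordinal.{u} → Ordinal.{u})
    (y : MorassNode.{u}) : MorassNode.{u} :=
  open Classical in if l y = lam then (κ.ord, f (o y)) else y

omit hd in
variable (C) in
open Classical in
/-- The data of the stem below all conditions in `C`. -/
noncomputable def unionData (lam τ : Ordinal.{u}) (f c : Ordinal.{u} → Ordinal.{u}) :
    MorassData.{u} where
  nodes := {x | l x < lam ∧ ∃ p ∈ C, x ∈ p.nodes} ∪ {x | l x = lam ∧ o x < τ}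
  rel x y := (l y < lam ∨ (l y = lam ∧ o y < τ)) ∧ unionRel C x (lift κ lam f y)
  map x y γ := if l y = lam then c (unionMap C x (lift κ lam f y) γ) else unionMap C x y γ
  lam := lam

variable {lam τ : Ordinal.{u}} {f c : Ordinal.{u} → Ordinal.{u}}

omit hd in
theorem lift_low (h : l y < lam) : lift κ lam f y = y := if_neg h.ne

omit hd in
theorem lift_top (ν : Ordinal.{u}) : lift κ lam f (lam, ν) = (κ.ord, f ν) := if_pos rfl

omit hd in
theorem unionData_map_low (h : l y < lam) (γ : Ordinal.{u}) :
    (unionData C lam τ f c).map x y γ = unionMap C x y γ := if_neg h.ne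

omit hd in
theorem unionData_map_top (ν γ : Ordinal.{u}) :
    (unionData C lam τ f c).map x (lam, ν) γ = c (unionMap C x (κ.ord, f ν) γ) :=
  (if_pos rfl).trans (by rw [lift_top])

variable (hlt : ∀ p ∈ C, p.lam < lam)

omit hd in
include hlt in
theorem level_lt_of_unionRel (h : unionRel C x y) : l x < lam := by
  obtain ⟨p, hp, h⟩ := h
  exact (p.level_lt_of_rel h).1.trans_lt (hlt p hp)

omit hd in
include hlt in
theorem unionData_level_lt (h : (unionData C lam τ f c).rel x y) : l x < lam :=
  level_lt_of_unionRel hlt h.2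

omit hd in
theorem unionData_rel_top {ν : Ordinal.{u}} (hν : ν < τ) :
    (unionData C lam τ f c).rel x (lam, ν) ↔ unionRel C x (κ.ord, f ν) := by
  refine ⟨fun h => ?_, fun h => ⟨.inr ⟨rfl, hν⟩, ?_⟩⟩
  · have := h.2
    rwa [lift_top] at this
  · rwa [lift_top]

omit hd in
theorem unionData_rel_low_iff (hy : l y < lam) :
    (unionData C lam τ f c).rel x y ↔ unionRel C x y := by
  refine ⟨fun h => ?_, fun h => ⟨.inl hy, ?_⟩⟩
  · have := h.2
    rwa [lift_low hy] at this
  · rwa [lift_low hy]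

variable (hlam : lam < κ.ord)

include hlt hlam

theorem unionData_rel_low (hp : p ∈ C) (hyp : y ∈ p.nodes) (hy : l y < lam) :
    (unionData C lam τ f c).rel x y ↔ p.rel x y := by
  rw [unionData_rel_low_iff hy]
  refine ⟨fun h => ?_, fun h => ⟨p, hp, h⟩⟩
  obtain ⟨q, hq, h'⟩ := h
  exact rel_of_unionRel hd hp ⟨q, hq, h'⟩ hyp
    ((q.monotonicity _ _ h').le.trans (p.level_cases' hyp (hy.trans hlam)).1)

theorem unionData_levelsBelow (hp : p ∈ C) (hyp : y ∈ p.nodes) (hy : l y < lam) :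
    (unionData C lam τ f c).levelsBelow y = p.levelsBelow y := by
  ext α
  exact exists_congr fun x => and_congr_left fun _ => unionData_rel_low hd hlt hlam hp hyp hy

omit hlt hlam in
theorem unionData_image_low (hp : p ∈ C) (hy : l y < lam) (h : p.rel x y) {A : Set Ordinal.{u}} :
    (unionData C lam τ f c).map x y '' A = p.map x y '' A :=
  Set.image_congr fun γ _ => by rw [unionData_map_low hy, unionMap_eq hd hp h]

theorem unionData_immRel (hp : p ∈ C) (hyp : y ∈ p.nodes) (hy : l y < lam)
    (h : (unionData C lam τ f c).immRel x y) : p.immRel x y := by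
  have key := fun x => unionData_rel_low (x := x) (τ := τ) (f := f) (c := c) hd hlt hlam hp hyp hy
  refine ⟨(key x).1 h.1, fun z hz => h.2 z ⟨?_, (key z).2 hz.2⟩⟩
  rw [unionData_rel_low hd hlt hlam hp (p.rel_nodes _ _ hz.2).1
    ((p.monotonicity _ _ hz.2).trans hy)]
  exact hz.1

omit hd hlam in
theorem unionData_node_low (hy : l y < lam) :
    y ∈ (unionData C lam τ f c).nodes ↔ ∃ p ∈ C, y ∈ p.nodes := by
  refine ⟨fun h => ?_, fun h => .inl ⟨hy, h⟩⟩
  rcases h with h | h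
  · exact h.2
  · exact absurd hy (h.1 ▸ lt_irrefl _)

theorem unionData_node_iff (hp : p ∈ C) (hy : l y ≤ p.lam) :
    y ∈ (unionData C lam τ f c).nodes ↔ y ∈ p.nodes := by
  have hyl := hy.trans_lt (hlt p hp)
  rw [unionData_node_low hlt hyl]
  refine ⟨fun ⟨q, hq, h⟩ => ?_, fun h => ⟨p, hp, h⟩⟩
  obtain ⟨r, -, h1, h2⟩ := hd p hp q hq
  exact node_of_le h1 (nodes_of_le h2 h) hy

theorem unionData_theta (hp : p ∈ C) {α : Ordinal.{u}} (hα : α ≤ p.lam) :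
    (unionData C lam τ f c).theta α = p.theta α :=
  MorassData.theta_eq_of fun β => by
    rw [unionData_node_iff hd hlt hlam hp (show l (α, β) ≤ p.lam from hα)]
    exact (p.left_alignment α hα).1 β

omit hd hlt in
theorem unionData_theta_top : (unionData C lam τ f c).theta lam = τ :=
  MorassData.theta_eq_of fun β => by
    refine ⟨fun h => ?_, fun h => .inr ⟨rfl, h⟩⟩
    rcases h with h | h
    · exact absurd h.1 (lt_irrefl _)
    · exact h.2

variable (hS : IsEnum (⋃ p ∈ C, p.topSet) τ f c) (hT : IsTopSet (⋃ p ∈ C, p.topSet))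
  (hcof : ∀ ε < lam, ∃ p ∈ C, ε < p.lam)

omit hd hlt hlam in
theorem exists_mem_topSet (hS : IsEnum (⋃ p ∈ C, p.topSet) τ f c) {ν : Ordinal.{u}} (hν : ν < τ) :
    ∃ p ∈ C, f ν ∈ p.topSet := by
  have := hS.mem ν hν
  simpa using this

omit hlt hlam in
include hS hcof in
theorem exists_mem_topSet_lt {ν ε : Ordinal.{u}} (hν : ν < τ) (hε : ε < lam) :
    ∃ p ∈ C, f ν ∈ p.topSet ∧ ε < p.lam := by
  obtain ⟨p, hp, h⟩ := exists_mem_topSet hS hν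
  obtain ⟨q, hq, h'⟩ := hcof ε hε
  obtain ⟨r, hr, h1, h2⟩ := hd p hp q hq
  exact ⟨r, hr, nodes_of_le h1 h, h'.trans_le (lam_le_of_le h2)⟩

omit hd hlt hlam in
theorem mem_topSet_iUnion (hp : p ∈ C) {β : Ordinal.{u}} (h : β ∈ p.topSet) :
    β ∈ ⋃ p ∈ C, p.topSet := Set.mem_biUnion hp h

omit hlt hlam in
theorem unionMap_mem {β : Ordinal.{u}} (h : unionRel C x (κ.ord, β)) {γ : Ordinal.{u}}
    (hγ : γ ≤ o x) : unionMap C x (κ.ord, β) γ ∈ ⋃ p ∈ C, p.topSet := by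
  obtain ⟨p, hp, h⟩ := h
  rw [unionMap_eq hd hp h]
  refine mem_topSet_iUnion hp ?_
  rcases hγ.lt_or_eq with hγ | rfl
  · exact (p.rel_nodes _ _ (p.m2 _ _ h γ hγ).1).2
  · rw [(p.m1 _ _ h).2]
    exact (p.rel_nodes _ _ h).2

omit hd hlt hlam in
theorem unionData_cases (h : (unionData C lam τ f c).rel x y) :
    l y < lam ∨ ∃ ν < τ, y = (lam, ν) := by
  rcases h.1 with h | h
  · exact .inl h
  · exact .inr ⟨o y, h.2, Prod.ext h.1 rfl⟩

omit hlam in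
include hS hcof in
/-- Nodes of the top level have predecessors on cofinally many levels. -/
theorem exists_rel_top {ν ε : Ordinal.{u}} (hν : ν < τ) (hε : ε < lam) :
    ∃ x, (unionData C lam τ f c).rel x (lam, ν) ∧ ε < l x ∧ l x < lam := by
  obtain ⟨p, hp, h1, h2⟩ := exists_mem_topSet_lt hd hS hcof hν hε
  obtain ⟨τ', f', c', e1, e2, e3⟩ := p.exists_isEnum
  have := e3 _ (e1.lt _ h1)
  rw [e1.f_c _ h1] at this
  exact ⟨_, (unionData_rel_top hν).2 ⟨p, hp, this⟩, h2, hlt p hp⟩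

theorem unionData_m1 (hS : IsEnum (⋃ p ∈ C, p.topSet) τ f c) (hT : IsTopSet (⋃ p ∈ C, p.topSet))
    (h : (unionData C lam τ f c).rel x y) :
    IsSLOOP ((unionData C lam τ f c).map x y) (o x + 1) ∧
      (unionData C lam τ f c).map x y (o x) = o y := by
  rcases unionData_cases h with hy | ⟨ν, hν, rfl⟩
  · obtain ⟨p, hp, h⟩ := (unionData_rel_low_iff hy).1 h
    have e : ∀ γ, (unionData C lam τ f c).map x y γ = p.map x y γ := fun γ => by
      rw [unionData_map_low hy, unionMap_eq hd hp h]
    rw [e]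
    exact ⟨(p.m1 _ _ h).1.congr fun γ _ => e γ, (p.m1 _ _ h).2⟩
  · have h' := (unionData_rel_top hν).1 h
    obtain ⟨p, hp, h⟩ := (unionData_rel_top hν).1 h
    rw [unionData_map_top]
    refine ⟨(hS.c_comp_isSLOOP hT (g := unionMap C x (κ.ord, f ν)) ?_ fun γ hγ =>
      unionMap_mem hd h' (Order.lt_add_one_iff.1 hγ)).congr fun γ _ => unionData_map_top ν γ, ?_⟩
    · rw [unionMap_eq hd hp h]
      exact (p.m1 _ _ h).1
    · rw [unionMap_eq hd hp h, (p.m1 _ _ h).2]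
      exact hS.c_f ν hν

include hd hlt hlam hS hT hcof

theorem unionData_m3 {y : MorassNode.{u}} (hy : y ∈ (unionData C lam τ f c).nodes) :
    ClosedIn ((unionData C lam τ f c).levelsBelow y) (l y) := by
  rcases hy with ⟨hy, p, hp, hyp⟩ | ⟨hy, hyτ⟩
  · rw [unionData_levelsBelow hd hlt hlam hp hyp hy]
    exact p.m3 y hyp
  · obtain ⟨yl, ν⟩ := y
    obtain rfl : yl = lam := hy
    have hν : ν < τ := hyτ
    intro d hd' hl hu
    obtain ⟨p, hp, h1, h2⟩ := exists_mem_topSet_lt hd hS hcof hν hd'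
    -- As `d < λ^p` and `f ν` belongs to the top set of `p`, the predecessors up to level `d` are
    -- those that `p` sees below the top node; M.3 of `p` at level `κ` then applies.
    have key : ∀ x, l x ≤ d → ((unionData C yl τ f c).rel x (yl, ν) ↔ p.rel x (κ.ord, f ν)) := by
      intro x hx
      rw [unionData_rel_top hν]
      exact ⟨fun h => rel_of_unionRel hd hp h h1 (hx.trans h2.le), fun h => ⟨p, hp, h⟩⟩
    obtain ⟨x, hx, e⟩ := p.m3 _ h1 d (lt_trans hd' hlam) hl fun ε hε => by
      obtain ⟨α, ⟨x, hx, e⟩, h3, h4⟩ := hu ε hε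
      exact ⟨α, ⟨x, (key x (e ▸ h4.le)).1 hx, e⟩, h3, h4⟩
    exact ⟨x, (key x e.le).2 hx, e⟩

theorem unionData_m5 {y : MorassNode.{u}} (hy : y ∈ (unionData C lam τ f c).nodes)
    (hu : UnboundedIn ((unionData C lam τ f c).levelsBelow y) (l y)) :
    Set.Iio (o y) = {β | ∃ x, (unionData C lam τ f c).rel x y ∧
      β ∈ (unionData C lam τ f c).map x y '' Set.Iio (o x)} := by
  rcases hy with ⟨hy, p, hp, hyp⟩ | ⟨hy, hyτ⟩
  · rw [unionData_levelsBelow hd hlt hlam hp hyp hy] at hu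
    rw [p.m5 y hyp hu]
    ext β
    refine exists_congr fun x => ?_
    rw [unionData_rel_low hd hlt hlam hp hyp hy]
    refine and_congr_right fun h => ?_
    rw [unionData_image_low hd hp hy h]
  · obtain ⟨yl, ν⟩ := y
    obtain rfl : yl = lam := hy
    have hν : ν < τ := hyτ
    ext μ
    constructor
    · intro hμ
      have hμ : μ < ν := hμ
      obtain ⟨p, hp, h1⟩ := exists_mem_topSet hS hν
      obtain ⟨q, hq, h2⟩ := exists_mem_topSet hS (hμ.trans hν)
      -- Once a single `r` has both `f μ` and `f ν` in its top set, the predecessor of `⟨λ, ν⟩` on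
      -- level `λ^r` has `μ` in the range of its map.
      obtain ⟨r, hr, h3, h4⟩ := hd p hp q hq
      replace h1 : f ν ∈ r.topSet := nodes_of_le h3 h1
      replace h2 : f μ ∈ r.topSet := nodes_of_le h4 h2
      obtain ⟨τ', f', c', e1, e2, e3⟩ := r.exists_isEnum
      have hrel := e3 _ (e1.lt _ h1)
      have hlt' : c' (f μ) < c' (f ν) := (e1.c_lt_iff h2 h1).2 (hS.strictMono _ _ hμ hν)
      have hmap := map_top e1 e3 (e1.lt _ h1) hlt'.le
      rw [e1.f_c _ h1] at hrel hmap
      refine ⟨(r.lam, c' (f ν)), (unionData_rel_top hν).2 ⟨r, hr, hrel⟩, c' (f μ), hlt', ?_⟩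
      rw [unionData_map_top, unionMap_eq hd hr hrel, hmap, e1.f_c _ h2, hS.c_f _ (hμ.trans hν)]
    · rintro ⟨x, hx, γ, hγ, rfl⟩
      obtain ⟨h1, h2⟩ := unionData_m1 hd hlt hlam hS hT hx
      exact lt_of_lt_of_eq (h1.2.2.2 _ _ hγ (lt_add_one _)) h2

/-- Each member of `C` with `f ν` in its top set contributes a predecessor on its own top level, and
these levels are cofinal. So M.6 and M.7, restricted to immediate successors, say nothing on the new
level; this is what that restriction in the definition of conditions achieves. -/
theorem unionData_not_immRel {ν : Ordinal.{u}} (hν : ν < τ) :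
    ¬ (unionData C lam τ f c).immRel x (lam, ν) := by
  intro h
  obtain ⟨z, hz, h1, h2⟩ := exists_rel_top hd hlt hS hcof hν (unionData_level_lt hlt h.1)
  refine h.2 z ⟨?_, hz⟩
  rw [unionData_rel_low_iff h2]
  obtain ⟨p, hp, h3, h4⟩ := exists_rel_rel hd ((unionData_rel_top hν).1 h.1)
    ((unionData_rel_top hν).1 hz)
  exact ⟨p, hp, p.rel_of_level_lt h3 h4 h1⟩

/-- The stem below all conditions in `C`. -/
noncomputable def unionStem (hτ : τ < κ.ord) : Stem κ where
  toMorassData := unionData C lam τ f c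
  lam_lt := hlam
  level_le := by
    rintro x (hx | hx)
    · exact hx.1.le
    · exact hx.1.le
  rel_nodes := by
    intro x y h
    have hx := unionData_level_lt hlt h
    rcases unionData_cases h with hy | ⟨ν, hν, rfl⟩
    · obtain ⟨p, hp, h⟩ := (unionData_rel_low_iff hy).1 h
      exact ⟨.inl ⟨hx, p, hp, (p.rel_nodes _ _ h).1⟩, .inl ⟨hy, p, hp, (p.rel_nodes _ _ h).2⟩⟩
    · obtain ⟨p, hp, h⟩ := (unionData_rel_top hν).1 h
      exact ⟨.inl ⟨hx, p, hp, (p.rel_nodes _ _ h).1⟩, .inr ⟨rfl, hν⟩⟩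
  rel_trans := by
    intro x y z hxy hyz
    have hy := unionData_level_lt hlt hyz
    exact ⟨hyz.1, unionRel_trans hd ((unionData_rel_low_iff hy).1 hxy) hyz.2⟩
  rel_linear := by
    intro x x' y h h'
    obtain ⟨p, hp, h1, h2⟩ := exists_rel_rel hd h.2 h'.2
    rcases p.rel_linear h1 h2 with e | e | e
    · exact .inl e
    · exact .inr (.inl ((unionData_rel_low_iff (unionData_level_lt hlt h')).2 ⟨p, hp, e⟩))
    · exact .inr (.inr ((unionData_rel_low_iff (unionData_level_lt hlt h)).2 ⟨p, hp, e⟩))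
  left_alignment := by
    intro α hα
    rcases (show α ≤ lam from hα).lt_or_eq with h | rfl
    · obtain ⟨p, hp, h1⟩ := hcof α h
      rw [unionData_theta hd hlt hlam hp h1.le]
      refine ⟨fun β => ?_, (p.left_alignment α h1.le).2⟩
      rw [unionData_node_iff hd hlt hlam hp (show l (α, β) ≤ p.lam from h1.le)]
      exact (p.left_alignment α h1.le).1 β
    · rw [unionData_theta_top hlam]
      refine ⟨fun β => ⟨fun h => ?_, fun h => .inr ⟨rfl, h⟩⟩, hS.tau_pos hT, hτ⟩
      rcases h with h | h
      · exact absurd h.1 (lt_irrefl _)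
      · exact h.2
  monotonicity := by
    intro x y h
    rcases unionData_cases h with hy | ⟨ν, hν, rfl⟩
    · obtain ⟨p, hp, h⟩ := (unionData_rel_low_iff hy).1 h
      exact p.monotonicity _ _ h
    · exact unionData_level_lt hlt h
  commutativity := by
    intro x y z hxy hyz γ hγ
    have hy := unionData_level_lt hlt hyz
    rw [unionData_map_low hy]
    obtain ⟨p, hp, h1, h2⟩ := exists_rel_rel hd ((unionData_rel_low_iff hy).1 hxy) hyz.2
    have key : unionMap C y (lift κ lam f z) (unionMap C x y γ) =
        unionMap C x (lift κ lam f z) γ := by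
      rw [unionMap_eq hd hp h1, unionMap_eq hd hp h2, unionMap_eq hd hp (p.rel_trans _ _ _ h1 h2)]
      exact p.commutativity _ _ _ h1 h2 γ hγ
    rcases unionData_cases hyz with hz | ⟨ν, hν, rfl⟩
    · rw [lift_low hz] at key
      rw [unionData_map_low hz, unionData_map_low hz, key]
    · rw [lift_top] at key
      rw [unionData_map_top, unionData_map_top, key]
  m1 x y h := unionData_m1 hd hlt hlam hS hT h
  m2 := by
    intro x y h ν hν
    rcases unionData_cases h with hy | ⟨μ, hμ, rfl⟩
    · obtain ⟨h1, h2⟩ := unionRel_m2 hd ((unionData_rel_low_iff hy).1 h) hν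
      rw [unionData_map_low hy]
      refine ⟨(unionData_rel_low_iff (y := (l y, unionMap C x y ν)) hy).2 h1, fun γ hγ => ?_⟩
      rw [unionData_map_low hy, unionData_map_low (y := (l y, unionMap C x y ν)) hy]
      exact h2 γ hγ
    · have h' := (unionData_rel_top hμ).1 h
      obtain ⟨h1, h2⟩ := unionRel_m2 hd h' hν
      have hm := unionMap_mem hd h' hν.le
      rw [unionData_map_top]
      change (unionData C lam τ f c).rel (l x, ν) (lam, _) ∧ ∀ γ ≤ ν,
        (unionData C lam τ f c).map (l x, ν) (lam, _) γ = _
      rw [unionData_rel_top (hS.lt _ hm), hS.f_c _ hm]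
      refine ⟨h1, fun γ hγ => ?_⟩
      rw [unionData_map_top, unionData_map_top, hS.f_c _ hm]
      exact congrArg c (h2 γ hγ)
  m3 y hy := unionData_m3 hd hlt hlam hS hT hcof hy
  m4 := by
    rintro y (⟨hy, p, hp, hyp⟩ | ⟨hy, hyτ⟩) ht
    · have hl := (p.level_cases' hyp (hy.trans hlam)).1
      rw [unionData_theta hd hlt hlam hp hl] at ht
      rw [unionData_levelsBelow hd hlt hlam hp hyp hy]
      exact p.m4 y hyp hl ht
    · obtain ⟨yl, ν⟩ := y
      obtain rfl : yl = lam := hy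
      intro ε hε
      obtain ⟨x, hx, h1, h2⟩ := exists_rel_top hd hlt hS hcof hyτ hε
      exact ⟨l x, ⟨x, hx, rfl⟩, h1, h2⟩
  m5 y hy hu := unionData_m5 hd hlt hlam hS hT hcof hy hu
  m6 := by
    intro x y h hx ν hν
    rcases unionData_cases h.1 with hy | ⟨μ, hμ, rfl⟩
    · obtain ⟨p, hp, h'⟩ := (unionData_rel_low_iff hy).1 h.1
      have hyp := (p.rel_nodes _ _ h').2
      rw [unionData_image_low hd hp hy h'] at hν
      obtain ⟨h1, h2⟩ := p.m6 x y (unionData_immRel hd hlt hlam hp hyp hy h)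
        (p.level_cases' hyp (hy.trans hlam)).1 hx ν hν
      refine ⟨(unionData_rel_low_iff (y := (l y, ν)) hy).2 ⟨p, hp, h1⟩, fun γ hγ => ?_⟩
      rw [unionData_map_low hy, unionData_map_low (y := (l y, ν)) hy, unionMap_eq hd hp h1,
        unionMap_eq hd hp h']
      exact h2 γ hγ
    · exact absurd h (unionData_not_immRel hd hlt hlam hS hT hcof hμ)
  m7 := by
    intro x y h α hα1 hα2 hx hν hα
    rcases unionData_cases h.1 with hy | ⟨μ, hμ, rfl⟩
    · obtain ⟨p, hp, h'⟩ := (unionData_rel_low_iff hy).1 h.1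
      have hyp := (p.rel_nodes _ _ h').2
      rw [unionData_image_low hd hp hy h'] at hν
      obtain ⟨γ, hγ⟩ := p.m7 x y (unionData_immRel hd hlt hlam hp hyp hy h)
        (p.level_cases' hyp (hy.trans hlam)).1 α hα1 hα2 hx hν fun ν hν => by
          obtain ⟨γ, hγ⟩ := hα ν hν
          rw [unionData_map_low hy, unionMap_eq hd hp h',
            unionData_rel_low hd hlt hlam hp (y := (l y, p.map x y ν))
              (p.rel_nodes _ _ (p.m2 _ _ h' ν hν).1).2 hy] at hγ
          exact ⟨γ, hγ⟩
      exact ⟨γ, (unionData_rel_low_iff hy).2 ⟨p, hp, hγ⟩⟩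
    · exact absurd h (unionData_not_immRel hd hlt hlam hS hT hcof hμ)

/-- The supremum level copies the top nodes of the union: a node there has exactly the predecessors
that the members of `C` give to the corresponding node of level `κ`. -/
theorem exists_le_directed (hτ : τ < κ.ord) : ∃ r : MorassCondition κ, ∀ p ∈ C, r ≤ p := by
  let t := unionStem hd hlt hlam hS hT hcof hτ
  have hb : ∀ β ∈ ⋃ p ∈ C, p.topSet, β < (succ κ).ord := by
    intro β hβ
    simp only [Set.mem_iUnion] at hβ
    obtain ⟨p, -, h⟩ := hβ
    exact p.topSet_lt h
  have hτ' : τ ≤ t.theta t.lam := (unionData_theta_top hlam).ge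
  refine ⟨t.toCondition hS hT hτ' hb, fun p hp => ?_⟩
  obtain ⟨τ₁, f₁, c₁, e1, e2, e3⟩ := p.exists_isEnum
  refine toCondition_le hS hT hτ' hb e1 e3 ⟨(hlt p hp).le, fun x hx => ?_, fun x y hy => ?_,
    fun x y hxy γ hγ => ?_⟩ (hlt p hp) ⟨(hlt p hp).le, fun x y hxy h1 h2 => ?_⟩
    (fun β hβ => mem_topSet_iUnion hp hβ) fun ν hν => ?_
  · exact (and_iff_left hx).trans (unionData_node_iff hd hlt hlam hp hx).symm
  · refine (and_iff_left hy).trans ⟨fun h => ?_, fun h => ?_⟩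
    · exact (unionData_rel_low_iff ((show l y ≤ p.lam from hy).trans_lt (hlt p hp))).2 ⟨p, hp, h⟩
    · have hn := (t.rel_nodes _ _ h).2
      have hn := (unionData_node_iff hd hlt hlam hp hy).1 hn
      exact (unionData_rel_low hd hlt hlam hp hn
        ((show l y ≤ p.lam from hy).trans_lt (hlt p hp))).1 h
  · have hy := lt_of_le_of_lt hxy.2 (hlt p hp)
    exact ((unionData_map_low hy γ).trans (congrFun (unionMap_eq hd hp hxy.1) γ)).symm
  -- Any edge of the union belongs to some `r ≤ p` in `C`, and `λ^p` is a mangal of `r`.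
  · have key : ∀ w, unionRel C x w → p.lam < l w → ∃ z, l z = p.lam ∧ unionRel C x z ∧
        unionRel C z w := by
      rintro w ⟨q, hq, h⟩ hw
      obtain ⟨r, hr, h3, h4⟩ := hd p hp q hq
      obtain ⟨z, hz, e, h5, h6⟩ := h3.2.2.2.2.2 x w (rel_of_le h4 h) h1 hw
      exact ⟨z, e, ⟨r, hr, h5⟩, ⟨r, hr, h6⟩⟩
    have hw : p.lam < l (lift κ lam f y) := by
      rcases unionData_cases hxy with hy | ⟨ν, hν, rfl⟩
      · rwa [lift_low hy]
      · rw [lift_top]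
        exact p.lam_lt
    obtain ⟨z, e, h5, h6⟩ := key _ hxy.2 hw
    have hz : l z < lam := e ▸ hlt p hp
    have h7 : t.rel z y := ⟨hxy.1, h6⟩
    exact ⟨z, (t.rel_nodes _ _ h7).1, e, (unionData_rel_low_iff hz).2 h5, h7⟩
  · have hm := mem_topSet_iUnion hp (e1.mem ν hν)
    have hrel : unionRel C (p.lam, ν) (κ.ord, f (c (f₁ ν))) := by
      rw [hS.f_c _ hm]
      exact ⟨p, hp, e3 ν hν⟩
    refine ⟨(unionData_rel_top (hS.lt _ hm)).2 hrel, fun γ hγ => ?_⟩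
    refine (unionData_map_top _ _).trans ?_
    rw [hS.f_c _ hm, unionMap_eq hd hp (e3 ν hν), map_top e1 e3 hν hγ]

end Directed

end MorassCondition

/-! ### Bounds from regularity -/

theorem exists_bound {κ : Cardinal.{u}} (hreg : κ.IsRegular) {A : Type u} (hA : #A < κ)
    (f : A → Ordinal.{u}) (hf : ∀ a, f a < κ.ord) : ∃ b < κ.ord, ∀ a, f a < b := by
  refine ⟨⨆ a, f a + 1, Ordinal.iSup_add_one_lt_of_lt_cof (by rwa [hreg.cof_ord]) hf, fun a => ?_⟩
  exact (lt_add_one (f a)).trans_le (Ordinal.le_iSup (fun a => f a + 1) a)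

theorem exists_bound_Iio {κ : Cardinal.{u}} (hreg : κ.IsRegular) {i : Ordinal.{u}}
    (hi : i.card < κ) (f : Ordinal.{u} → Ordinal.{u}) (hf : ∀ j < i, f j < κ.ord) :
    ∃ b < κ.ord, ∀ j < i, f j < b := by
  obtain ⟨b, hb, h⟩ := exists_bound hreg (A := i.ToType) (by rwa [Cardinal.mk_toType])
    (fun a => f (Ordinal.ToType.toOrd a)) (fun a => hf _ (Ordinal.ToType.toOrd a).2)
  refine ⟨b, hb, fun j hj => ?_⟩
  have := h (Ordinal.ToType.mk ⟨j, hj⟩)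
  simpa using this

theorem IsFew.biUnion {κ : Cardinal.{u}} (hreg : κ.IsRegular) {i : Ordinal.{u}} (hi : i < κ.ord)
    {S : Ordinal.{u} → Set Ordinal.{u}} (hS : ∀ j < i, IsFew κ (S j)) :
    IsFew κ (⋃ j ∈ Set.Iio i, S j) := by
  choose! μ hμ e he using hS
  obtain ⟨b, hb, hlt⟩ := exists_bound_Iio hreg (Cardinal.lt_ord.1 hi) μ hμ
  -- With a common bound `b` on the index sets, the pair `(j, ζ)` is coded as `b * j + ζ` and
  -- recovered by division.
  refine ⟨b * i, Ordinal.isPrincipal_mul_ord hreg.aleph0_le hb hi, fun ξ => e (ξ / b) (ξ % b), ?_⟩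
  intro β hβ
  simp only [Set.mem_iUnion, Set.mem_Iio] at hβ
  obtain ⟨j, hj, hβ⟩ := hβ
  obtain ⟨ζ, hζ, rfl⟩ := he j hj hβ
  have hζb : ζ < b := lt_trans hζ (hlt j hj)
  have hb0 : b ≠ 0 := (pos_of_gt hζb).ne'
  refine ⟨b * j + ζ, ?_, ?_⟩
  · have h1 : b * j + ζ < b * (j + 1) := by
      rw [mul_add, mul_one]
      exact (add_lt_add_iff_left _).2 hζb
    exact Set.mem_Iio.2 (h1.trans_le (by gcongr; exact Order.add_one_le_of_lt hj))
  · beta_reduce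
    rw [Ordinal.mul_add_div _ hb0, Ordinal.div_eq_zero_of_lt hζb, add_zero,
      Ordinal.mul_add_mod_self, Ordinal.mod_eq_of_lt hζb]

theorem IsFew.exists_bound {κ : Cardinal.{u}} {S : Set Ordinal.{u}} (hS : IsFew κ S)
    {κ' : Cardinal.{u}} (hreg : κ'.IsRegular) (hκ : κ ≤ κ') (g : Ordinal.{u} → Ordinal.{u})
    (hg : ∀ β ∈ S, g β < κ'.ord) : ∃ b < κ'.ord, ∀ β ∈ S, g β < b := by
  classical
  obtain ⟨μ, hμ, e, he⟩ := hS
  obtain ⟨b, hb, h⟩ := exists_bound_Iio hreg ((Cardinal.lt_ord.1 hμ).trans_le hκ)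
    (fun ξ => if e ξ ∈ S then g (e ξ) else 0) (fun ξ _ => by
      split_ifs with h
      · exact hg _ h
      · exact (Cardinal.isSuccLimit_ord hreg.aleph0_le).pos)
  refine ⟨b, hb, fun β hβ => ?_⟩
  obtain ⟨ξ, hξ, rfl⟩ := he hβ
  have := h ξ hξ
  rwa [if_pos hβ] at this

namespace MorassCondition

variable {κ : Cardinal.{u}}

/-! ### Closure and distributivity -/

/-- A decreasing sequence of limit length below `κ` with increasing top levels has a lower bound. -/
theorem exists_le_chain (hreg : κ.IsRegular) {i : Ordinal.{u}} (hi : i < κ.ord)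
    (hl : IsSuccLimit i) (c : Ordinal.{u} → MorassCondition κ)
    (hc : ∀ j k, j < k → k < i → c k ≤ c j ∧ (c j).lam < (c k).lam) :
    ∃ r, ∀ j < i, r ≤ c j := by
  have hle : ∀ j k, j ≤ k → k < i → c k ≤ c j := by
    intro j k hjk hk
    rcases hjk.lt_or_eq with h | rfl
    · exact (hc j k h hk).1
    · exact le_rfl
  let C : Set (MorassCondition κ) := c '' Set.Iio i
  have hd : ∀ p ∈ C, ∀ q ∈ C, ∃ r ∈ C, r ≤ p ∧ r ≤ q := by
    rintro _ ⟨j, hj, rfl⟩ _ ⟨k, hk, rfl⟩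
    exact ⟨c (max j k), ⟨_, Set.mem_Iio.2 (max_lt hj hk), rfl⟩, hle _ _ (le_max_left _ _) (max_lt hj hk),
      hle _ _ (le_max_right _ _) (max_lt hj hk)⟩
  obtain ⟨b, hb, hbl⟩ := exists_bound_Iio hreg (Cardinal.lt_ord.1 hi) (fun j => (c j).lam)
    (fun j _ => (c j).lam_lt)
  -- The least strict upper bound of the top levels; because the length is a limit and the levels
  -- increase, they are cofinal in it.
  let B : Set Ordinal.{u} := {b | ∀ j < i, (c j).lam < b}
  have hB : sInf B ∈ B := csInf_mem ⟨b, hbl⟩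
  have hlt : ∀ p ∈ C, p.lam < sInf B := by
    rintro _ ⟨j, hj, rfl⟩
    exact hB j hj
  have hlam : sInf B < κ.ord := (csInf_le' (show b ∈ B from hbl)).trans_lt hb
  have hcof : ∀ ε < sInf B, ∃ p ∈ C, ε < p.lam := by
    intro ε hε
    have : ε ∉ B := notMem_of_lt_csInf' hε
    simp only [B, Set.mem_ofPred_eq, not_forall, not_lt] at this
    obtain ⟨j, hj, h⟩ := this
    have hj' := hl.add_one_lt hj
    exact ⟨c (j + 1), ⟨_, hj', rfl⟩, h.trans_lt (hc j _ (lt_add_one j) hj').2⟩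
  have hfew : IsFew κ (⋃ p ∈ C, p.topSet) := by
    have := IsFew.biUnion hreg hi (S := fun j => (c j).topSet) fun j _ => (c j).isFew_topSet
    rwa [show ⋃ p ∈ C, p.topSet = ⋃ j ∈ Set.Iio i, (c j).topSet from Set.biUnion_image]
  have hT : IsTopSet (⋃ p ∈ C, p.topSet) := by
    refine ⟨Set.mem_biUnion (x := c 0) ⟨0, hl.pos, rfl⟩ (c 0).isTopSet.zero_mem, fun β => ?_⟩
    simp only [Set.mem_iUnion]
    exact exists_congr fun p => exists_congr fun _ => p.isTopSet.succ_mem β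
  obtain ⟨τ, f, e, hS⟩ := _root_.exists_isEnum (S := ⋃ p ∈ C, p.topSet) (b := (succ κ).ord) (by
    intro β hβ
    simp only [Set.mem_iUnion] at hβ
    obtain ⟨p, -, h⟩ := hβ
    exact p.topSet_lt h)
  obtain ⟨r, hr⟩ := exists_le_directed hd hlt hlam hS hT hcof (hS.lt_ord hfew)
  exact ⟨r, fun j hj => hr _ ⟨j, hj, rfl⟩⟩

theorem exists_le_lam_gt (hκ : ℵ₀ < κ) (p : MorassCondition κ) {α : Ordinal.{u}}
    (hα : α < κ.ord) : ∃ q ≤ p, p.lam < q.lam ∧ α ≤ q.lam := by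
  obtain ⟨q, h1, h2, h3, -⟩ := exists_le_topSet hκ p p.isFew_topSet p.isTopSet
    (fun _ h => p.topSet_lt h) subset_rfl hα
  exact ⟨q, h1, h2, h3⟩

/-- Fewer than `κ` open dense sets of conditions have a common element below any condition. -/
theorem exists_le_forall (hreg : κ.IsRegular) (hκ : ℵ₀ < κ) {δ : Ordinal.{u}} (hδ : δ < κ.ord)
    {D : Ordinal.{u} → MorassCondition κ → Prop} (hD : ∀ i < δ, ∀ p, ∃ q ≤ p, D i q)
    (hmono : ∀ i p q, q ≤ p → D i p → D i q) (p : MorassCondition κ) :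
    ∃ q ≤ p, ∀ i < δ, D i q := by
  classical
  -- Besides entering the dense set, every step raises the top level, which the lower bound at limit
  -- stages requires.
  have hstep : ∀ (i : Ordinal.{u}) (q : MorassCondition κ),
      ∃ r ≤ q, q.lam < r.lam ∧ (i < δ → D i r) := by
    intro i q
    obtain ⟨r, h1, h2, -⟩ := exists_le_lam_gt hκ q (α := 0)
      (Cardinal.isSuccLimit_ord hreg.aleph0_le).pos
    by_cases hi : i < δ
    · obtain ⟨s, hs, h⟩ := hD i hi r
      exact ⟨s, hs.trans h1, h2.trans_le (lam_le_of_le hs), fun _ => h⟩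
    · exact ⟨r, h1, h2, fun h => absurd h hi⟩
  choose step st1 st2 st3 using hstep
  -- The recursion must be total, hence the default `p`; `main` shows that it is not needed up to
  -- `δ`.
  let lb : Set (MorassCondition κ) → MorassCondition κ := fun A =>
    if h : ∃ r ≤ p, ∀ a ∈ A, r ≤ a then h.choose else p
  let c : Ordinal.{u} → MorassCondition κ := WellFoundedLT.fix fun i ih =>
    step i (lb {q | ∃ j, ∃ h : j < i, ih j h = q})
  have hc : ∀ i, c i = step i (lb {q | ∃ j, ∃ _ : j < i, c j = q}) := fun i =>
    WellFoundedLT.fix_eq _ i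
  have hlb : ∀ i, (∃ r ≤ p, ∀ j < i, r ≤ c j) →
      lb {q | ∃ j, ∃ _ : j < i, c j = q} ≤ p ∧ ∀ j < i, lb {q | ∃ j, ∃ _ : j < i, c j = q} ≤ c j := by
    rintro i ⟨r, h1, h2⟩
    have hex : ∃ r ≤ p, ∀ a ∈ {q | ∃ j, ∃ _ : j < i, c j = q}, r ≤ a := by
      refine ⟨r, h1, ?_⟩
      rintro _ ⟨j, hj, rfl⟩
      exact h2 j hj
    simp only [lb, dif_pos hex]
    exact ⟨hex.choose_spec.1, fun j hj => hex.choose_spec.2 _ ⟨j, hj, rfl⟩⟩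
  have main : ∀ i ≤ δ, ∃ r ≤ p, ∀ j < i, r ≤ c j := by
    intro i
    induction i using WellFoundedLT.induction with
    | ind i ih =>
      intro hi
      have good : ∀ j < i, c j ≤ p ∧ ∀ k < j, c j ≤ c k ∧ (c k).lam < (c j).lam := by
        intro j hj
        obtain ⟨h1, h2⟩ := hlb j (ih j hj (hj.le.trans hi))
        rw [hc j]
        refine ⟨(st1 _ _).trans h1, fun k hk => ⟨(st1 _ _).trans (h2 k hk), ?_⟩⟩
        exact (lam_le_of_le (h2 k hk)).trans_lt (st2 _ _)
      rcases Ordinal.exists_add_one_or_isSuccLimit i with rfl | ⟨j, rfl⟩ | hl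
      · exact ⟨p, le_rfl, fun j hj => absurd hj (by simp)⟩
      · refine ⟨c j, (good j (lt_add_one j)).1, fun k hk => ?_⟩
        rcases (Order.lt_add_one_iff.1 hk).lt_or_eq with h | rfl
        · exact ((good j (lt_add_one j)).2 k h).1
        · exact le_rfl
      · obtain ⟨r, hr⟩ := exists_le_chain hreg (hi.trans_lt hδ) hl c
          fun j k hjk hk => (good k hk).2 j hjk
        exact ⟨r, (hr 0 hl.pos).trans (good 0 hl.pos).1, hr⟩
  obtain ⟨r, h1, h2⟩ := main δ le_rfl
  refine ⟨r, h1, fun i hi => hmono i _ _ (h2 i hi) ?_⟩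
  rw [hc i]
  exact st3 _ _ hi

/-! ### The chain condition -/

/-- The coordinates of the nodes of `p` below level `κ`, and of `S^p ∩ γ` under `E`, are bounded by
`μ`. -/
def CodeBounded (γ : Ordinal.{u}) (E : Ordinal.{u} → Ordinal.{u}) (μ : Ordinal.{u})
    (p : MorassCondition κ) : Prop :=
  p.lam < μ ∧ (∀ x ∈ p.nodes, l x ≤ p.lam → o x < μ) ∧ ∀ β ∈ p.topSet, β < γ → E β < μ

/-- The type of codes of stems bounded by `μ`. -/
abbrev CodeAt (X : Type u) : Type u :=
  Set X × Set (X × X) × Set ((X × X) × (X × X)) × Set (((X × X) × (X × X)) × (X × X)) × Set X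

/-- The code of the stem of `p` and of `S^p ∩ γ`. -/
noncomputable def codeAt (γ : Ordinal.{u}) (E : Ordinal.{u} → Ordinal.{u}) (μ : Ordinal.{u})
    (p : MorassCondition κ) : CodeAt μ.ToType :=
  let d : μ.ToType → Ordinal.{u} := fun a => (Ordinal.ToType.toOrd a : Set.Iio μ).1
  ({a | d a = p.lam}, {a | (d a.1, d a.2) ∈ p.nodes},
    {a | p.rel (d a.1.1, d a.1.2) (d a.2.1, d a.2.2)},
    {a | p.map (d a.1.1.1, d a.1.1.2) (d a.1.2.1, d a.1.2.2) (d a.2.1) = d a.2.2},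
    {a | ∃ β ∈ p.topSet, β < γ ∧ E β = d a})

/-- With all coordinates below `μ`, every node, edge and map value of the stem is visible in the
code, and injectivity of `E` on `γ` recovers the trace of the top set. -/
theorem codeAt_eq {γ μ : Ordinal.{u}} {E : Ordinal.{u} → Ordinal.{u}} {p q : MorassCondition κ}
    (hE : ∀ β < γ, ∀ β' < γ, E β = E β' → β = β') (hp : CodeBounded γ E μ p)
    (hq : CodeBounded γ E μ q) (h : codeAt γ E μ p = codeAt γ E μ q) :
    p.lam = q.lam ∧ p.stem.Extends q.stem ∧ ∀ β < γ, (β ∈ p.topSet ↔ β ∈ q.topSet) := by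
  simp only [codeAt, Prod.mk.injEq] at h
  obtain ⟨h1, h2, h3, h4, h5⟩ := h
  have hd : ∀ α < μ, ∃ a : μ.ToType, (Ordinal.ToType.toOrd a : Set.Iio μ).1 = α := fun α hα =>
    ⟨Ordinal.ToType.mk ⟨α, hα⟩, by simp⟩
  have elam : p.lam = q.lam := by
    obtain ⟨a, ha⟩ := hd _ hp.1
    rw [← ha]
    exact (Set.ext_iff.1 h1 a).1 ha
  have bnd : ∀ x, (x ∈ p.nodes ∨ x ∈ q.nodes) → l x ≤ p.lam → ∃ a b : μ.ToType,
      ((Ordinal.ToType.toOrd a : Set.Iio μ).1, (Ordinal.ToType.toOrd b : Set.Iio μ).1) = x := by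
    rintro x hx hl
    obtain ⟨a, ha⟩ := hd _ (hl.trans_lt hp.1)
    have : o x < μ := by
      rcases hx with hx | hx
      · exact hp.2.1 x hx hl
      · exact hq.2.1 x hx (elam ▸ hl)
    obtain ⟨b, hb⟩ := hd _ this
    exact ⟨a, b, Prod.ext ha hb⟩
  have rel : ∀ x y, l y ≤ p.lam → (p.rel x y ∨ q.rel x y) → (p.rel x y ↔ q.rel x y) := by
    intro x y hy hxy
    have hx : l x ≤ p.lam := by
      rcases hxy with h | h
      · exact (p.monotonicity _ _ h).le.trans hy
      · exact (q.monotonicity _ _ h).le.trans hy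
    obtain ⟨a, b, rfl⟩ := bnd x (hxy.imp (fun h => (p.rel_nodes _ _ h).1)
      fun h => (q.rel_nodes _ _ h).1) hx
    obtain ⟨a', b', rfl⟩ := bnd y (hxy.imp (fun h => (p.rel_nodes _ _ h).2)
      fun h => (q.rel_nodes _ _ h).2) hy
    exact Set.ext_iff.1 h3 ((a, b), (a', b'))
  refine ⟨elam, ⟨elam.ge, fun x hx => ?_, fun x y hy => ?_, fun x y hxy γ hγ => ?_⟩, fun β hβ => ?_⟩
  · change (x ∈ q.nodes ∧ l x ≤ q.lam) ↔ (x ∈ p.nodes ∧ l x ≤ p.lam)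
    rw [elam, and_congr_left_iff]
    intro hx
    constructor
    · intro h
      obtain ⟨a, b, rfl⟩ := bnd x (.inr h) (elam ▸ hx)
      exact (Set.ext_iff.1 h2 (a, b)).2 h
    · intro h
      obtain ⟨a, b, rfl⟩ := bnd x (.inl h) (elam ▸ hx)
      exact (Set.ext_iff.1 h2 (a, b)).1 h
  · change (q.rel x y ∧ l y ≤ q.lam) ↔ (p.rel x y ∧ l y ≤ p.lam)
    rw [elam, and_congr_left_iff]
    intro hy
    exact ⟨fun h => (rel x y (elam ▸ hy) (.inr h)).2 h, fun h => (rel x y (elam ▸ hy) (.inl h)).1 h⟩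
  · have hy : l y ≤ p.lam := elam ▸ hxy.2
    have hq' : q.rel x y := hxy.1
    have hp' : p.rel x y := (rel x y hy (.inr hq')).2 hq'
    have nx := (p.rel_nodes _ _ hp').1
    have ny := (p.rel_nodes _ _ hp').2
    have hx := (p.level_lt_of_rel hp').1
    obtain ⟨a, ha⟩ := hd γ (hγ.trans_lt (hp.2.1 x nx hx))
    obtain ⟨b, hb⟩ := hd (p.map x y γ) ((p.map_le x y hp' γ hγ).trans_lt (hp.2.1 y ny hy))
    obtain ⟨a1, b1, rfl⟩ := bnd x (.inl nx) hx
    obtain ⟨a2, b2, rfl⟩ := bnd y (.inl ny) hy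
    have key := (Set.ext_iff.1 h4 (((a1, b1), (a2, b2)), (a, b))).1 (by
      change p.map _ _ _ = _
      rw [ha, hb])
    change q.map _ _ _ = _ at key
    rw [ha, hb] at key
    exact key
  · constructor
    · intro h
      obtain ⟨a, ha⟩ := hd _ (hp.2.2 β h hβ)
      obtain ⟨β', h6, h7, h8⟩ := (Set.ext_iff.1 h5 a).1 ⟨β, h, hβ, ha.symm⟩
      rwa [hE β hβ β' h7 (ha.symm.trans h8.symm)]
    · intro h
      obtain ⟨a, ha⟩ := hd _ (hq.2.2 β h hβ)
      obtain ⟨β', h6, h7, h8⟩ := (Set.ext_iff.1 h5 a).2 ⟨β, h, hβ, ha.symm⟩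
      rwa [hE β hβ β' h7 (ha.symm.trans h8.symm)]

/-- The one place where the hypothesis on powers is applied: finite products of `X` stay below `κ`,
so each component of a code has at most `κ` values. -/
theorem mk_codeAt_le (hκ : ℵ₀ ≤ κ) (hpow : ∀ μ : Cardinal.{u}, μ < κ → 2 ^ μ ≤ κ) {X : Type u}
    (hX : #X < κ) : #(CodeAt X) ≤ κ := by
  have hset : ∀ {Y : Type u}, #Y < κ → #(Set Y) ≤ κ := fun hY => by
    rw [Cardinal.mk_set]
    exact hpow _ hY
  have hlt : ∀ {Y Z : Type u}, #Y < κ → #Z < κ → #(Y × Z) < κ := fun hY hZ => by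
    rw [Cardinal.mk_prod, Cardinal.lift_id, Cardinal.lift_id]
    exact Cardinal.mul_lt_of_lt hκ hY hZ
  have hle : ∀ {Y Z : Type u}, #Y ≤ κ → #Z ≤ κ → #(Y × Z) ≤ κ := fun hY hZ => by
    rw [Cardinal.mk_prod, Cardinal.lift_id, Cardinal.lift_id]
    exact (mul_le_mul' hY hZ).trans_eq (Cardinal.mul_eq_self hκ)
  have h2 := hlt hX hX
  have h4 := hlt h2 h2
  exact hle (hset hX) (hle (hset h2) (hle (hset h4) (hle (hset (hlt h4 h2)) (hset hX))))

theorem exists_injOn_Iio {κ : Cardinal.{u}} {γ : Ordinal.{u}} (hγ : γ < (succ κ).ord) :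
    ∃ E : Ordinal.{u} → Ordinal.{u}, (∀ β < γ, E β < κ.ord) ∧
      ∀ β < γ, ∀ β' < γ, E β = E β' → β = β' := by
  classical
  have h : #γ.ToType ≤ #κ.ord.ToType := by
    rw [Cardinal.mk_toType, Cardinal.mk_toType, Cardinal.card_ord]
    exact Order.lt_succ_iff.1 (Cardinal.lt_ord.1 hγ)
  obtain ⟨e⟩ := h
  refine ⟨fun β => if h : β < γ then (Ordinal.ToType.toOrd (e (Ordinal.ToType.mk ⟨β, h⟩)) :
    Set.Iio κ.ord).1 else 0, fun β hβ => ?_, fun β hβ β' hβ' heq => ?_⟩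
  · beta_reduce
    rw [dif_pos hβ]
    exact (Ordinal.ToType.toOrd (e _)).2
  · beta_reduce at heq
    rw [dif_pos hβ, dif_pos hβ'] at heq
    have := e.injective (Ordinal.ToType.mk.symm.injective (Subtype.ext heq))
    exact congrArg Subtype.val (by simpa using this)

theorem exists_codeBounded (hreg : κ.IsRegular) (γ : Ordinal.{u}) {E : Ordinal.{u} → Ordinal.{u}}
    (hE : ∀ β < γ, E β < κ.ord) (p : MorassCondition κ) : ∃ μ < κ.ord, CodeBounded γ E μ p := by
  classical
  have hpos : 0 < κ.ord := (Cardinal.isSuccLimit_ord hreg.aleph0_le).pos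
  obtain ⟨b, hb, h1⟩ := exists_bound_Iio hreg (i := p.lam + 1)
    (Cardinal.lt_ord.1 ((Cardinal.isSuccLimit_ord hreg.aleph0_le).add_one_lt p.lam_lt)) p.theta
    fun j hj => (p.left_alignment j (Order.lt_add_one_iff.1 hj)).2.2
  obtain ⟨b', hb', h2⟩ := p.isFew_topSet.exists_bound hreg le_rfl
    (fun β => if β < γ then E β else 0) (fun β _ => by
      split_ifs with h
      · exact hE β h
      · exact hpos)
  refine ⟨max (p.lam + 1) (max b b'), max_lt ((Cardinal.isSuccLimit_ord hreg.aleph0_le).add_one_lt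
    p.lam_lt) (max_lt hb hb'), lt_max_of_lt_left (lt_add_one _), fun x hx hl => ?_,
    fun β hβ hlt => ?_⟩
  · refine lt_max_of_lt_right (lt_max_of_lt_left ?_)
    exact (((p.left_alignment _ hl).1 _).1 hx).trans (h1 _ (Order.lt_add_one_iff.2 hl))
  · refine lt_max_of_lt_right (lt_max_of_lt_right ?_)
    have := h2 β hβ
    rwa [if_pos hlt] at this

/-- Below `κ⁺`, every condition of a family has the same stem and the same trace on `γ` as some
member of the family with small index. -/
theorem exists_reflection (hreg : κ.IsRegular) (hpow : ∀ μ : Cardinal.{u}, μ < κ → 2 ^ μ ≤ κ)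
    (D : Set Ordinal.{u}) (hD : ∀ d ∈ D, d < (succ κ).ord) (q : Ordinal.{u} → MorassCondition κ)
    {γ : Ordinal.{u}} (hγ : γ < (succ κ).ord) :
    ∃ b < (succ κ).ord, γ < b ∧ ∀ d ∈ D, ∃ d' ∈ D, d' < b ∧ (∀ β ∈ (q d').topSet, β < b) ∧
      (q d').lam = (q d).lam ∧ (q d').stem.Extends (q d).stem ∧
      ∀ β < γ, (β ∈ (q d').topSet ↔ β ∈ (q d).topSet) := by
  classical
  have hκ := hreg.aleph0_le
  have hreg' := Cardinal.isRegular_succ hκ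
  have hlim := Cardinal.isSuccLimit_ord hreg'.aleph0_le
  obtain ⟨E, hE1, hE2⟩ := exists_injOn_Iio hγ
  -- All codes over all bounds `m < κ`. There are at most `κ` of them, so choosing one member of the
  -- family for each realised code keeps indices and top sets bounded below `κ⁺`.
  let K : Type u := Σ m : κ.ord.ToType, CodeAt ((Ordinal.ToType.toOrd m : Set.Iio κ.ord).1).ToType
  have hK : #K < succ κ := by
    refine Order.lt_succ_iff.2 ?_
    have h1 : ∀ m : κ.ord.ToType,
        #(CodeAt ((Ordinal.ToType.toOrd m : Set.Iio κ.ord).1).ToType) ≤ κ := fun m => by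
      refine mk_codeAt_le hκ hpow ?_
      rw [Cardinal.mk_toType]
      exact Cardinal.lt_ord.1 (Ordinal.ToType.toOrd m).2
    rw [Cardinal.mk_sigma]
    refine (Cardinal.sum_le_sum _ _ h1).trans ?_
    rw [Cardinal.sum_const', Cardinal.mk_toType, Cardinal.card_ord, Cardinal.mul_eq_self hκ]
  let P : K → Ordinal.{u} → Prop := fun k d => d ∈ D ∧
    CodeBounded γ E (Ordinal.ToType.toOrd k.1 : Set.Iio κ.ord).1 (q d) ∧
    codeAt γ E (Ordinal.ToType.toOrd k.1 : Set.Iio κ.ord).1 (q d) = k.2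
  have hbd : ∀ d ∈ D, ∃ b < (succ κ).ord, d < b ∧ ∀ β ∈ (q d).topSet, β < b := by
    intro d hd
    obtain ⟨b, hb, h⟩ := (q d).isFew_topSet.exists_bound hreg' (Order.le_succ κ) id
      fun β hβ => (q d).topSet_lt hβ
    exact ⟨max b (d + 1), max_lt hb (hlim.add_one_lt (hD d hd)),
      lt_max_of_lt_right (lt_add_one d), fun β hβ => lt_max_of_lt_left (h β hβ)⟩
  have hex : ∀ k : K, ∃ b < (succ κ).ord, (∃ d, P k d) →
      ∃ d, P k d ∧ d < b ∧ ∀ β ∈ (q d).topSet, β < b := by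
    intro k
    by_cases h : ∃ d, P k d
    · obtain ⟨d, hd⟩ := h
      obtain ⟨b, hb, h1, h2⟩ := hbd d hd.1
      exact ⟨b, hb, fun _ => ⟨d, hd, h1, h2⟩⟩
    · exact ⟨0, hlim.pos, fun h' => absurd h' h⟩
  choose bk hbk hbk' using hex
  obtain ⟨b, hb, hlt⟩ := _root_.exists_bound hreg' hK bk hbk
  refine ⟨max b (γ + 1), max_lt hb (hlim.add_one_lt hγ), lt_max_of_lt_right (lt_add_one γ),
    fun d hd => ?_⟩
  obtain ⟨μ, hμ, hcb⟩ := exists_codeBounded hreg γ hE1 (q d)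
  obtain ⟨m, rfl⟩ : ∃ m : κ.ord.ToType, (Ordinal.ToType.toOrd m : Set.Iio κ.ord).1 = μ :=
    ⟨Ordinal.ToType.mk ⟨μ, hμ⟩, by simp⟩
  obtain ⟨d', hd', h1, h2⟩ := hbk' ⟨m, codeAt γ E _ (q d)⟩ ⟨d, hd, hcb, rfl⟩
  have h3 := codeAt_eq hE2 hd'.2.1 hcb hd'.2.2
  have h4 := lt_max_of_lt_left (c := γ + 1) (hlt ⟨m, codeAt γ E _ (q d)⟩)
  exact ⟨d', hd'.1, h1.trans h4, fun β hβ => (h2 β hβ).trans h4, h3⟩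

/-- The chain condition: a family of conditions indexed by an unbounded subset of `κ⁺` contains two
compatible conditions. -/
theorem exists_compatible (hreg : κ.IsRegular) (hκ : ℵ₀ < κ)
    (hpow : ∀ μ : Cardinal.{u}, μ < κ → 2 ^ μ ≤ κ) (D : Set Ordinal.{u})
    (hD : ∀ d ∈ D, d < (succ κ).ord) (hunb : ∀ b < (succ κ).ord, ∃ d ∈ D, b ≤ d)
    (q : Ordinal.{u} → MorassCondition κ) :
    ∃ d ∈ D, ∃ d' ∈ D, d ≠ d' ∧ ∃ r, r ≤ q d ∧ r ≤ q d' := by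
  classical
  have hreg' := Cardinal.isRegular_succ hreg.aleph0_le
  have hκlt : κ.ord < (succ κ).ord := Cardinal.ord_lt_ord.2 (Order.lt_succ κ)
  have href := fun (γ : Ordinal.{u}) (hγ : γ < (succ κ).ord) =>
    exists_reflection hreg hpow D hD q hγ
  choose! F hF1 hF2 hF3 using href
  -- Reflection is iterated with suprema, up to stage `κ`. Stage `κ` matters because a top set,
  -- having fewer than `κ` elements, cannot be cofinal in `g κ`.
  let g : Ordinal.{u} → Ordinal.{u} := WellFoundedLT.fix fun i ih =>
    ⨆ j : Set.Iio i, F (ih j.1 j.2)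
  have hg : ∀ i, g i = ⨆ j : Set.Iio i, F (g j.1) := fun i => WellFoundedLT.fix_eq _ i
  have hle : ∀ j i, j < i → F (g j) ≤ g i := by
    intro j i h
    rw [hg i]
    exact Ordinal.le_iSup (fun j : Set.Iio i => F (g j.1)) ⟨j, h⟩
  have hlt : ∀ i ≤ κ.ord, g i < (succ κ).ord := by
    intro i
    induction i using WellFoundedLT.induction with
    | ind i ih =>
      intro hi
      obtain ⟨b, hb, h⟩ := exists_bound_Iio hreg' (Cardinal.lt_ord.1 (hi.trans_lt hκlt))
        (fun j => F (g j)) fun j hj => hF1 _ (ih j hj (hj.le.trans hi))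
      rw [hg i]
      exact (Ordinal.iSup_le fun j : Set.Iio i => (h j.1 j.2).le).trans_lt hb
  have hmono : ∀ j i, j ≤ i → i ≤ κ.ord → g j ≤ g i := by
    intro j i hji hi
    rcases hji.lt_or_eq with h | rfl
    · exact (hF2 _ (hlt j (hji.trans hi))).le.trans (hle j i h)
    · exact le_rfl
  obtain ⟨d, hd, hγd⟩ := hunb (g κ.ord) (hlt _ le_rfl)
  have hex : ∀ β, ∃ i < κ.ord, β < g κ.ord → β < g i := by
    intro β
    by_cases h : β < g κ.ord
    · have h' := h
      rw [hg κ.ord] at h'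
      obtain ⟨⟨j, hj⟩, hlt'⟩ := Ordinal.lt_iSup_iff.1 h'
      have hj' := (Cardinal.isSuccLimit_ord hκ.le).add_one_lt hj
      exact ⟨j + 1, hj', fun _ => hlt'.trans_le (hle _ _ (lt_add_one j))⟩
    · exact ⟨0, (Cardinal.isSuccLimit_ord hκ.le).pos, fun h' => absurd h' h⟩
  choose idx hidx hidx' using hex
  -- Regularity of `κ`: the part of this top set below `g κ` is already contained in some `g i` with
  -- `i < κ`.
  obtain ⟨i, hi, hi'⟩ := (q d).isFew_topSet.exists_bound hreg le_rfl idx fun β _ => hidx β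
  have htrace : ∀ β ∈ (q d).topSet, β < g κ.ord → β < g i := fun β hβ h =>
    (hidx' β h).trans_le (hmono _ _ (hi' β hβ).le hi.le)
  -- The reflected `d'` and its top set lie below `F (g i) ≤ g κ ≤ d`, with the same trace on `g i`.
  -- Elements of the top set of `q d` missing from that of `q d'` are thus at least `g κ`, above all
  -- of the latter.
  obtain ⟨d', hd', h1, h2, h3, h4, h5⟩ := hF3 (g i) (hlt i hi.le) d hd
  have hb := hle i κ.ord hi
  refine ⟨d', hd', d, hd, ((h1.trans_le hb).trans_le hγd).ne, ?_⟩
  refine exists_le_of_stem hκ (q d') (q d) h3 h4 (fun β hβ hβ' γ hγ => ?_)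
    (fun β hβ hβ' γ hγ hlt' => ?_)
  · refine ((h2 γ hγ).trans_le hb).trans_le (not_lt.1 fun hc => hβ' ?_)
    exact (h5 β (htrace β hβ hc)).2 hβ
  · have := htrace β hβ ((h2 β hβ').trans_le hb)
    exact (h5 γ (hlt'.trans this)).1 hγ

end MorassCondition

namespace MorassCondition

variable {κ : Cardinal.{u}} (p : MorassCondition κ) {x y z : MorassNode.{u}}

/-! ### The axioms M.6 and M.7 for arbitrary pairs -/

theorem map_lt_map (h : p.rel x y) {γ δ : Ordinal.{u}} (hγ : γ < δ) (hδ : δ ≤ o x) :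
    p.map x y γ < p.map x y δ :=
  (p.m1 x y h).1.2.2.2 γ δ hγ (Order.lt_add_one_iff.2 hδ)

theorem map_lt_iff (h : p.rel x y) {γ δ : Ordinal.{u}} (hγ : γ ≤ o x) (hδ : δ ≤ o x) :
    p.map x y γ < p.map x y δ ↔ γ < δ := by
  refine ⟨fun hlt => not_le.1 fun hle => ?_, fun hlt => p.map_lt_map h hlt hδ⟩
  rcases hle.lt_or_eq with h' | rfl
  · exact absurd hlt (p.map_lt_map h h' hγ).not_gt
  · exact lt_irrefl _ hlt

theorem map_lt_o (h : p.rel x y) {γ : Ordinal.{u}} (hγ : γ < o x) : p.map x y γ < o y := by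
  have := p.map_lt_map h hγ le_rfl
  rwa [(p.m1 x y h).2] at this

theorem isSuccLimit_o (h : p.rel x y) (hl : IsSuccLimit (o x)) : IsSuccLimit (o y) := by
  rw [← (p.m1 x y h).2]
  exact (p.m1 x y h).1.2.1 _ (lt_add_one _) hl

theorem map_lt_of_isLUB (h : p.rel x y) (hl : IsSuccLimit (o x)) {ν : Ordinal.{u}}
    (hν : IsLUB (p.map x y '' Set.Iio (o x)) ν) {γ : Ordinal.{u}} (hγ : γ < o x) :
    p.map x y γ < ν :=
  (p.map_lt_map h (lt_add_one γ) (hl.add_one_lt hγ).le).trans_le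
    (hν.1 ⟨γ + 1, hl.add_one_lt hγ, rfl⟩)

theorem le_o_of_isLUB (h : p.rel x y) {ν : Ordinal.{u}}
    (hν : IsLUB (p.map x y '' Set.Iio (o x)) ν) : ν ≤ o y := by
  refine hν.2 ?_
  rintro _ ⟨γ, hγ, rfl⟩
  exact (p.map_lt_o h hγ).le

theorem exists_lt_map_of_isLUB {ν σ : Ordinal.{u}}
    (hν : IsLUB (p.map x y '' Set.Iio (o x)) ν) (hσ : σ < ν) : ∃ γ < o x, σ < p.map x y γ := by
  by_contra hc
  push Not at hc
  refine absurd (hν.2 ?_) (not_le.2 hσ)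
  rintro _ ⟨γ, hγ, rfl⟩
  exact hc γ hγ

theorem exists_isLUB_map (hxy : p.rel x y) (hl : IsSuccLimit (o x)) :
    ∃ σ, IsLUB (p.map x y '' Set.Iio (o x)) σ := by
  refine ⟨_, isLUB_csSup ⟨_, Set.mem_image_of_mem _ (Set.mem_Iio.2 hl.pos)⟩ ⟨o y, ?_⟩⟩
  rintro _ ⟨γ, hγ, rfl⟩
  exact (p.map_lt_o hxy hγ).le

/-- Strict monotonicity of `π_{zy}` pulls a supremum back when it is a value of `π_{zy}`; continuity
is not available. -/
theorem isLUB_of_comp (hxz : p.rel x z) (hzy : p.rel z y) (hl : IsSuccLimit (o x))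
    {ν : Ordinal.{u}} (hνz : ν ≤ o z)
    (hν : IsLUB (p.map x y '' Set.Iio (o x)) (p.map z y ν)) :
    IsLUB (p.map x z '' Set.Iio (o x)) ν := by
  have hxy := p.rel_trans _ _ _ hxz hzy
  refine ⟨?_, fun σ hσ => not_lt.1 fun hlt => ?_⟩
  · rintro _ ⟨γ, hγ, rfl⟩
    have h1 := p.map_lt_of_isLUB hxy hl hν hγ
    rw [← p.commutativity _ _ _ hxz hzy γ (le_of_lt hγ),
      p.map_lt_iff hzy (p.map_le _ _ hxz _ (le_of_lt hγ)) hνz] at h1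
    exact h1.le
  · obtain ⟨γ, hγ, h1⟩ := p.exists_lt_map_of_isLUB hν (p.map_lt_map hzy hlt hνz)
    rw [← p.commutativity _ _ _ hxz hzy γ hγ.le,
      p.map_lt_iff hzy (hlt.le.trans hνz) (p.map_le _ _ hxz _ hγ.le)] at h1
    exact absurd (hσ ⟨γ, hγ, rfl⟩) (not_le.2 h1)

theorem isLUB_o_of_comp (hxz : p.rel x z) (hzy : p.rel z y) (hl : IsSuccLimit (o x))
    (h : IsLUB (p.map x y '' Set.Iio (o x)) (o y)) :
    IsLUB (p.map x z '' Set.Iio (o x)) (o z) :=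
  p.isLUB_of_comp hxz hzy hl le_rfl (by rwa [(p.m1 _ _ hzy).2])

/-- The range of `π_{xz}` on `o x` is cofinal in `o z`, so both images have the same upper bounds.
-/
theorem isLUB_comp (hxz : p.rel x z) (hzy : p.rel z y)
    (hz : IsLUB (p.map x z '' Set.Iio (o x)) (o z)) {ν : Ordinal.{u}} :
    IsLUB (p.map x y '' Set.Iio (o x)) ν ↔ IsLUB (p.map z y '' Set.Iio (o z)) ν := by
  have : upperBounds (p.map x y '' Set.Iio (o x)) = upperBounds (p.map z y '' Set.Iio (o z)) := by
    ext σ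
    constructor
    · rintro h _ ⟨δ, hδ, rfl⟩
      obtain ⟨γ, hγ, h1⟩ := p.exists_lt_map_of_isLUB hz hδ
      refine (p.map_lt_map hzy h1 (p.map_le _ _ hxz _ hγ.le)).le.trans ?_
      rw [p.commutativity _ _ _ hxz hzy γ hγ.le]
      exact h ⟨γ, hγ, rfl⟩
    · rintro h _ ⟨γ, hγ, rfl⟩
      rw [← p.commutativity _ _ _ hxz hzy γ (le_of_lt hγ)]
      exact h ⟨_, p.map_lt_o hxz hγ, rfl⟩
  unfold IsLUB
  rw [this]

/-- If no immediate predecessor lies at or above `x`, the predecessors of `y` have no highest level.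
The supremum of their levels, if below `l y`, would be a limit and hence itself a predecessor level
by M.3, which is impossible. -/
theorem exists_immRel_or_unbounded (hxy : p.rel x y) :
    (∃ w, p.immRel w y ∧ (w = x ∨ p.rel x w)) ∨
      UnboundedIn (p.toMorassData.levelsBelow y) (l y) := by
  by_cases him : ∃ w, p.immRel w y ∧ (w = x ∨ p.rel x w)
  · exact .inl him
  right
  have step : ∀ w, p.rel w y → l x ≤ l w → ∃ z, p.rel z y ∧ l w < l z := by
    intro w hw hlw
    have hxw : w = x ∨ p.rel x w := by
      rcases hlw.lt_or_eq with h | h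
      · exact .inr (p.rel_of_level_lt hxy hw h)
      · exact .inl (p.eq_of_level_eq hw hxy h.symm)
    by_contra hc
    refine him ⟨w, ⟨hw, fun z hz => hc ⟨z, hz.2, p.monotonicity _ _ hz.1⟩⟩, hxw⟩
  let B : Set Ordinal.{u} := {δ | ∀ w, p.rel w y → l w < δ}
  have hBy : l y ∈ B := fun w hw => p.monotonicity _ _ hw
  have hB : sInf B ∈ B := csInf_mem ⟨_, hBy⟩
  have hun : UnboundedIn (p.toMorassData.levelsBelow y) (sInf B) := by
    intro ε hε
    have : ε ∉ B := notMem_of_lt_csInf' hε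
    simp only [B, Set.mem_ofPred_eq, not_forall, not_lt] at this
    obtain ⟨w, hw, hle⟩ := this
    have hmax : ∃ w', p.rel w' y ∧ ε ≤ l w' ∧ l x ≤ l w' := by
      rcases le_total (l x) (l w) with h | h
      · exact ⟨w, hw, hle, h⟩
      · exact ⟨x, hxy, hle.trans h, le_rfl⟩
    obtain ⟨w', hw', h1, h2⟩ := hmax
    obtain ⟨z, hz, h3⟩ := step w' hw' h2
    exact ⟨l z, ⟨z, hz, rfl⟩, h1.trans_lt h3, hB z hz⟩
  rcases (csInf_le' hBy : sInf B ≤ l y).lt_or_eq with hlt | heq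
  · have hlim : IsSuccLimit (sInf B) := by
      rcases Ordinal.exists_add_one_or_isSuccLimit (sInf B) with h | ⟨a, h⟩ | h
      · exact absurd (h ▸ hB x hxy) (by simp)
      · obtain ⟨b, -, h1, h2⟩ := hun a (h ▸ lt_add_one a)
        rw [h, Order.lt_add_one_iff] at h2
        exact absurd h1 h2.not_gt
      · exact h
    obtain ⟨w, hw, he⟩ := p.m3 y (p.rel_nodes _ _ hxy).2 _ hlt hlim hun
    exact absurd (hB w hw) (by rw [he]; exact lt_irrefl _)
  · rwa [heq] at hun

/-- Induction on the level of `y`, then on its order. With an immediate predecessor `w` above `x`,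
compute the supremum `σ` at `w` first. If `σ = o w`, M.6 for `w` and `y` finishes; if `σ < o w`, M.2
replaces `y` by a node of smaller order on the same level. If the levels below `y` are unbounded,
M.5 places `ν` in the range of some `π_{zy}`, and the supremum is found at `z`. -/
theorem m6_of_rel (hxy : p.rel x y) (hy : l y ≤ p.lam) (hl : IsSuccLimit (o x)) {ν : Ordinal.{u}}
    (hν : IsLUB (p.map x y '' Set.Iio (o x)) ν) :
    p.rel x (l y, ν) ∧ ∀ γ < o x, p.map x (l y, ν) γ = p.map x y γ := by
  obtain ⟨α, β⟩ := y
  induction α using WellFoundedLT.induction generalizing x β ν with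
  | ind α ihα =>
  induction β using WellFoundedLT.induction with
  | ind β ihβ =>
  rcases (p.le_o_of_isLUB hxy hν).lt_or_eq with hlt | rfl
  swap
  · exact ⟨hxy, fun _ _ => rfl⟩
  have lift : ∀ z ν', p.rel z (α, β) → p.rel x (l z, ν') → ν' < o z →
      (∀ γ < o x, p.map x (l z, ν') γ = p.map x z γ) → p.rel x z →
      p.rel x (α, p.map z (α, β) ν') ∧
        ∀ γ < o x, p.map x (α, p.map z (α, β) ν') γ = p.map x (α, β) γ := by
    intro z ν' hz hx hν' he hxz
    obtain ⟨h1, h2⟩ := p.m2 z (α, β) hz ν' hν'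
    change p.rel (l z, ν') (α, p.map z (α, β) ν') at h1
    refine ⟨p.rel_trans _ _ _ hx h1, fun γ hγ => ?_⟩
    rw [← p.commutativity _ _ _ hx h1 γ hγ.le, ← p.commutativity _ _ _ hxz hz γ hγ.le, he γ hγ]
    refine h2 _ ?_
    rw [← he γ hγ]
    exact p.map_le _ _ hx γ hγ.le
  rcases p.exists_immRel_or_unbounded hxy with ⟨w, hw, rfl | hxw⟩ | hun
  · exact p.m6 _ _ hw hy hl ν hν
  · have hwα : l w < α := p.monotonicity _ _ hw.1
    obtain ⟨σ, hσ⟩ := p.exists_isLUB_map hxw hl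
    have ih := ihα (l w) hwα hl (o w) hxw (hwα.le.trans hy) hσ
    rcases (p.le_o_of_isLUB hxw hσ).lt_or_eq with hσw | rfl
    · obtain ⟨h1, h2⟩ := lift w σ hw.1 ih.1 hσw ih.2 hxw
      have hlt' := p.map_lt_o hw.1 hσw
      obtain ⟨h3, h4⟩ := ihβ _ hlt' h1 hy (by rwa [Set.image_congr (s := Set.Iio (o x)) h2])
      exact ⟨h3, fun γ hγ => (h4 γ hγ).trans (h2 γ hγ)⟩
    · obtain ⟨h1, h2⟩ := p.m6 w (α, β) hw hy (p.isSuccLimit_o hxw hl) ν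
        ((p.isLUB_comp hxw hw.1 hσ).1 hν)
      refine ⟨p.rel_trans _ _ _ hxw h1, fun γ hγ => ?_⟩
      rw [← p.commutativity _ _ _ hxw h1 γ hγ.le, ← p.commutativity _ _ _ hxw hw.1 γ hγ.le,
        h2 _ (p.map_lt_o hxw hγ)]
  · have hmem : ν ∈ Set.Iio (o (α, β)) := hlt
    rw [p.m5 _ (p.rel_nodes _ _ hxy).2 hun] at hmem
    obtain ⟨z, hz, ν', hν', rfl⟩ := hmem
    -- `ν` exceeds every value of `π_{xy}` below `o x`, so it is not such a value, and `z` cannot be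
    -- `x` or lie below `x`.
    have hxz : p.rel x z := by
      have key : ∀ γ < o x, p.map x (α, β) γ ≠ p.map z (α, β) ν' := fun γ hγ =>
        (p.map_lt_of_isLUB hxy hl hν hγ).ne
      rcases p.rel_linear hxy hz with rfl | h | h
      · exact absurd rfl (key ν' hν')
      · exact h
      · refine absurd (p.commutativity _ _ _ h hxy ν' (le_of_lt hν')) ?_
        exact key _ (p.map_lt_o h hν')
    have hzα : l z < α := p.monotonicity _ _ hz
    have ih := ihα (l z) hzα hl (o z) hxz (hzα.le.trans hy)
      (p.isLUB_of_comp hxz hz hl (le_of_lt hν') hν)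
    exact lift z ν' hz ih.1 hν' ih.2 hxz

/-- Induction on the level of `y`. A predecessor of `y` at level `α` or above takes over the role of
`y`. Otherwise there is an immediate predecessor `w` below `α`, and the hypotheses are transferred
from `x` to `w`. -/
theorem m7_of_rel (hxy : p.rel x y) (hy : l y ≤ p.lam) {α : Ordinal.{u}} (hxα : l x < α)
    (hαy : α < l y) (hl : IsSuccLimit (o x)) (hs : IsLUB (p.map x y '' Set.Iio (o x)) (o y))
    (h : ∀ ν < o x, ∃ γ, p.rel (α, γ) (l y, p.map x y ν)) : ∃ γ, p.rel (α, γ) y := by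
  obtain ⟨δ, β⟩ := y
  induction δ using WellFoundedLT.induction generalizing x β with
  | ind δ ih =>
  have above : ∀ z, p.rel z (δ, β) → α ≤ l z → ∃ γ, p.rel (α, γ) (δ, β) := by
    intro z hz hle
    rcases hle.lt_or_eq with hlt | rfl
    · have hxz := p.rel_of_level_lt hxy hz (hxα.trans hlt)
      obtain ⟨γ, hγ⟩ := ih (l z) (p.monotonicity _ _ hz) hxα hl (o z) hxz
        ((p.monotonicity _ _ hz).le.trans hy) hlt
        (p.isLUB_o_of_comp hxz hz hl hs) (by
          intro ν hν
          obtain ⟨γ, hγ⟩ := h ν hν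
          have h2 := (p.m2 z _ hz _ (p.map_lt_o hxz hν)).1
          rw [p.commutativity _ _ _ hxz hz ν hν.le] at h2
          exact ⟨γ, p.rel_of_level_lt hγ h2 hlt⟩)
      exact ⟨γ, p.rel_trans _ _ _ hγ hz⟩
    · exact ⟨o z, hz⟩
  rcases p.exists_immRel_or_unbounded hxy with ⟨w, hw, hxw⟩ | hun
  · rcases lt_or_ge (l w) α with hwα | hwα
    swap
    · exact above w hw.1 hwα
    rcases hxw with rfl | hxw
    · exact p.m7 _ _ hw hy α hwα hαy hl hs h
    · have hs' := p.isLUB_o_of_comp hxw hw.1 hl hs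
      refine p.m7 _ _ hw hy α hwα hαy (p.isSuccLimit_o hxw hl) ((p.isLUB_comp hxw hw.1 hs').1 hs) ?_
      intro ν hν
      -- The hypothesis speaks only of orders in the range of `π_{xw}`; a larger such order is
      -- taken, and M.2 restricts the resulting edge to `ν`.
      obtain ⟨μ, hμ, hνμ⟩ := p.exists_lt_map_of_isLUB hs' hν
      obtain ⟨γ, hγ⟩ := h μ hμ
      obtain ⟨h1, h2⟩ := p.m2 w _ hw.1 _ (p.map_lt_o hxw hμ)
      have hcomm := p.commutativity _ _ _ hxw hw.1 μ hμ.le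
      rw [← hcomm] at hγ
      have h3 := p.rel_of_level_lt h1 hγ hwα
      have h4 := p.map_lt_o h3 hνμ
      obtain ⟨h5, -⟩ := p.m2 _ _ hγ _ h4
      rw [p.commutativity _ _ _ h3 hγ ν hνμ.le, h2 ν hνμ.le] at h5
      exact ⟨_, h5⟩
  · obtain ⟨_, ⟨z, hz, rfl⟩, h1, -⟩ := hun α hαy
    exact above z hz h1.le

/-! ### The axioms at level `κ` -/

/-- The top part of a condition, seen from a node below `lam`. -/
theorem exists_top_of_rel {β : Ordinal.{u}} (hβ : β ∈ p.topSet) :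
    ∃ (f c : Ordinal.{u} → Ordinal.{u}), p.rel (p.lam, c β) (κ.ord, β) ∧
      (∀ γ ∈ p.topSet, p.rel (p.lam, c γ) (κ.ord, γ) ∧ f (c γ) = γ ∧ (γ < β ↔ c γ < c β) ∧
        (∀ δ ≤ c γ, f δ ∈ p.topSet ∧ c (f δ) = δ ∧ p.map (p.lam, c γ) (κ.ord, γ) δ = f δ)) ∧
      (∀ γ δ, γ ∈ p.topSet → δ ∈ p.topSet → (c γ < c δ ↔ γ < δ)) ∧
      ∀ x, l x < p.lam → ∀ γ ∈ p.topSet, p.rel x (κ.ord, γ) → p.rel x (p.lam, c γ) := by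
  obtain ⟨τ, f, c, hS, hτ, hr⟩ := p.exists_isEnum
  have hrel : ∀ γ ∈ p.topSet, p.rel (p.lam, c γ) (κ.ord, γ) := fun γ hγ => by
    have := hr _ (hS.lt γ hγ)
    rwa [hS.f_c γ hγ] at this
  refine ⟨f, c, hrel β hβ, fun γ hγ => ⟨hrel γ hγ, hS.f_c γ hγ, (hS.c_lt_iff hγ hβ).symm,
    fun δ hδ => ?_⟩, fun γ δ hγ hδ => hS.c_lt_iff hγ hδ, fun x hx γ hγ h => ?_⟩
  · have hδ' := hδ.trans_lt (hS.lt γ hγ)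
    have := p.map_top hS hr (hS.lt γ hγ) hδ
    rw [hS.f_c γ hγ] at this
    exact ⟨hS.mem _ hδ', hS.c_f _ hδ', this⟩
  · rcases (p.rel_top_iff hS hr hγ).1 h with rfl | h
    · exact absurd hx (lt_irrefl _)
    · exact h

theorem mem_topSet_of_rel {β : Ordinal.{u}} (h : p.rel x (κ.ord, β)) : β ∈ p.topSet :=
  (p.rel_nodes _ _ h).2

/-- The top nodes are copies of nodes on level `λ`, where M.6 is known. Having `ν` in the top set
makes it a value of the enumeration, so the supremum can be pulled back to level `λ`. -/
theorem m6_top {β ν : Ordinal.{u}} (hxy : p.rel x (κ.ord, β)) (hx : l x < p.lam)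
    (hl : IsSuccLimit (o x)) (hν : IsLUB (p.map x (κ.ord, β) '' Set.Iio (o x)) ν)
    (hνS : ν ∈ p.topSet) :
    p.rel x (κ.ord, ν) ∧ ∀ γ < o x, p.map x (κ.ord, ν) γ = p.map x (κ.ord, β) γ := by
  have hβ := p.mem_topSet_of_rel hxy
  obtain ⟨f, c, h1, h2, h3, h4⟩ := p.exists_top_of_rel hβ
  have hxy' := h4 x hx β hβ hxy
  obtain ⟨hr, hfc, -, hm⟩ := h2 ν hνS
  have hcν : c ν ≤ c β := not_lt.1 fun hc =>
    absurd (p.le_o_of_isLUB hxy hν) (not_le.2 ((h3 β ν hβ hνS).1 hc))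
  have hmap := (h2 β hβ).2.2.2
  have hν' : IsLUB (p.map x (p.lam, c β) '' Set.Iio (o x)) (c ν) :=
    p.isLUB_of_comp hxy' h1 hl hcν (by rwa [(hmap _ hcν).2.2, hfc])
  obtain ⟨h5, h6⟩ := p.m6_of_rel hxy' le_rfl hl hν'
  change p.rel x (p.lam, c ν) at h5
  change ∀ γ < o x, p.map x (p.lam, c ν) γ = p.map x (p.lam, c β) γ at h6
  refine ⟨p.rel_trans _ _ _ h5 hr, fun γ hγ => ?_⟩
  have h7 : p.map x (p.lam, c ν) γ ≤ c ν := p.map_le _ _ h5 γ hγ.le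
  rw [← p.commutativity _ _ _ h5 hr γ hγ.le, ← p.commutativity _ _ _ hxy' h1 γ hγ.le,
    (hm _ h7).2.2, ← h6 γ hγ, (hmap _ (h7.trans hcν)).2.2]

theorem m7_top {α β : Ordinal.{u}} (hxy : p.rel x (κ.ord, β)) (hxα : l x < α) (hα : α < p.lam)
    (hl : IsSuccLimit (o x)) (hs : IsLUB (p.map x (κ.ord, β) '' Set.Iio (o x)) β)
    (h : ∀ ν < o x, ∃ γ, p.rel (α, γ) (κ.ord, p.map x (κ.ord, β) ν)) :
    ∃ γ, p.rel (α, γ) (κ.ord, β) := by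
  have hβ := p.mem_topSet_of_rel hxy
  obtain ⟨f, c, h1, h2, h3, h4⟩ := p.exists_top_of_rel hβ
  have hxy' := h4 x (hxα.trans hα) β hβ hxy
  obtain ⟨-, hfc, -, hm⟩ := h2 β hβ
  obtain ⟨γ, hγ⟩ := p.m7_of_rel hxy' le_rfl hxα hα hl
    (p.isLUB_o_of_comp hxy' h1 hl hs) (by
      intro ν hν
      obtain ⟨γ, hγ⟩ := h ν hν
      have h5 : p.map x (p.lam, c β) ν ≤ c β := p.map_le _ _ hxy' ν hν.le
      rw [← p.commutativity _ _ _ hxy' h1 ν hν.le, (hm _ h5).2.2] at hγ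
      have := h4 (α, γ) hα _ (hm _ h5).1 hγ
      rw [(hm _ h5).2.1] at this
      exact ⟨γ, this⟩)
  exact ⟨γ, p.rel_trans _ _ _ hγ h1⟩

/-! ### Density -/

/-- The closure of `β` under successor and predecessor is its block `ω * (β / ω) + n`; adjoining
this countable block suffices. -/
theorem exists_isTopSet_mem (hκ : ℵ₀ < κ) {T : Set Ordinal.{u}} (hT : IsTopSet T)
    (hf : IsFew κ T) (hb : ∀ β ∈ T, β < (succ κ).ord) {β : Ordinal.{u}} (hβ : β < (succ κ).ord) :
    ∃ S, IsTopSet S ∧ IsFew κ S ∧ (∀ β ∈ S, β < (succ κ).ord) ∧ T ⊆ S ∧ β ∈ S := by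
  have hω : ω < κ.ord := by rwa [← Cardinal.ord_aleph0, Cardinal.ord_lt_ord]
  have hdiv : ∀ γ : Ordinal.{u}, (γ + 1) / ω = γ / ω := by
    intro γ
    have h1 := Ordinal.div_add_mod γ ω
    have h2 : γ % ω < ω := Ordinal.mod_lt _ Ordinal.omega0_ne_zero
    have h3 : γ + 1 = ω * (γ / ω) + (γ % ω + 1) := by rw [← add_assoc, h1]
    rw [h3, Ordinal.mul_add_div _ Ordinal.omega0_ne_zero,
      Ordinal.div_eq_zero_of_lt (Ordinal.isSuccLimit_omega0.add_one_lt h2), add_zero]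
  have heq : ∀ γ ∈ {γ | γ / ω = β / ω}, ∃ ξ < ω, ω * (β / ω) + ξ = γ := fun γ hγ =>
    ⟨γ % ω, Ordinal.mod_lt _ Ordinal.omega0_ne_zero, by
      rw [← show γ / ω = β / ω from hγ, Ordinal.div_add_mod]⟩
  refine ⟨T ∪ {γ | γ / ω = β / ω}, ⟨.inl hT.zero_mem, fun γ => ?_⟩,
    isFew_union hκ.le hf ⟨ω, hω, fun ξ => ω * (β / ω) + ξ, fun γ hγ => ?_⟩, ?_, Set.subset_union_left,
    .inr rfl⟩
  · refine or_congr (hT.succ_mem γ) ?_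
    change γ / ω = β / ω ↔ (γ + 1) / ω = β / ω
    rw [hdiv]
  · obtain ⟨ξ, hξ, h⟩ := heq γ hγ
    exact ⟨ξ, hξ, h⟩
  · rintro γ (h | h)
    · exact hb γ h
    · obtain ⟨ξ, hξ, rfl⟩ := heq γ h
      refine Ordinal.isPrincipal_add_ord (hκ.le.trans (Order.le_succ κ))
        ((Ordinal.mul_div_le β ω).trans_lt hβ) ?_
      exact hξ.trans (hω.trans (Cardinal.ord_lt_ord.2 (Order.lt_succ κ)))

theorem exists_le_mem_topSet (hκ : ℵ₀ < κ) {α β : Ordinal.{u}} (hα : α < κ.ord)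
    (hβ : β < (succ κ).ord) : ∃ q ≤ p, α < q.lam ∧ β ∈ q.topSet := by
  obtain ⟨S, h1, h2, h3, h4, h5⟩ := exists_isTopSet_mem hκ p.isTopSet p.isFew_topSet
    (fun _ h => p.topSet_lt h) hβ
  obtain ⟨q, h6, -, h7, rfl⟩ := exists_le_topSet hκ p h2 h1 h3 h4
    ((Cardinal.isSuccLimit_ord hκ.le).add_one_lt hα)
  exact ⟨q, h6, Order.add_one_le_iff.1 h7, h5⟩

theorem exists_le_m6 (hκ : ℵ₀ < κ) (hxy : p.rel x y) (hl : IsSuccLimit (o x)) {ν : Ordinal.{u}}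
    (hν : IsLUB (p.map x y '' Set.Iio (o x)) ν) :
    ∃ q ≤ p, q.rel x (l y, ν) ∧ ∀ γ < o x, q.map x (l y, ν) γ = q.map x y γ := by
  rcases p.level_cases (p.rel_nodes _ _ hxy).2 with ⟨h, -⟩ | ⟨β, hβ, rfl⟩
  · exact ⟨p, le_rfl, p.m6_of_rel hxy h hl hν⟩
  · obtain ⟨q, h1, h2, h3⟩ := p.exists_le_mem_topSet hκ
      ((p.level_lt_of_rel hxy).1.trans_lt p.lam_lt)
      ((p.le_o_of_isLUB hxy hν).trans_lt (p.topSet_lt hβ))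
    rw [← map_of_le h1 hxy] at hν
    exact ⟨q, h1, q.m6_top (rel_of_le h1 hxy) h2 hl hν h3⟩

/-- Once the top level exceeds `α`, predecessors on level `α` of existing nodes are decided. A
single extension therefore resolves the density hypothesis for all `ν` simultaneously. -/
theorem exists_le_m7 (hκ : ℵ₀ < κ) (hxy : p.rel x y) {α : Ordinal.{u}} (hxα : l x < α)
    (hαy : α < l y) (hl : IsSuccLimit (o x)) (hs : IsLUB (p.map x y '' Set.Iio (o x)) (o y))
    (h : ∀ ν < o x, ∀ q ≤ p, ∃ r ≤ q, ∃ γ, r.rel (α, γ) (l y, p.map x y ν)) :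
    ∃ q ≤ p, ∃ γ, q.rel (α, γ) y := by
  have hακ := hαy.trans_le (p.level_le_kappa (p.rel_nodes _ _ hxy).2)
  obtain ⟨q, h1, -, hα⟩ := p.exists_le_lam_gt hκ
    ((Cardinal.isSuccLimit_ord hκ.le).add_one_lt hακ)
  replace hα := Order.add_one_le_iff.1 hα
  have hxy' := rel_of_le h1 hxy
  rw [← map_of_le h1 hxy] at hs h
  have h' : ∀ ν < o x, ∃ γ, q.rel (α, γ) (l y, q.map x y ν) := by
    intro ν hν
    obtain ⟨r, hr, γ, hγ⟩ := h ν hν q h1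
    exact ⟨γ, rel_of_le' hr hγ (q.rel_nodes _ _ (q.m2 _ _ hxy' ν hν).1).2 hα.le⟩
  refine ⟨q, h1, ?_⟩
  rcases q.level_cases (q.rel_nodes _ _ hxy').2 with ⟨hle, -⟩ | ⟨β, hβ, rfl⟩
  · exact q.m7_of_rel hxy' hle hxα hαy hl hs h'
  · exact q.m7_top hxy' hxα hα hl hs h'

end MorassCondition

/-! ### Evaluating formulas on canonical names -/

namespace PName

open SetFormula

section

variable {P : Type w} [Preorder P]

theorem forces_imp_imp {φ ψ χ : SetFormula (PName.{u, w} P)} {p : P} :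
    Forces (φ →ₛ ψ →ₛ χ) p ↔ Forces (φ ∧ₛ ψ →ₛ χ) p := by
  simp only [forces_imp, forces_and]
  exact ⟨fun h q hq h' => h q hq h'.1 q le_rfl h'.2,
    fun h q hq h1 r hr h2 => h r (hr.trans hq) ⟨h1.mono hr, h2⟩⟩

theorem forces_imp_of_dense {φ ψ : SetFormula (PName.{u, w} P)} {p : P}
    (h : ∀ q ≤ p, Forces φ q → ∃ r ≤ q, Forces ψ r) : Forces (φ →ₛ ψ) p :=
  forces_imp.2 fun _ hq hφ => Forces.dense fun r hr => h r (hr.trans hq) (hφ.mono hr)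

end

variable {P : Type w} [Preorder P] [OrderTop P] {p : P} {x y z : PName.{u, w} P}
  {α β : Ordinal.{u}}

/-! ### Formulas about ordinals of the ground model -/

theorem exists_of_forcesMem_ordinal (h : ForcesMem x (ordinal α) p) :
    ∃ q ≤ p, ∃ β < α, ForcesEq x (ordinal β) q :=
  forcesMem_ordinal.1 h p le_rfl

theorem forcesMem_ordinal_of_eq (h : ForcesEq x (ordinal β) p) (hβ : β < α) :
    ForcesMem x (ordinal α) p :=
  forcesMem_congr_left (forcesEq_symm h) (forcesMem_ordinal_of_lt hβ p)

theorem lt_of_forcesMem (h : ForcesMem x y p) (hx : ForcesEq x (ordinal β) p)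
    (hy : ForcesEq y (ordinal α) p) : β < α :=
  forcesMem_ordinal_iff.1 (forcesMem_congr_left hx (forcesMem_congr_right hy h))

theorem eq_of_forcesEq (h : ForcesEq x y p) (hx : ForcesEq x (ordinal β) p)
    (hy : ForcesEq y (ordinal α) p) : β = α :=
  forcesEq_ordinal_iff.1 (forcesEq_trans (forcesEq_symm hx) (forcesEq_trans h hy))

theorem forces_isZero (hx : ForcesEq x (ordinal α) p) : Forces (isZero x) p ↔ α = 0 := by
  constructor
  · intro h
    by_contra hc
    exact h (ordinal 0) p le_rfl (forcesMem_congr_right (forcesEq_symm hx)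
      (forcesMem_ordinal_of_lt (pos_iff_ne_zero.2 hc) p))
  · rintro rfl y q hq hy
    obtain ⟨r, -, β, hβ, -⟩ :=
      exists_of_forcesMem_ordinal (forcesMem_congr_right (forcesEq_mono hx hq) hy)
    exact absurd hβ not_lt_zero

theorem forces_isTrans (hx : ForcesEq x (ordinal α) p) : Forces (isTrans x) p := by
  refine fun y => forces_imp.2 fun q hq hy z => forces_imp_of_dense fun r hr hz => ?_
  have hx := forcesEq_mono hx hq
  obtain ⟨s, hs, β, hβ, e⟩ := exists_of_forcesMem_ordinal
    (forcesMem_congr_right (forcesEq_mono hx hr) (hy.mono hr))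
  obtain ⟨t, ht, γ, hγ, e'⟩ := exists_of_forcesMem_ordinal
    (forcesMem_congr_right e (hz.mono hs))
  exact ⟨t, ht.trans hs, forcesMem_congr_right (forcesEq_symm (forcesEq_mono hx
    ((ht.trans hs).trans hr))) (forcesMem_ordinal_of_eq e' (hγ.trans hβ))⟩

theorem forces_isOrd (hx : ForcesEq x (ordinal α) p) : Forces (isOrd x) p := by
  refine ⟨forces_isTrans hx, fun y => forces_imp_of_dense fun q hq hy => ?_⟩
  obtain ⟨r, hr, β, -, e⟩ := exists_of_forcesMem_ordinal
    (forcesMem_congr_right (forcesEq_mono hx hq) hy)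
  exact ⟨r, hr, forces_isTrans e⟩

theorem forces_isLimit (hx : ForcesEq x (ordinal α) p) :
    Forces (isLimit x) p ↔ IsSuccLimit α := by
  constructor
  · rintro ⟨-, h1, h2⟩
    obtain ⟨q, hq, y, hy⟩ := forces_ex.1 h1 p le_rfl
    obtain ⟨-, -, γ, hγ, -⟩ :=
      exists_of_forcesMem_ordinal (forcesMem_congr_right (forcesEq_mono hx hq) hy)
    rcases Ordinal.exists_add_one_or_isSuccLimit α with rfl | ⟨β, rfl⟩ | h
    · exact absurd hγ not_lt_zero
    · obtain ⟨r, hr, z, hz, h3⟩ := forces_ex.1 (forces_imp.1 (h2 (ordinal β)) p le_rfl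
        (forcesMem_congr_right (forcesEq_symm hx) (forcesMem_ordinal_of_lt (lt_add_one β) p)))
        p le_rfl
      obtain ⟨s, hs, δ, hδ, e⟩ :=
        exists_of_forcesMem_ordinal (forcesMem_congr_right (forcesEq_mono hx hr) hz)
      have := forcesMem_ordinal_iff.1 (forcesMem_congr_right e (h3.mono hs))
      exact absurd this (Order.lt_add_one_iff.1 hδ).not_gt
    · exact h
  · intro h
    refine ⟨forces_isOrd hx, Forces.ex (ordinal 0) (forcesMem_congr_right (forcesEq_symm hx)
      (forcesMem_ordinal_of_lt h.pos p)), fun y => forces_imp_of_dense fun q hq hy => ?_⟩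
    have hx := forcesEq_mono hx hq
    obtain ⟨r, hr, β, hβ, e⟩ := exists_of_forcesMem_ordinal (forcesMem_congr_right hx hy)
    exact ⟨r, hr, Forces.ex (ordinal (β + 1)) ⟨forcesMem_congr_right
      (forcesEq_symm (forcesEq_mono hx hr)) (forcesMem_ordinal_of_lt (h.add_one_lt hβ) r),
      forcesMem_ordinal_of_eq e (lt_add_one β)⟩⟩

theorem forces_isSucc (hx : ForcesEq x (ordinal α) p) :
    Forces (isSucc y x) p ↔ ForcesEq y (ordinal (α + 1)) p := by
  have key : ∀ z, ∀ q ≤ p, Forces (z ∈ₛ x ∨ₛ z =ₛ x) q ↔ ForcesMem z (ordinal (α + 1)) q := by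
    intro z q hq
    have hx := forcesEq_mono hx hq
    rw [forces_or]
    constructor
    · refine fun h => forcesMem_dense fun r hr => ?_
      obtain ⟨s, hs, h | h⟩ := h r hr
      · obtain ⟨t, ht, β, hβ, e⟩ := exists_of_forcesMem_ordinal
          (forcesMem_congr_right (forcesEq_mono hx (hs.trans hr)) h)
        exact ⟨t, ht.trans hs, forcesMem_ordinal_of_eq e (hβ.trans (lt_add_one α))⟩
      · exact ⟨s, hs, forcesMem_ordinal_of_eq
          (forcesEq_trans h (forcesEq_mono hx (hs.trans hr))) (lt_add_one α)⟩
    · intro h r hr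
      obtain ⟨s, hs, β, hβ, e⟩ := forcesMem_ordinal.1 h r hr
      have hx := forcesEq_symm (forcesEq_mono hx (hs.trans hr))
      rcases (Order.lt_add_one_iff.1 hβ).lt_or_eq with hlt | rfl
      · exact ⟨s, hs, .inl (forcesMem_congr_right hx (forcesMem_ordinal_of_eq e hlt))⟩
      · exact ⟨s, hs, .inr (forcesEq_trans e hx)⟩
  constructor
  · intro h
    refine forcesEq_of_mem fun z q hq => ?_
    exact (forces_iff.1 (h z) q hq).trans (key z q hq)
  · intro h z
    refine forces_iff.2 fun q hq => ?_
    rw [key z q hq]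
    exact ⟨forcesMem_congr_right (forcesEq_mono h hq),
      forcesMem_congr_right (forcesEq_symm (forcesEq_mono h hq))⟩

/-! ### Functions of the ground model -/

/-- The canonical name of a function on a set of ordinals, with ordinal values. -/
noncomputable def ordinalFun (D : Set Ordinal.{u}) [Small.{u} D] (F : Ordinal.{u} → Ordinal.{u}) :
    PName.{u, w} P :=
  ofFamily (I := D) (fun γ => pair (ordinal γ.1) (ordinal (F γ.1))) (fun _ => ⊤)

variable {D : Set Ordinal.{u}} [Small.{u} D] {F : Ordinal.{u} → Ordinal.{u}}
  {f g d : PName.{u, w} P}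

theorem forcesMem_ordinalFun : ForcesMem z (ordinalFun D F) p ↔
    ∀ q ≤ p, ∃ r ≤ q, ∃ γ ∈ D, ForcesEq z (pair (ordinal γ) (ordinal (F γ))) r := by
  rw [ordinalFun, forcesMem_ofFamily]
  refine forall₂_congr fun q hq => exists_congr fun r => and_congr Iff.rfl ?_
  constructor
  · rintro ⟨⟨β, hβ⟩, -, h⟩
    exact ⟨β, hβ, h⟩
  · rintro ⟨β, hβ, h⟩
    exact ⟨⟨β, hβ⟩, le_top, h⟩

theorem exists_of_pairMem_ordinalFun (hf : ForcesEq f (ordinalFun D F) p)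
    (h : Forces (pairMem g d f) p) :
    ∃ q ≤ p, ∃ γ ∈ D, ForcesEq g (ordinal γ) q ∧ ForcesEq d (ordinal (F γ)) q := by
  obtain ⟨q, hq, γ, hγ, e⟩ := forcesMem_ordinalFun.1
    (forcesMem_congr_right hf (forces_pairMem.1 h)) p le_rfl
  exact ⟨q, hq, γ, hγ, forcesEq_pair.1 e⟩

theorem pairMem_ordinalFun (hf : ForcesEq f (ordinalFun D F) p) {γ : Ordinal.{u}} (hγ : γ ∈ D)
    (hg : ForcesEq g (ordinal γ) p) (hd : ForcesEq d (ordinal (F γ)) p) :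
    Forces (pairMem g d f) p :=
  forces_pairMem.2 <| forcesMem_congr_right (forcesEq_symm hf) <| forcesMem_ordinalFun.2 fun q hq =>
    ⟨q, le_rfl, γ, hγ, forcesEq_pair.2 ⟨forcesEq_mono hg hq, forcesEq_mono hd hq⟩⟩

theorem forces_isFun_ordinalFun {a b : PName.{u, w} P} (hf : ForcesEq f (ordinalFun D F) p)
    (ha : ForcesEq a (ordinal α) p) (hb : ForcesEq b (ordinal β) p) (hD : ∀ γ, γ ∈ D ↔ γ < α)
    (hF : ∀ γ < α, F γ < β) : Forces (isFun f a b) p := by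
  refine ⟨fun z => forces_imp_of_dense fun q hq hz => ?_, fun x => forces_imp_of_dense
    fun q hq hx => ?_, fun x y y' => forces_imp_imp.2 (forces_imp_of_dense fun q hq h => ?_)⟩
  · obtain ⟨r, hr, γ, hγ, e⟩ := forcesMem_ordinalFun.1
      (forcesMem_congr_right (forcesEq_mono hf hq) hz) q le_rfl
    have hγ' := (hD γ).1 hγ
    refine ⟨r, hr, Forces.ex (ordinal γ) <| Forces.ex (ordinal (F γ)) ⟨?_, ?_,
      forces_isPair.2 e⟩⟩
    · exact forcesMem_congr_right (forcesEq_symm (forcesEq_mono ha (hr.trans hq)))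
        (forcesMem_ordinal_of_lt hγ' r)
    · exact forcesMem_congr_right (forcesEq_symm (forcesEq_mono hb (hr.trans hq)))
        (forcesMem_ordinal_of_lt (hF γ hγ') r)
  · obtain ⟨r, hr, γ, hγ, e⟩ := exists_of_forcesMem_ordinal
      (forcesMem_congr_right (forcesEq_mono ha hq) hx)
    exact ⟨r, hr, Forces.ex (ordinal (F γ)) (pairMem_ordinalFun (forcesEq_mono hf (hr.trans hq))
      ((hD γ).2 hγ) e (forcesEq_refl _ _))⟩
  · obtain ⟨r, hr, γ, -, e1, e2⟩ := exists_of_pairMem_ordinalFun (forcesEq_mono hf hq) h.1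
    obtain ⟨s, hs, γ', -, e1', e2'⟩ := exists_of_pairMem_ordinalFun
      (forcesEq_mono hf (hr.trans hq)) (h.2.mono hr)
    have := eq_of_forcesEq (forcesEq_refl x s) (forcesEq_mono e1 hs) e1'
    subst this
    exact ⟨s, hs.trans hr, forcesEq_trans (forcesEq_mono e2 hs) (forcesEq_symm e2')⟩

theorem forces_isSLOOP_ordinalFun {b : PName.{u, w} P} (hf : ForcesEq f (ordinalFun D F) p)
    (hb : ForcesEq b (ordinal β) p) (hD : ∀ γ, γ ∈ D ↔ γ < β + 1) (hF : IsSLOOP F (β + 1)) :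
    Forces (SetFormula.isSLOOP f b) p := by
  refine ⟨fun g g' d => forces_imp_imp.2 (forces_imp_imp.2 (forces_imp_of_dense fun q hq h => ?_)),
    fun g d => forces_imp_imp.2 (forces_imp_of_dense fun q hq h => ?_),
    fun g d => forces_imp_imp.2 (forces_imp_of_dense fun q hq h => ?_),
    fun g g' d d' => forces_imp_imp.2 (forces_imp_imp.2 (forces_imp_of_dense fun q hq h => ?_))⟩
  · obtain ⟨⟨h1, h2⟩, h3⟩ := h
    obtain ⟨r, hr, γ, hγ, e1, e2⟩ := exists_of_pairMem_ordinalFun (forcesEq_mono hf hq) h3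
    have hγβ := lt_of_forcesMem (h1.mono hr) e1 (forcesEq_mono hb (hr.trans hq))
    have h2 := (forces_isSucc e1).1 (h2.mono hr)
    have hlt : γ + 1 < β + 1 := Order.lt_add_one_iff.2 (Order.add_one_le_of_lt hγβ)
    refine ⟨r, hr, Forces.ex (ordinal (F γ + 1)) ⟨(forces_isSucc e2).2 (forcesEq_refl _ _),
      pairMem_ordinalFun (forcesEq_mono hf (hr.trans hq)) ((hD _).2 hlt) h2 ?_⟩⟩
    rw [hF.1 γ hlt]
    exact forcesEq_refl _ _
  · obtain ⟨r, hr, γ, hγ, e1, e2⟩ := exists_of_pairMem_ordinalFun (forcesEq_mono hf hq) h.2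
    exact ⟨r, hr, (forces_isLimit e2).2
      (hF.2.1 γ ((hD γ).1 hγ) ((forces_isLimit e1).1 (h.1.mono hr)))⟩
  · obtain ⟨r, hr, γ, hγ, e1, e2⟩ := exists_of_pairMem_ordinalFun (forcesEq_mono hf hq) h.2
    have h0 := (forces_isZero e1).1 (h.1.mono hr)
    subst h0
    exact ⟨r, hr, (forces_isZero e2).2 (hF.2.2.1 ((hD 0).1 hγ))⟩
  · obtain ⟨⟨h1, h2⟩, h3⟩ := h
    obtain ⟨r, hr, γ, hγ, e1, e2⟩ := exists_of_pairMem_ordinalFun (forcesEq_mono hf hq) h2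
    obtain ⟨s, hs, γ', hγ', e1', e2'⟩ := exists_of_pairMem_ordinalFun
      (forcesEq_mono hf (hr.trans hq)) (h3.mono hr)
    have hlt := lt_of_forcesMem (h1.mono (hs.trans hr)) (forcesEq_mono e1 hs) e1'
    exact ⟨s, hs.trans hr, forcesMem_congr_right (forcesEq_symm e2')
      (forcesMem_ordinal_of_eq (forcesEq_mono e2 hs) (hF.2.2.2 γ γ' hlt ((hD γ').1 hγ')))⟩

theorem forcesEq_of_isSupImage {n b : PName.{u, w} P} (hf : ForcesEq f (ordinalFun D F) p)
    (hb : ForcesEq b (ordinal β) p) (hD : ∀ γ < β, γ ∈ D) {σ : Ordinal.{u}}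
    (hσ : IsLUB (F '' Set.Iio β) σ) (h : Forces (isSupImage n f b) p) :
    ForcesEq n (ordinal σ) p := by
  refine forcesEq_of_mem fun v q hq => (forces_iff.1 (h v) q hq).trans ?_
  constructor
  · refine fun hv => forcesMem_dense fun q' hq' => ?_
    obtain ⟨r, hr, g, hg⟩ := forces_ex.1 hv q' hq'
    obtain ⟨s, hs, d, h1, h2, h3⟩ := forces_ex.1 hg r le_rfl
    have hsp := (hs.trans hr).trans (hq'.trans hq)
    obtain ⟨t, ht, γ, hγ, e1, e2⟩ := exists_of_pairMem_ordinalFun (forcesEq_mono hf hsp) h2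
    have hγβ := lt_of_forcesMem (h1.mono ht) e1 (forcesEq_mono hb (ht.trans hsp))
    obtain ⟨t', ht', δ, hδ, e⟩ := exists_of_forcesMem_ordinal (forcesMem_congr_right e2 (h3.mono ht))
    exact ⟨t', ht'.trans (ht.trans (hs.trans hr)),
      forcesMem_ordinal_of_eq e (hδ.trans_le (hσ.1 ⟨γ, hγβ, rfl⟩))⟩
  · refine fun hv => Forces.dense fun q' hq' => ?_
    obtain ⟨r, hr, δ, hδ, e⟩ := forcesMem_ordinal.1 hv q' hq'
    obtain ⟨_, ⟨γ, hγ, rfl⟩, hlt⟩ := (lt_isLUB_iff hσ).1 hδ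
    have hrp := hr.trans (hq'.trans hq)
    exact ⟨r, hr, Forces.ex (ordinal γ) <| Forces.ex (ordinal (F γ)) ⟨forcesMem_congr_right
      (forcesEq_symm (forcesEq_mono hb hrp)) (forcesMem_ordinal_of_lt hγ r),
      pairMem_ordinalFun (forcesEq_mono hf hrp) (hD γ hγ) (forcesEq_refl _ _) (forcesEq_refl _ _),
      forcesMem_ordinal_of_eq e hlt⟩⟩

end PName

/-! ### The names of the generic limit, evaluated below a condition -/

namespace MangroveForcing

open PName SetFormula

variable {κ : Cardinal.{u}}

/-- The names for the mangrove forcing. -/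
abbrev Name (κ : Cardinal.{u}) := PName.{u, u + 1} (MangroveForcing κ)

variable {s : MorassCondition κ} {p : MangroveForcing κ} {φ ψ : SetFormula (Name κ)}
  {X Y : MorassNode.{u}} {x y z a b c d f : Name κ}

theorem exists_coe_of_le {q : MangroveForcing κ} (h : q ≤ s) : ∃ t : MorassCondition κ,
    t ≤ s ∧ q = t := by
  cases q with
  | none => exact absurd h (WithTop.not_top_le_coe s)
  | some t => exact ⟨t, WithTop.coe_le_coe.1 h, rfl⟩

theorem exists_real [Nonempty (MorassCondition κ)] (q : MangroveForcing κ) :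
    ∃ t : MorassCondition κ, (t : MangroveForcing κ) ≤ q := by
  cases q with
  | none => exact ⟨Classical.arbitrary _, le_top⟩
  | some t => exact ⟨t, le_rfl⟩

theorem coe_le {s t : MorassCondition κ} (h : t ≤ s) :
    (t : MangroveForcing κ) ≤ (s : MangroveForcing κ) := WithTop.coe_le_coe.2 h

theorem forces_coe_of_dense (h : ∀ t ≤ s, ∃ r ≤ t, Forces φ (r : MangroveForcing κ)) :
    Forces φ (s : MangroveForcing κ) := by
  refine Forces.dense fun q hq => ?_
  obtain ⟨t, ht, rfl⟩ := exists_coe_of_le hq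
  obtain ⟨r, hr, h⟩ := h t ht
  exact ⟨r, coe_le hr, h⟩

section

variable [Nonempty (MorassCondition κ)]

/-- Every element of the forcing, the largest one included, has a morass condition below it, so only
these need to be examined. -/
theorem forces_of_coe (h : ∀ s : MorassCondition κ, (s : MangroveForcing κ) ≤ p →
    ∃ t ≤ s, Forces φ (t : MangroveForcing κ)) : Forces φ p := by
  refine Forces.dense fun q hq => ?_
  obtain ⟨s, hs⟩ := exists_real q
  obtain ⟨t, ht, h⟩ := h s (hs.trans hq)
  exact ⟨t, (coe_le ht).trans hs, h⟩

theorem forces_imp_of_coe (h : ∀ s : MorassCondition κ, (s : MangroveForcing κ) ≤ p →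
    Forces φ (s : MangroveForcing κ) → ∃ t ≤ s, Forces ψ (t : MangroveForcing κ)) :
    Forces (φ →ₛ ψ) p := by
  refine forces_imp.2 fun q hq hφ => forces_of_coe fun s hs => ?_
  exact h s (hs.trans hq) (hφ.mono hs)

theorem forces_iff_of_coe (h : ∀ s : MorassCondition κ, (s : MangroveForcing κ) ≤ p →
    Forces φ (s : MangroveForcing κ) → ∃ t ≤ s, Forces ψ (t : MangroveForcing κ))
    (h' : ∀ s : MorassCondition κ, (s : MangroveForcing κ) ≤ p →
    Forces ψ (s : MangroveForcing κ) → ∃ t ≤ s, Forces φ (t : MangroveForcing κ)) :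
    Forces (φ ↔ₛ ψ) p :=
  ⟨forces_imp_of_coe h, forces_imp_of_coe h'⟩

end

theorem exists_of_forces_ex {φ : Name κ → SetFormula (Name κ)}
    (h : Forces (.ex φ) (s : MangroveForcing κ)) :
    ∃ t ≤ s, ∃ x, Forces (φ x) (t : MangroveForcing κ) := by
  obtain ⟨q, hq, x, hx⟩ := forces_ex.1 h _ le_rfl
  obtain ⟨t, ht, rfl⟩ := exists_coe_of_le hq
  exact ⟨t, ht, x, hx⟩

theorem exists_of_forces_or (h : Forces (φ ∨ₛ ψ) (s : MangroveForcing κ)) :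
    ∃ t ≤ s, Forces φ (t : MangroveForcing κ) ∨ Forces ψ (t : MangroveForcing κ) := by
  obtain ⟨q, hq, hx⟩ := forces_or.1 h _ le_rfl
  obtain ⟨t, ht, rfl⟩ := exists_coe_of_le hq
  exact ⟨t, ht, hx⟩

theorem exists_eq_of_mem_ordinal {α : Ordinal.{u}}
    (h : ForcesMem x (ordinal α) (s : MangroveForcing κ)) :
    ∃ t ≤ s, ∃ β < α, ForcesEq x (ordinal β) (t : MangroveForcing κ) := by
  obtain ⟨q, hq, β, hβ, e⟩ := exists_of_forcesMem_ordinal h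
  obtain ⟨t, ht, rfl⟩ := exists_coe_of_le hq
  exact ⟨t, ht, β, hβ, e⟩

theorem exists_eq_of_pairMem_ordinalFun {D : Set Ordinal.{u}} [Small.{u} D]
    {F : Ordinal.{u} → Ordinal.{u}} (hf : ForcesEq f (ordinalFun D F) (s : MangroveForcing κ))
    (h : Forces (pairMem x y f) (s : MangroveForcing κ)) :
    ∃ t ≤ s, ∃ γ ∈ D, ForcesEq x (ordinal γ) (t : MangroveForcing κ) ∧
      ForcesEq y (ordinal (F γ)) (t : MangroveForcing κ) := by
  obtain ⟨q, hq, γ, hγ, e⟩ := exists_of_pairMem_ordinalFun hf h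
  obtain ⟨t, ht, rfl⟩ := exists_coe_of_le hq
  exact ⟨t, ht, γ, hγ, e⟩

theorem forcesEq_coe_mono {t : MorassCondition κ} (h : ForcesEq x y (s : MangroveForcing κ))
    (ht : t ≤ s) : ForcesEq x y (t : MangroveForcing κ) := forcesEq_mono h (coe_le ht)

/-! ### Nodes and edges -/

theorem forcesEq_nodeName :
    ForcesEq x (nodeName X) p → ForcesEq x (nodeName Y) p → X = Y := by
  intro h h'
  obtain ⟨h1, h2⟩ := forcesEq_pair.1 (forcesEq_trans (forcesEq_symm h) h')
  exact Prod.ext (forcesEq_ordinal_iff.1 h1) (forcesEq_ordinal_iff.1 h2)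

theorem mem_Iic_iff {α γ : Ordinal.{u}} : γ ∈ Set.Iic α ↔ γ < α + 1 := by
  rw [Set.mem_Iic, Order.lt_add_one_iff]

theorem mapName_eq (X Y : MorassNode.{u}) :
    mapName s X Y = ordinalFun (Set.Iic (o X)) (s.map X Y) := rfl

theorem mem_limitNodes (hX : X ∈ s.nodes) (hx : ForcesEq x (nodeName X) (s : MangroveForcing κ)) :
    ForcesMem x (limitNodes κ) (s : MangroveForcing κ) :=
  forcesMem_ofFamily.2 fun q hq => ⟨q, le_rfl, ⟨s, X, hX⟩, hq, forcesEq_mono hx hq⟩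

theorem exists_of_mem_limitNodes (h : ForcesMem x (limitNodes κ) (s : MangroveForcing κ)) :
    ∃ t ≤ s, ∃ X ∈ t.nodes, ForcesEq x (nodeName X) (t : MangroveForcing κ) := by
  obtain ⟨q, hq, ⟨r, X, hX⟩, h1, e⟩ := forcesMem_ofFamily.1 h _ le_rfl
  obtain ⟨t, ht, rfl⟩ := exists_coe_of_le hq
  exact ⟨t, ht, X, (WithTop.coe_le_coe.1 h1).1 hX, e⟩

theorem mem_limitRel (h : s.rel X Y)
    (hz : ForcesEq z (pair (nodeName X) (nodeName Y)) (s : MangroveForcing κ)) :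
    ForcesMem z (limitRel κ) (s : MangroveForcing κ) :=
  forcesMem_ofFamily.2 fun q hq => ⟨q, le_rfl, ⟨s, (X, Y), h⟩, hq, forcesEq_mono hz hq⟩

theorem exists_of_mem_limitRel (h : ForcesMem z (limitRel κ) (s : MangroveForcing κ)) :
    ∃ t ≤ s, ∃ X Y, t.rel X Y ∧
      ForcesEq z (pair (nodeName X) (nodeName Y)) (t : MangroveForcing κ) := by
  obtain ⟨q, hq, ⟨r, ⟨X, Y⟩, hX⟩, h1, e⟩ := forcesMem_ofFamily.1 h _ le_rfl
  obtain ⟨t, ht, rfl⟩ := exists_coe_of_le hq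
  exact ⟨t, ht, X, Y, MorassCondition.rel_of_le (WithTop.coe_le_coe.1 h1) hX, e⟩

theorem pairMem_limitRel (h : s.rel X Y) (hx : ForcesEq x (nodeName X) (s : MangroveForcing κ))
    (hy : ForcesEq y (nodeName Y) (s : MangroveForcing κ)) :
    Forces (pairMem x y (limitRel κ)) (s : MangroveForcing κ) :=
  forces_pairMem.2 (mem_limitRel h (forcesEq_pair.2 ⟨hx, hy⟩))

theorem exists_of_pairMem_limitRel
    (h : Forces (pairMem x y (limitRel κ)) (s : MangroveForcing κ)) :
    ∃ t ≤ s, ∃ X Y, t.rel X Y ∧ ForcesEq x (nodeName X) (t : MangroveForcing κ) ∧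
      ForcesEq y (nodeName Y) (t : MangroveForcing κ) := by
  obtain ⟨t, ht, X, Y, h1, e⟩ := exists_of_mem_limitRel (forces_pairMem.1 h)
  exact ⟨t, ht, X, Y, h1, forcesEq_pair.1 e⟩

theorem exists_of_mem_limitMaps (h : ForcesMem z (limitMaps κ) (s : MangroveForcing κ)) :
    ∃ t ≤ s, ∃ X Y, t.rel X Y ∧
      ForcesEq z (pair (pair (nodeName X) (nodeName Y)) (mapName t X Y))
        (t : MangroveForcing κ) := by
  obtain ⟨q, hq, ⟨r, ⟨X, Y⟩, hX⟩, h1, e⟩ := forcesMem_ofFamily.1 h _ le_rfl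
  obtain ⟨t, ht, rfl⟩ := exists_coe_of_le hq
  have h1 := WithTop.coe_le_coe.1 h1
  refine ⟨t, ht, X, Y, MorassCondition.rel_of_le h1 hX, ?_⟩
  rw [mapName_eq, MorassCondition.map_of_le h1 hX]
  exact e

theorem mem_limitMaps (h : s.rel X Y) (hz : ForcesEq z (pair (pair (nodeName X) (nodeName Y))
    (mapName s X Y)) (s : MangroveForcing κ)) :
    ForcesMem z (limitMaps κ) (s : MangroveForcing κ) :=
  forcesMem_ofFamily.2 fun q hq => ⟨q, le_rfl, ⟨s, (X, Y), h⟩, hq, forcesEq_mono hz hq⟩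

/-- The map of an edge never changes in an extension, so the condition containing the edge decides
the generic map on it. -/
theorem eq_mapName_of_mem (h : s.rel X Y)
    (hz : ForcesEq z (pair (nodeName X) (nodeName Y)) (s : MangroveForcing κ))
    (hf : ForcesMem (pair z f) (limitMaps κ) (s : MangroveForcing κ)) :
    ForcesEq f (mapName s X Y) (s : MangroveForcing κ) := by
  refine forcesEq_dense fun q hq => ?_
  obtain ⟨t, ht, rfl⟩ := exists_coe_of_le hq
  obtain ⟨r, hr, X', Y', h1, e⟩ := exists_of_mem_limitMaps (forcesMem_mono hf hq)
  obtain ⟨e1, e2⟩ := forcesEq_pair.1 e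
  obtain ⟨e3, e4⟩ := forcesEq_pair.1
    (forcesEq_trans (forcesEq_symm (forcesEq_coe_mono hz (hr.trans ht))) e1)
  obtain rfl := forcesEq_nodeName (forcesEq_refl _ _) e3
  obtain rfl := forcesEq_nodeName (forcesEq_refl _ _) e4
  refine ⟨r, coe_le hr, ?_⟩
  rw [mapName_eq, ← MorassCondition.map_of_le (hr.trans ht) h]
  exact e2

theorem eq_mapName_of_isMap (h : s.rel X Y)
    (hx : ForcesEq x (nodeName X) (s : MangroveForcing κ))
    (hy : ForcesEq y (nodeName Y) (s : MangroveForcing κ))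
    (hf : Forces (isMap (limitMaps κ) x y f) (s : MangroveForcing κ)) :
    ForcesEq f (mapName s X Y) (s : MangroveForcing κ) :=
  eq_mapName_of_mem h (forcesEq_pair.2 ⟨hx, hy⟩) (forces_isMap.1 hf)

theorem mapName_mono {t : MorassCondition κ} (ht : t ≤ s) (h : s.rel X Y) :
    mapName t X Y = mapName s X Y := by
  rw [mapName_eq, mapName_eq, MorassCondition.map_of_le ht h]

theorem eq_mapName_mono {t : MorassCondition κ} (ht : t ≤ s) (h : s.rel X Y)
    (hf : ForcesEq f (mapName s X Y) (s : MangroveForcing κ)) :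
    ForcesEq f (mapName t X Y) (t : MangroveForcing κ) := by
  rw [mapName_mono ht h]
  exact forcesEq_coe_mono hf ht

/-- The names `x, y, a, b, c, d` are evaluated as the edge `X ≺ Y` and its coordinates. -/
structure IsEdge (s : MorassCondition κ) (X Y : MorassNode.{u}) (x y a b c d : Name κ) : Prop where
  rel : s.rel X Y
  x : ForcesEq x (nodeName X) (s : MangroveForcing κ)
  y : ForcesEq y (nodeName Y) (s : MangroveForcing κ)
  a : ForcesEq a (ordinal (l X)) (s : MangroveForcing κ)
  b : ForcesEq b (ordinal (o X)) (s : MangroveForcing κ)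
  c : ForcesEq c (ordinal (l Y)) (s : MangroveForcing κ)
  d : ForcesEq d (ordinal (o Y)) (s : MangroveForcing κ)

theorem IsEdge.mono {t : MorassCondition κ} (h : IsEdge s X Y x y a b c d) (ht : t ≤ s) :
    IsEdge t X Y x y a b c d :=
  ⟨MorassCondition.rel_of_le ht h.rel, forcesEq_coe_mono h.x ht, forcesEq_coe_mono h.y ht,
    forcesEq_coe_mono h.a ht, forcesEq_coe_mono h.b ht, forcesEq_coe_mono h.c ht,
    forcesEq_coe_mono h.d ht⟩

variable [Nonempty (MorassCondition κ)]

/-- The common opening of the axioms: extend until the names in the hypotheses denote a ground-model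
edge and its coordinates. -/
theorem forces_edge (h : ∀ (s : MorassCondition κ) X Y, (s : MangroveForcing κ) ≤ p →
    IsEdge s X Y x y a b c d → ∃ t ≤ s, Forces φ (t : MangroveForcing κ)) :
    Forces (isPair x a b →ₛ isPair y c d →ₛ pairMem x y (limitRel κ) →ₛ φ) p := by
  rw [forces_imp_imp, forces_imp_imp]
  refine forces_imp_of_coe fun s hs ⟨⟨h1, h2⟩, h3⟩ => ?_
  obtain ⟨t, ht, X, Y, hr, ex, ey⟩ := exists_of_pairMem_limitRel h3
  obtain ⟨e1, e2⟩ := forcesEq_pair.1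
    (forcesEq_trans (forcesEq_symm (forcesEq_coe_mono (forces_isPair.1 h1) ht)) ex)
  obtain ⟨e3, e4⟩ := forcesEq_pair.1
    (forcesEq_trans (forcesEq_symm (forcesEq_coe_mono (forces_isPair.1 h2) ht)) ey)
  obtain ⟨r, hr', h⟩ := h t X Y ((coe_le ht).trans hs) ⟨hr, ex, ey, e1, e2, e3, e4⟩
  exact ⟨r, hr'.trans ht, h⟩

theorem forces_edge_map (h : ∀ (s : MorassCondition κ) X Y, (s : MangroveForcing κ) ≤ p →
    IsEdge s X Y x y a b c d → ForcesEq f (mapName s X Y) (s : MangroveForcing κ) →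
      ∃ t ≤ s, Forces φ (t : MangroveForcing κ)) :
    Forces (isPair x a b →ₛ isPair y c d →ₛ pairMem x y (limitRel κ) →ₛ
      isMap (limitMaps κ) x y f →ₛ φ) p := by
  refine forces_edge fun s X Y hs he => ⟨s, le_rfl, forces_imp_of_coe fun t ht hf => ?_⟩
  have ht' := WithTop.coe_le_coe.1 ht
  have he' := he.mono ht'
  exact h t X Y (ht.trans hs) he' (eq_mapName_of_isMap he'.rel he'.x he'.y hf)

theorem forces_node (h : ∀ (s : MorassCondition κ) Y, (s : MangroveForcing κ) ≤ p →
    Y ∈ s.nodes → ForcesEq y (nodeName Y) (s : MangroveForcing κ) →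
    ForcesEq c (ordinal (l Y)) (s : MangroveForcing κ) →
    ForcesEq d (ordinal (o Y)) (s : MangroveForcing κ) →
      ∃ t ≤ s, Forces φ (t : MangroveForcing κ)) :
    Forces (y ∈ₛ limitNodes κ →ₛ isPair y c d →ₛ φ) p := by
  rw [forces_imp_imp]
  refine forces_imp_of_coe fun s hs ⟨h1, h2⟩ => ?_
  obtain ⟨t, ht, Y, hY, ey⟩ := exists_of_mem_limitNodes h1
  obtain ⟨e3, e4⟩ := forcesEq_pair.1
    (forcesEq_trans (forcesEq_symm (forcesEq_coe_mono (forces_isPair.1 h2) ht)) ey)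
  obtain ⟨r, hr', h⟩ := h t Y ((coe_le ht).trans hs) hY ey e3 e4
  exact ⟨r, hr'.trans ht, h⟩

/-! ### The axioms -/

theorem forces_nodesBounded :
    Forces (nodesBounded (ordinal κ.ord) (ordinal (succ κ).ord) (limitNodes κ)) p := by
  refine fun x => forces_imp_of_coe fun s _ hx => ?_
  obtain ⟨t, ht, X, hX, e⟩ := exists_of_mem_limitNodes hx
  refine ⟨t, ht, Forces.ex (ordinal (l X)) <| Forces.ex (ordinal (o X)) ⟨forces_isPair.2 e, ?_⟩⟩
  rcases t.nodes_bounded X hX with ⟨h1, h2⟩ | ⟨h1, h2⟩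
  · exact Forces.inl ⟨forcesMem_ordinal_of_lt (h1.trans_lt t.lam_lt) _,
      forcesMem_ordinal_of_lt h2 _⟩
  · refine Forces.inr ⟨?_, forcesMem_ordinal_of_lt h2 _⟩
    rw [h1]
    exact forcesEq_refl _ _

omit [Nonempty (MorassCondition κ)] in
-- The orders below `θ` need only appear densely. This covers both the frozen levels and level `κ`,
-- where every order below `κ⁺` is added eventually.
theorem forces_isTheta_of {α θ : Ordinal.{u}}
    (h : ∀ t ≤ s, ∀ β < θ, ∃ r ≤ t, (α, β) ∈ r.nodes)
    (h' : ∀ t ≤ s, ∀ β, (α, β) ∈ t.nodes → β < θ) (ha : ForcesEq a (ordinal α) (s : MangroveForcing κ)) :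
    Forces (isTheta (limitNodes κ) a x) (s : MangroveForcing κ) ↔
      ForcesEq x (ordinal θ) (s : MangroveForcing κ) := by
  have key : ∀ t ≤ s, ∀ b, Forces (pairMem a b (limitNodes κ)) (t : MangroveForcing κ) ↔
      ForcesMem b (ordinal θ) (t : MangroveForcing κ) := by
    intro t ht b
    constructor
    · refine fun hb => forces_coe_of_dense (φ := b ∈ₛ ordinal θ) fun t' ht' => ?_
      obtain ⟨r, hr, ⟨α', β⟩, hX, e⟩ :=
        exists_of_mem_limitNodes (forces_pairMem.1 (hb.mono (coe_le ht')))
      obtain ⟨e1, e2⟩ := forcesEq_pair.1 e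
      have hrs := hr.trans (ht'.trans ht)
      obtain rfl := eq_of_forcesEq (forcesEq_refl a _) (forcesEq_coe_mono ha hrs) e1
      exact ⟨r, hr, forcesMem_ordinal_of_eq e2 (h' r hrs β hX)⟩
    · refine fun hb => forces_coe_of_dense fun t' ht' => ?_
      obtain ⟨r, hr, β, hβ, e⟩ := exists_eq_of_mem_ordinal (forcesMem_mono hb (coe_le ht'))
      obtain ⟨q, hq, hn⟩ := h r (hr.trans (ht'.trans ht)) β hβ
      exact ⟨q, hq.trans hr, forces_pairMem.2 (mem_limitNodes hn (forcesEq_pair.2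
        ⟨forcesEq_coe_mono ha (hq.trans (hr.trans (ht'.trans ht))), forcesEq_coe_mono e hq⟩))⟩
  constructor
  · refine fun hx => forcesEq_of_mem fun z q hq => ?_
    obtain ⟨t, ht, rfl⟩ := exists_coe_of_le hq
    exact (forces_iff.1 (hx z) _ hq).trans (key t ht z)
  · refine fun hx b => forces_iff.2 fun q hq => ?_
    obtain ⟨t, ht, rfl⟩ := exists_coe_of_le hq
    rw [key t ht b]
    exact ⟨forcesMem_congr_right (forcesEq_coe_mono hx ht),
      forcesMem_congr_right (forcesEq_symm (forcesEq_coe_mono hx ht))⟩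

omit [Nonempty (MorassCondition κ)] in
theorem forces_isTheta_low {α : Ordinal.{u}} (hα : α ≤ s.lam)
    (ha : ForcesEq a (ordinal α) (s : MangroveForcing κ)) :
    Forces (isTheta (limitNodes κ) a x) (s : MangroveForcing κ) ↔
      ForcesEq x (ordinal (s.theta α)) (s : MangroveForcing κ) := by
  have hs := (s.left_alignment α hα).1
  refine forces_isTheta_of (fun t ht β hβ => ⟨t, le_rfl, MorassCondition.nodes_of_le ht
    ((hs β).2 hβ)⟩) (fun t ht β hβ => ?_) ha
  exact (hs β).1 (MorassCondition.node_of_le ht hβ hα)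

omit [Nonempty (MorassCondition κ)] in
theorem forces_isTheta_top (hκ : ℵ₀ < κ) (ha : ForcesEq a (ordinal κ.ord) (s : MangroveForcing κ)) :
    Forces (isTheta (limitNodes κ) a x) (s : MangroveForcing κ) ↔
      ForcesEq x (ordinal (succ κ).ord) (s : MangroveForcing κ) := by
  refine forces_isTheta_of (fun t ht β hβ => ?_) (fun t ht β hβ => t.topSet_lt hβ) ha
  obtain ⟨r, h1, -, h2⟩ := t.exists_le_mem_topSet hκ (α := 0)
    (Cardinal.isSuccLimit_ord hκ.le).pos hβ
  exact ⟨r, h1, h2⟩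

theorem forces_leftAlignment (hκ : ℵ₀ < κ) :
    Forces (leftAlignment (ordinal κ.ord) (ordinal (succ κ).ord) (limitNodes κ)) p := by
  refine ⟨forces_of_coe fun s _ => ⟨s, le_rfl, (forces_isTheta_top hκ (forcesEq_refl _ _)).2
    (forcesEq_refl _ _)⟩, fun a => forces_imp_of_coe fun s _ ha => ?_⟩
  obtain ⟨t, ht, α, hα, e⟩ := exists_eq_of_mem_ordinal ha
  obtain ⟨r, hr, -, hle⟩ := t.exists_le_lam_gt hκ hα
  obtain ⟨-, h1, h2⟩ := r.left_alignment α hle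
  refine ⟨r, hr.trans ht, Forces.ex (ordinal (r.theta α))
    ⟨(forces_isTheta_low hle (forcesEq_coe_mono e hr)).2 (forcesEq_refl _ _),
    forces_isOrd (forcesEq_refl _ _), fun q _ h => ?_, forcesMem_ordinal_of_lt h2 _⟩⟩
  exact h1.ne' ((forces_isZero (forcesEq_refl _ _)).1 h)

theorem forces_isTreeOrder : Forces (isTreeOrder (limitNodes κ) (limitRel κ)) p := by
  refine ⟨fun z => forces_imp_of_coe fun s _ hz => ?_, fun x => ?_,
    fun x y z => forces_imp_imp.2 (forces_imp_of_coe fun s _ h => ?_),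
    fun y A => forces_imp_imp.2 (forces_imp_of_coe fun s _ h => ?_)⟩
  · obtain ⟨t, ht, X, Y, h, e⟩ := exists_of_mem_limitRel hz
    exact ⟨t, ht, Forces.ex (nodeName X) <| Forces.ex (nodeName Y)
      ⟨mem_limitNodes (t.rel_nodes _ _ h).1 (forcesEq_refl _ _),
      mem_limitNodes (t.rel_nodes _ _ h).2 (forcesEq_refl _ _), forces_isPair.2 e⟩⟩
  · intro q hq h
    obtain ⟨s, hs⟩ := exists_real q
    obtain ⟨t, ht, X, Y, h1, e1, e2⟩ := exists_of_pairMem_limitRel (h.mono hs)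
    obtain rfl := forcesEq_nodeName e1 e2
    exact t.rel_irrefl X h1
  · obtain ⟨t, ht, X, Y, h1, e1, e2⟩ := exists_of_pairMem_limitRel h.1
    obtain ⟨r, hr, Y', Z, h2, e2', e3⟩ := exists_of_pairMem_limitRel (h.2.mono (coe_le ht))
    obtain rfl := forcesEq_nodeName (forcesEq_coe_mono e2 hr) e2'
    exact ⟨r, hr.trans ht, pairMem_limitRel
      (r.rel_trans _ _ _ (MorassCondition.rel_of_le hr h1) h2) (forcesEq_coe_mono e1 hr) e3⟩
  · obtain ⟨h1, h2⟩ := h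
    obtain ⟨t, ht, x, hx⟩ := exists_of_forces_ex h1
    have h2 := h2.mono (coe_le ht)
    have key : ∀ r ≤ t, ∀ x, Forces (x ∈ₛ A) (r : MangroveForcing κ) → ∃ q ≤ r, ∃ X Y, q.rel X Y ∧
        ForcesEq x (nodeName X) (q : MangroveForcing κ) ∧
        ForcesEq y (nodeName Y) (q : MangroveForcing κ) := fun r hr x hx =>
      exists_of_pairMem_limitRel (forces_imp.1 (h2 x) _ (coe_le hr) hx)
    obtain ⟨r, hr, X, Y, hXY, ex, ey⟩ := key t le_rfl x hx
    -- The minimum is taken over levels of nodes that some extension of `r` forces into `A`. An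
    -- extension attaining it forces its node to be least: elements of `A` all lie below `y`, hence
    -- are comparable.
    let B : Set Ordinal.{u} := {α | ∃ q ≤ r, ∃ X, l X = α ∧
      ForcesMem (nodeName X) A (q : MangroveForcing κ)}
    have hB : B.Nonempty :=
      ⟨_, r, le_rfl, X, rfl, forcesMem_congr_left ex (hx.mono (coe_le hr))⟩
    obtain ⟨q, hq, N, hN, hNA⟩ := csInf_mem hB
    refine ⟨q, hq.trans (hr.trans ht), Forces.ex (nodeName N) ⟨hNA, fun x =>
      forces_imp_of_coe fun q' hq' hx' => ?_⟩⟩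
    have hq'q := WithTop.coe_le_coe.1 hq'
    obtain ⟨q1, hq1, X1, Y1, h3, e3, e4⟩ := key q' (hq'q.trans (hq.trans hr)) x hx'
    have hle1 : q1 ≤ q := hq1.trans hq'q
    obtain ⟨q2, hq2, N', Y2, h5, e5, e6⟩ := key q1 (hle1.trans (hq.trans hr)) (nodeName N)
      (forcesMem_mono hNA (coe_le hle1))
    obtain rfl := forcesEq_nodeName (forcesEq_refl _ _) e5
    obtain rfl := forcesEq_nodeName (forcesEq_coe_mono e4 hq2) e6
    have h3' := MorassCondition.rel_of_le hq2 h3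
    have e3' := forcesEq_coe_mono e3 hq2
    have hle : l N ≤ l X1 := by
      rw [hN]
      exact csInf_le' ⟨q2, hq2.trans (hle1.trans hq), X1, rfl,
        forcesMem_congr_left e3' (hx'.mono (coe_le (hq2.trans hq1)))⟩
    refine ⟨q2, hq2.trans hq1, ?_⟩
    rcases hle.lt_or_eq with hlt | heq
    · exact Forces.inr (pairMem_limitRel (q2.rel_of_level_lt h5 h3' hlt) (forcesEq_refl _ _) e3')
    · obtain rfl := q2.eq_of_level_eq h5 h3' heq
      exact Forces.inl e3'

theorem forces_isMapFamily : Forces (isMapFamily (limitRel κ) (limitMaps κ)) p := by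
  refine ⟨fun z => forces_imp_of_coe fun s _ hz => ?_, fun z => forces_imp_of_coe fun s _ hz => ?_,
    fun z f f' => forces_imp_imp.2 (forces_imp_of_coe fun s _ h => ?_),
    fun x y a b c d f => forces_edge_map fun s X Y _ he hf => ?_⟩
  · obtain ⟨t, ht, X, Y, h, e⟩ := exists_of_mem_limitMaps hz
    exact ⟨t, ht, Forces.ex (pair (nodeName X) (nodeName Y)) <| Forces.ex (mapName t X Y)
      ⟨mem_limitRel h (forcesEq_refl _ _), forces_isPair.2 e⟩⟩
  · obtain ⟨t, ht, X, Y, h, e⟩ := exists_of_mem_limitRel hz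
    exact ⟨t, ht, Forces.ex (mapName t X Y) (forces_pairMem.2 (mem_limitMaps h
      (forcesEq_pair.2 ⟨e, forcesEq_refl _ _⟩)))⟩
  · obtain ⟨t, ht, X, Y, h1, e⟩ := exists_of_mem_limitMaps (forces_pairMem.1 h.1)
    obtain ⟨e1, e2⟩ := forcesEq_pair.1 e
    have := eq_mapName_of_mem h1 e1 (forces_pairMem.1 (h.2.mono (coe_le ht)))
    exact ⟨t, ht, forcesEq_trans e2 (forcesEq_symm this)⟩
  · refine ⟨s, le_rfl, Forces.ex (ordinal (o X + 1)) <| Forces.ex (ordinal (o Y + 1))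
      ⟨(forces_isSucc he.b).2 (forcesEq_refl _ _), (forces_isSucc he.d).2 (forcesEq_refl _ _), ?_⟩⟩
    rw [mapName_eq] at hf
    refine forces_isFun_ordinalFun hf (forcesEq_refl _ _) (forcesEq_refl _ _)
      (fun γ => mem_Iic_iff) fun γ hγ => Order.lt_add_one_iff.2 ?_
    exact s.map_le _ _ he.rel γ (Order.lt_add_one_iff.1 hγ)

theorem forces_monotonicity : Forces (SetFormula.monotonicity (limitRel κ)) p :=
  fun _ _ _ _ _ _ => forces_edge fun s _ _ _ he => ⟨s, le_rfl, forcesMem_congr_right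
    (forcesEq_symm he.c) (forcesMem_ordinal_of_eq he.a (s.monotonicity _ _ he.rel))⟩

theorem forces_commutativity : Forces (SetFormula.commutativity (limitRel κ) (limitMaps κ)) p := by
  intro x y z f g h
  rw [forces_imp_imp, forces_imp_imp, forces_imp_imp, forces_imp_imp]
  refine forces_imp_of_coe fun s _ ⟨⟨⟨⟨h1, h2⟩, hf⟩, hg⟩, hh⟩ => ?_
  obtain ⟨t, ht, X, Y, hXY, ex, ey⟩ := exists_of_pairMem_limitRel h1
  obtain ⟨r, hr, Y', Z, hYZ, ey', ez⟩ := exists_of_pairMem_limitRel (h2.mono (coe_le ht))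
  obtain rfl := forcesEq_nodeName (forcesEq_coe_mono ey hr) ey'
  replace hXY := MorassCondition.rel_of_le hr hXY
  replace ex := forcesEq_coe_mono ex hr
  have hrs := coe_le (hr.trans ht)
  have hXZ := r.rel_trans _ _ _ hXY hYZ
  replace hf := eq_mapName_of_isMap hXY ex ey' (hf.mono hrs)
  replace hg := eq_mapName_of_isMap hYZ ey' ez (hg.mono hrs)
  replace hh := eq_mapName_of_isMap hXZ ex ez (hh.mono hrs)
  refine ⟨r, hr.trans ht, fun v w => forces_iff_of_coe (fun q hq h => ?_) (fun q hq h => ?_)⟩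
  · obtain ⟨q', hq', γ, hγ, e1, e2⟩ := exists_eq_of_pairMem_ordinalFun (forcesEq_mono hh hq) h
    have hq'r := (coe_le hq').trans hq
    refine ⟨q', hq', Forces.ex (ordinal (r.map X Y γ))
      ⟨pairMem_ordinalFun (forcesEq_mono hf hq'r) hγ e1 (forcesEq_refl _ _),
      pairMem_ordinalFun (forcesEq_mono hg hq'r) (r.map_le _ _ hXY γ hγ) (forcesEq_refl _ _) ?_⟩⟩
    rwa [r.commutativity _ _ _ hXY hYZ γ hγ]
  · obtain ⟨q1, hq1, m, h3, h4⟩ := exists_of_forces_ex h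
    have hq1r := (coe_le hq1).trans hq
    obtain ⟨q2, hq2, γ, hγ, e1, e2⟩ := exists_eq_of_pairMem_ordinalFun (forcesEq_mono hf hq1r) h3
    have hq2r := (coe_le hq2).trans hq1r
    obtain ⟨q3, hq3, δ, hδ, e3, e4⟩ := exists_eq_of_pairMem_ordinalFun (forcesEq_mono hg hq2r)
      (h4.mono (coe_le hq2))
    obtain rfl := eq_of_forcesEq (forcesEq_refl m _) (forcesEq_coe_mono e2 hq3) e3
    refine ⟨q3, hq3.trans (hq2.trans hq1), pairMem_ordinalFun
      (forcesEq_mono hh ((coe_le hq3).trans hq2r)) hγ (forcesEq_coe_mono e1 hq3) ?_⟩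
    rwa [r.commutativity _ _ _ hXY hYZ γ hγ] at e4

theorem forces_axiomM1 : Forces (axiomM1 (limitRel κ) (limitMaps κ)) p := by
  refine fun x y a b c d f => forces_edge_map fun s X Y _ he hf => ⟨s, le_rfl, ?_, ?_⟩
  · exact forces_isSLOOP_ordinalFun hf he.b (fun γ => mem_Iic_iff)
      (s.m1 _ _ he.rel).1
  · refine pairMem_ordinalFun hf (γ := o X) (Set.mem_Iic.2 le_rfl) he.b ?_
    rw [(s.m1 _ _ he.rel).2]
    exact he.d

end MangroveForcing

/-! ### The axioms M.2 to M.7 and the mangals -/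

namespace MangroveForcing

open PName SetFormula

variable {κ : Cardinal.{u}} {s : MorassCondition κ} {p : MangroveForcing κ}
  {φ ψ : SetFormula (Name κ)} {X Y : MorassNode.{u}} {x y z a b c d f : Name κ}
  [Nonempty (MorassCondition κ)]

theorem forces_axiomM2 : Forces (axiomM2 (limitRel κ) (limitMaps κ)) p := by
  refine fun x y a b c d f => forces_edge_map fun s X Y _ he hf => ⟨s, le_rfl, fun n n' v z => ?_⟩
  rw [forces_imp_imp, forces_imp_imp, forces_imp_imp]
  refine forces_imp_of_coe fun t ht ⟨⟨⟨h1, h2⟩, h3⟩, h4⟩ => ?_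
  replace ht := WithTop.coe_le_coe.1 ht
  replace hf := eq_mapName_mono ht he.rel hf
  obtain ⟨r, hr, γ, hγ, e1, e2⟩ := exists_eq_of_pairMem_ordinalFun hf h2
  replace hf := eq_mapName_mono hr (MorassCondition.rel_of_le ht he.rel) hf
  rw [← MorassCondition.map_of_le hr (MorassCondition.rel_of_le ht he.rel)] at e2
  replace he := he.mono (hr.trans ht)
  have hlt := lt_of_forcesMem (h1.mono (coe_le hr)) e1 he.b
  obtain ⟨h5, h6⟩ := r.m2 _ _ he.rel γ hlt
  have ev : ForcesEq v (nodeName (l X, γ)) (r : MangroveForcing κ) :=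
    forcesEq_trans (forces_isPair.1 (h3.mono (coe_le hr))) (forcesEq_pair.2 ⟨he.a, e1⟩)
  have ez : ForcesEq z (nodeName (l Y, r.map X Y γ)) (r : MangroveForcing κ) :=
    forcesEq_trans (forces_isPair.1 (h4.mono (coe_le hr))) (forcesEq_pair.2 ⟨he.c, e2⟩)
  refine ⟨r, hr, pairMem_limitRel h5 ev ez, fun g => forces_imp_of_coe fun q hq hg => ⟨q, le_rfl,
    fun i j => forces_iff_of_coe (fun q' hq' h => ?_) (fun q' hq' h => ?_)⟩⟩
  all_goals
    replace hq := WithTop.coe_le_coe.1 hq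
    replace hq' := WithTop.coe_le_coe.1 hq'
    have hg := eq_mapName_of_isMap (MorassCondition.rel_of_le hq h5) (forcesEq_coe_mono ev hq)
      (forcesEq_coe_mono ez hq) hg
    rw [mapName_mono hq h5] at hg
    replace hg := forcesEq_coe_mono hg hq'
  · obtain ⟨q1, hq1, δ, hδ, e3, e4⟩ := exists_eq_of_pairMem_ordinalFun hg h
    have hle := hq1.trans (hq'.trans hq)
    have hδ : δ ≤ γ := hδ
    rw [h6 δ hδ] at e4
    refine ⟨q1, hq1, ?_, pairMem_ordinalFun (forcesEq_coe_mono hf hle)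
      (Set.mem_Iic.2 (hδ.trans hlt.le)) e3 e4⟩
    have e1 := forcesEq_symm (forcesEq_coe_mono e1 hle)
    rcases hδ.lt_or_eq with h' | rfl
    · exact Forces.inl (forcesMem_congr_right e1 (forcesMem_ordinal_of_eq e3 h'))
    · exact Forces.inr (forcesEq_trans e3 e1)
  · obtain ⟨q1, hq1, δ, hδ, e3, e4⟩ := exists_eq_of_pairMem_ordinalFun
      (forcesEq_coe_mono hf (hq'.trans hq)) h.2
    have hle := hq1.trans (hq'.trans hq)
    obtain ⟨q2, hq2, h'⟩ := exists_of_forces_or (h.1.mono (coe_le hq1))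
    have e1 := forcesEq_coe_mono e1 (hq2.trans hle)
    have hδγ : δ ≤ γ := by
      rcases h' with h' | h'
      · exact (lt_of_forcesMem h' (forcesEq_coe_mono e3 hq2) e1).le
      · exact (eq_of_forcesEq h' (forcesEq_coe_mono e3 hq2) e1).le
    rw [← h6 δ hδγ] at e4
    exact ⟨q1, hq1, pairMem_ordinalFun (forcesEq_coe_mono hg hq1) (Set.mem_Iic.2 hδγ) e3 e4⟩

omit [Nonempty (MorassCondition κ)] in
theorem exists_of_levelBelow {Y : MorassNode.{u}} {α : Ordinal.{u}}
    (h : Forces (levelBelow (limitRel κ) y a) (s : MangroveForcing κ))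
    (hy : ForcesEq y (nodeName Y) (s : MangroveForcing κ))
    (ha : ForcesEq a (ordinal α) (s : MangroveForcing κ)) :
    ∃ t ≤ s, ∃ β, t.rel (α, β) Y := by
  obtain ⟨t1, ht1, x, h1⟩ := exists_of_forces_ex h
  obtain ⟨t2, ht2, b, h2, h3⟩ := exists_of_forces_ex h1
  obtain ⟨t3, ht3, ⟨α', β⟩, Y', h4, e1, e2⟩ := exists_of_pairMem_limitRel h3
  have hle := ht3.trans (ht2.trans ht1)
  obtain rfl := forcesEq_nodeName (forcesEq_coe_mono hy hle) e2
  obtain ⟨e3, -⟩ := forcesEq_pair.1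
    (forcesEq_trans (forcesEq_symm (forcesEq_coe_mono (forces_isPair.1 h2) ht3)) e1)
  obtain rfl := eq_of_forcesEq (forcesEq_refl a _) (forcesEq_coe_mono ha hle) e3
  exact ⟨t3, hle, β, h4⟩

omit [Nonempty (MorassCondition κ)] in
theorem forces_levelBelow {Y : MorassNode.{u}} {α β : Ordinal.{u}} (h : s.rel (α, β) Y)
    (hy : ForcesEq y (nodeName Y) (s : MangroveForcing κ))
    (ha : ForcesEq a (ordinal α) (s : MangroveForcing κ)) :
    Forces (levelBelow (limitRel κ) y a) (s : MangroveForcing κ) :=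
  Forces.ex (nodeName (α, β)) <| Forces.ex (ordinal β)
    ⟨forces_isPair.2 (forcesEq_pair.2 ⟨forcesEq_symm ha, forcesEq_refl _ _⟩),
      pairMem_limitRel h (forcesEq_refl _ _) hy⟩

omit [Nonempty (MorassCondition κ)] in
/-- The levels below a node of `s` that are at most `s.lam` are decided by `s`. -/
theorem unboundedIn_of_forces {Y : MorassNode.{u}} (hY : Y ∈ s.nodes) {γ : Ordinal.{u}}
    (hγ : γ ≤ s.lam) (hy : ForcesEq y (nodeName Y) (s : MangroveForcing κ))
    (hc : ForcesEq c (ordinal γ) (s : MangroveForcing κ))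
    (h : Forces (levelsUnbounded (limitRel κ) y c) (s : MangroveForcing κ)) :
    UnboundedIn (s.toMorassData.levelsBelow Y) γ := by
  intro ε hε
  obtain ⟨t, ht, a, h1, h2, h3⟩ := exists_of_forces_ex (forces_imp.1 (h (ordinal ε)) _ le_rfl
    (forcesMem_congr_right (forcesEq_symm hc) (forcesMem_ordinal_of_lt hε _)))
  obtain ⟨r, hr, α, hα, e⟩ := exists_eq_of_mem_ordinal
    (forcesMem_congr_right (forcesEq_coe_mono hc ht) h1)
  obtain ⟨q, hq, β, hβ⟩ := exists_of_levelBelow (h3.mono (coe_le hr))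
    (forcesEq_coe_mono hy (hr.trans ht)) e
  exact ⟨α, ⟨(α, β), MorassCondition.rel_of_le' (hq.trans (hr.trans ht)) hβ hY (hα.le.trans hγ),
    rfl⟩, lt_of_forcesMem (h2.mono (coe_le hr)) (forcesEq_refl _ _) e, hα⟩

theorem forces_axiomM3 (hκ : ℵ₀ < κ) : Forces (axiomM3 (limitNodes κ) (limitRel κ)) p := by
  refine fun y c d => forces_node fun s Y _ hY hy hc _ => ⟨s, le_rfl, fun e => ?_⟩
  rw [forces_imp_imp, forces_imp_imp]
  refine forces_imp_of_coe fun t ht ⟨⟨h1, h2⟩, h3⟩ => ?_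
  replace ht := WithTop.coe_le_coe.1 ht
  obtain ⟨r, hr, γ, hγ, ee⟩ := exists_eq_of_mem_ordinal
    (forcesMem_congr_right (forcesEq_coe_mono hc ht) h1)
  -- With the top level at least `γ`, the predecessor levels below `γ` are decided and M.3 of `q`
  -- applies.
  obtain ⟨q, hq, -, hle⟩ := r.exists_le_lam_gt hκ (hγ.trans_le (s.level_le_kappa hY))
  have hqs := hq.trans (hr.trans ht)
  replace hY := MorassCondition.nodes_of_le hqs hY
  replace hy := forcesEq_coe_mono hy hqs
  replace ee := forcesEq_coe_mono ee hq
  have hun := unboundedIn_of_forces hY hle hy ee (h3.mono (coe_le (hq.trans hr)))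
  obtain ⟨⟨_, β⟩, hβ, rfl⟩ := q.m3 Y hY γ hγ
    ((forces_isLimit ee).1 (h2.mono (coe_le (hq.trans hr)))) hun
  exact ⟨q, hq.trans hr, forces_levelBelow hβ hy ee⟩

theorem forces_axiomM4 (hκ : ℵ₀ < κ) : Forces (axiomM4 (limitNodes κ) (limitRel κ)) p := by
  refine fun y c d t => forces_node fun s Y _ hY hy hc hd => ⟨s, le_rfl, ?_⟩
  rw [forces_imp_imp]
  refine forces_imp_of_coe fun r hr ⟨h1, h2⟩ => ⟨r, le_rfl, fun e => forces_imp_of_coe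
    fun q hq he => ?_⟩
  replace hr := WithTop.coe_le_coe.1 hr
  replace hq := WithTop.coe_le_coe.1 hq
  have hqs := hq.trans hr
  obtain ⟨q', hq', ε, hε, ee⟩ := exists_eq_of_mem_ordinal
    (forcesMem_congr_right (forcesEq_coe_mono hc hqs) he)
  -- For a low node, `θ` is decided and M.4 of the condition applies. At level `κ`, raise the top
  -- level above `ε`: the top node then has a predecessor on it.
  have key : ∃ q1 ≤ q', ∃ α β, ε < α ∧ α < l Y ∧ q1.rel (α, β) Y := by
    rcases s.level_cases hY with ⟨hle, -⟩ | ⟨β, hβ, rfl⟩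
    · have hle' := hle.trans (MorassCondition.lam_le_of_le hr)
      have e1 := (forces_isTheta_low hle' (forcesEq_coe_mono hc hr)).1 h1
      have hne : o Y + 1 ≠ r.theta (l Y) := fun h => by
        rw [← h] at e1
        exact h2 _ le_rfl ((forces_isSucc (forcesEq_coe_mono hd hr)).2 e1)
      obtain ⟨_, ⟨⟨α, β⟩, h3, rfl⟩, h4, h5⟩ :=
        r.m4 Y (MorassCondition.nodes_of_le hr hY) hle' hne ε hε
      exact ⟨q', le_rfl, α, β, h4, h5, MorassCondition.rel_of_le (hq'.trans hq) h3⟩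
    · obtain ⟨q1, h3, h4, h5⟩ := q'.exists_le_mem_topSet hκ hε (s.topSet_lt hβ)
      obtain ⟨f, g, h6, -⟩ := q1.exists_top_of_rel h5
      exact ⟨q1, h3, q1.lam, _, h4, q1.lam_lt, h6⟩
  obtain ⟨q1, h3, α, β, h4, h5, h6⟩ := key
  have hle := h3.trans (hq'.trans hqs)
  exact ⟨q1, h3.trans hq', Forces.ex (ordinal α) ⟨forcesMem_congr_right
    (forcesEq_symm (forcesEq_coe_mono hc hle)) (forcesMem_ordinal_of_lt h5 _),
    forcesMem_ordinal_of_eq (forcesEq_coe_mono ee h3) h4,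
    forces_levelBelow h6 (forcesEq_coe_mono hy hle) (forcesEq_refl _ _)⟩⟩

theorem forces_axiomM5 (hκ : ℵ₀ < κ) :
    Forces (axiomM5 (limitNodes κ) (limitRel κ) (limitMaps κ)) p := by
  refine fun y c d => forces_node fun s Y _ hY hy hc hd => ⟨s, le_rfl, forces_imp_of_coe
    fun r hr h1 => ⟨r, le_rfl, fun t => forces_iff_of_coe (fun q hq h => ?_) fun q hq h => ?_⟩⟩
  all_goals
    replace hr := WithTop.coe_le_coe.1 hr
    replace hq := WithTop.coe_le_coe.1 hq
    have hqs := hq.trans hr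
  · obtain ⟨q', hq', δ, hδ, e⟩ := exists_eq_of_mem_ordinal
      (forcesMem_congr_right (forcesEq_coe_mono hd hqs) h)
    -- For a low node, unboundedness is decided and M.5 of the condition applies. At level `κ`, add
    -- `δ` to the top set: the map from level `λ` is the enumeration, so it takes the value `δ`.
    have key : ∃ q1 ≤ q', ∃ X γ, q1.rel X Y ∧ γ < o X ∧ q1.map X Y γ = δ := by
      rcases s.level_cases hY with ⟨hle, -⟩ | ⟨β, hβ, rfl⟩
      · have hY' := MorassCondition.nodes_of_le (hq'.trans hqs) hY
        have hun := unboundedIn_of_forces hY' (hle.trans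
          (MorassCondition.lam_le_of_le (hq'.trans hqs))) (forcesEq_coe_mono hy (hq'.trans hqs))
          (forcesEq_coe_mono hc (hq'.trans hqs)) (h1.mono (coe_le (hq'.trans hq)))
        have hmem : δ ∈ Set.Iio (o Y) := hδ
        rw [q'.m5 Y hY' hun] at hmem
        obtain ⟨X, h2, γ, h3, h4⟩ := hmem
        exact ⟨q', le_rfl, X, γ, h2, h3, h4⟩
      · obtain ⟨q1, h3, -, h5⟩ := q'.exists_le_mem_topSet hκ q'.lam_lt
          (hδ.trans (s.topSet_lt hβ))
        obtain ⟨f, g, h6, h7, h8, -⟩ := q1.exists_top_of_rel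
          (MorassCondition.nodes_of_le (h3.trans (hq'.trans hqs)) hY)
        have hlt := (h8 δ β h5 (MorassCondition.nodes_of_le (h3.trans (hq'.trans hqs)) hY)).2 hδ
        refine ⟨q1, h3, (q1.lam, g β), g δ, h6, hlt, ?_⟩
        rw [((h7 β (MorassCondition.nodes_of_le (h3.trans (hq'.trans hqs)) hY)).2.2.2 _ hlt.le).2.2,
          (h7 δ h5).2.1]
    obtain ⟨q1, h3, X, γ, h4, h5, rfl⟩ := key
    have ey := forcesEq_coe_mono hy (h3.trans (hq'.trans hqs))
    refine ⟨q1, h3.trans hq', Forces.ex (nodeName X) <| Forces.ex (ordinal (l X)) <|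
      Forces.ex (ordinal (o X)) <| Forces.ex (mapName q1 X Y) <| Forces.ex (ordinal γ)
      ⟨forces_isPair.2 (forcesEq_refl _ _), pairMem_limitRel h4 (forcesEq_refl _ _) ey,
      forces_isMap.2 (mem_limitMaps h4 (forcesEq_pair.2 ⟨forcesEq_pair.2 ⟨forcesEq_refl _ _, ey⟩,
        forcesEq_refl _ _⟩)), forcesMem_ordinal_of_lt h5 _,
      pairMem_ordinalFun (forcesEq_refl _ _) (Set.mem_Iic.2 h5.le) (forcesEq_refl _ _)
        (forcesEq_coe_mono e h3)⟩⟩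
  · obtain ⟨q1, hq1, x, h⟩ := exists_of_forces_ex h
    obtain ⟨q2, hq2, a, h⟩ := exists_of_forces_ex h
    obtain ⟨q3, hq3, b, h⟩ := exists_of_forces_ex h
    obtain ⟨q4, hq4, f, h⟩ := exists_of_forces_ex h
    obtain ⟨q5, hq5, r', h2, h3, h4, h5, h6⟩ := exists_of_forces_ex h
    have h5q : q5 ≤ q := hq5.trans (hq4.trans (hq3.trans (hq2.trans hq1)))
    obtain ⟨q6, hq6, X, Y', hXY, e1, e2⟩ := exists_of_pairMem_limitRel h3
    have h6s := hq6.trans (h5q.trans hqs)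
    obtain rfl := forcesEq_nodeName (forcesEq_coe_mono hy h6s) e2
    have ef := eq_mapName_of_isMap hXY e1 e2 (h4.mono (coe_le hq6))
    obtain ⟨-, eb⟩ := forcesEq_pair.1
      (forcesEq_trans (forcesEq_symm (forcesEq_coe_mono (forces_isPair.1 h2) hq6)) e1)
    obtain ⟨q7, hq7, γ, hγ, e3, e4⟩ := exists_eq_of_pairMem_ordinalFun ef (h6.mono (coe_le hq6))
    have hlt := lt_of_forcesMem (h5.mono (coe_le (hq7.trans hq6))) e3 (forcesEq_coe_mono eb hq7)
    exact ⟨q7, hq7.trans (hq6.trans h5q), forcesMem_congr_right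
      (forcesEq_symm (forcesEq_coe_mono hd (hq7.trans h6s)))
      (forcesMem_ordinal_of_eq e4 (q6.map_lt_o hXY hlt))⟩

theorem forces_axiomM6 (hκ : ℵ₀ < κ) : Forces (axiomM6 (limitRel κ) (limitMaps κ)) p := by
  refine fun x y a b c d f => forces_edge_map fun s X Y _ he hf => ⟨s, le_rfl, forces_imp_of_coe
    fun t ht h1 => ⟨t, le_rfl, fun n z => forces_imp_imp.2 (forces_imp_of_coe
    fun q hq ⟨h2, h3⟩ => ?_)⟩⟩
  have hqs := (WithTop.coe_le_coe.1 hq).trans (WithTop.coe_le_coe.1 ht)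
  replace hf := eq_mapName_mono hqs he.rel hf
  replace he := he.mono hqs
  have hl := (forces_isLimit he.b).1 (h1.mono hq)
  obtain ⟨σ, hσ⟩ := q.exists_isLUB_map he.rel hl
  have en := forcesEq_of_isSupImage hf he.b (fun γ hγ => Set.mem_Iic.2 (le_of_lt hγ)) hσ h2
  have ez := forcesEq_trans (forces_isPair.1 h3) (forcesEq_pair.2 ⟨he.c, en⟩)
  obtain ⟨r, hr, h4, h5⟩ := q.exists_le_m6 hκ he.rel hl hσ
  have ez : ForcesEq z (nodeName (l Y, σ)) (r : MangroveForcing κ) := forcesEq_coe_mono ez hr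
  replace hf := eq_mapName_mono hr he.rel hf
  replace he := he.mono hr
  refine ⟨r, hr, pairMem_limitRel h4 he.x ez, fun g => forces_imp_of_coe fun r' hr' hg =>
    ⟨r', le_rfl, fun i j => forces_imp_of_coe fun q' hq' hi => ⟨q', le_rfl,
      forces_iff_of_coe (fun w hw h => ?_) fun w hw h => ?_⟩⟩⟩
  all_goals
    replace hr' := WithTop.coe_le_coe.1 hr'
    have hw' := WithTop.coe_le_coe.1 hw
    replace hq' := WithTop.coe_le_coe.1 hq'
    have hwr := hw'.trans (hq'.trans hr')
    have eg := eq_mapName_of_isMap (MorassCondition.rel_of_le hr' h4)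
      (forcesEq_coe_mono he.x hr') (forcesEq_coe_mono ez hr') hg
    replace eg := forcesEq_coe_mono eg (hw'.trans hq')
    rw [mapName_mono hr' h4] at eg
  · obtain ⟨w', hw1, γ, hγ, e1, e2⟩ := exists_eq_of_pairMem_ordinalFun eg h
    have hlt := lt_of_forcesMem (hi.mono ((coe_le hw1).trans hw)) e1
      (forcesEq_coe_mono he.b (hw1.trans hwr))
    rw [h5 γ hlt] at e2
    exact ⟨w', hw1, pairMem_ordinalFun (forcesEq_coe_mono hf (hw1.trans hwr)) hγ e1 e2⟩
  · obtain ⟨w', hw1, γ, hγ, e1, e2⟩ := exists_eq_of_pairMem_ordinalFun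
      (forcesEq_coe_mono hf hwr) h
    have hlt := lt_of_forcesMem (hi.mono ((coe_le hw1).trans hw)) e1
      (forcesEq_coe_mono he.b (hw1.trans hwr))
    rw [← h5 γ hlt] at e2
    exact ⟨w', hw1, pairMem_ordinalFun (forcesEq_coe_mono eg hw1) hγ e1 e2⟩

theorem forces_axiomM7 (hκ : ℵ₀ < κ) : Forces (axiomM7 (limitRel κ) (limitMaps κ)) p := by
  refine fun x y a b c d f e => forces_edge_map fun s X Y _ he hf => ⟨s, le_rfl, ?_⟩
  rw [forces_imp_imp, forces_imp_imp, forces_imp_imp, forces_imp_imp]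
  refine forces_imp_of_coe fun t ht ⟨⟨⟨⟨h1, h2⟩, h3⟩, h4⟩, h5⟩ => ?_
  replace ht := WithTop.coe_le_coe.1 ht
  obtain ⟨r, hr, α, hα, ee⟩ := exists_eq_of_mem_ordinal
    (forcesMem_congr_right (forcesEq_coe_mono he.c ht) h2)
  replace hf := eq_mapName_mono (hr.trans ht) he.rel hf
  replace he := he.mono (hr.trans ht)
  have hXα := lt_of_forcesMem (h1.mono (coe_le hr)) he.a ee
  have hl := (forces_isLimit he.b).1 (h3.mono (coe_le hr))
  obtain ⟨σ, hσ⟩ := r.exists_isLUB_map he.rel hl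
  have hσ' := eq_of_forcesEq (forcesEq_refl d _) he.d (forcesEq_of_isSupImage hf he.b
    (fun γ hγ => Set.mem_Iic.2 (le_of_lt hγ)) hσ (h4.mono (coe_le hr)))
  subst hσ'
  obtain ⟨q, hq, γ, hγ⟩ := r.exists_le_m7 hκ he.rel hXα hα hl hσ (by
    intro ν hν q hq
    have h6 := forces_imp.1 (forces_imp.1 (h5 (ordinal ν) (ordinal (r.map X Y ν))) _
      (coe_le (hq.trans hr)) (forcesMem_congr_right (forcesEq_symm (forcesEq_coe_mono he.b hq))
        (forcesMem_ordinal_of_lt hν _))) _ le_rfl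
      (pairMem_ordinalFun (forcesEq_coe_mono hf hq) (Set.mem_Iic.2 hν.le) (forcesEq_refl _ _)
        (forcesEq_refl _ _))
    obtain ⟨q1, hq1, g, h⟩ := exists_of_forces_ex h6
    obtain ⟨q2, hq2, v, h⟩ := exists_of_forces_ex h
    obtain ⟨q3, hq3, z, h7, h8, h9⟩ := exists_of_forces_ex h
    have hq3q := hq3.trans (hq2.trans hq1)
    obtain ⟨q4, hq4, ⟨α', γ⟩, Z, h10, e1, e2⟩ := exists_of_pairMem_limitRel h9
    have hle := hq4.trans (hq3q.trans hq)
    obtain ⟨e3, -⟩ := forcesEq_pair.1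
      (forcesEq_trans (forcesEq_symm (forcesEq_coe_mono (forces_isPair.1 h7) hq4)) e1)
    obtain rfl := eq_of_forcesEq (forcesEq_refl e _) (forcesEq_coe_mono ee hle) e3
    have e4 : ForcesEq z (nodeName (l Y, r.map X Y ν)) (q4 : MangroveForcing κ) :=
      forcesEq_trans (forcesEq_coe_mono (forces_isPair.1 h8) hq4)
        (forcesEq_pair.2 ⟨forcesEq_coe_mono he.c hle, forcesEq_refl _ _⟩)
    obtain rfl := forcesEq_nodeName e2 e4
    exact ⟨q4, hq4.trans hq3q, γ, h10⟩)
  have ee' : ForcesEq (pair e (ordinal γ)) (nodeName (α, γ)) (q : MangroveForcing κ) :=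
    forcesEq_pair.2 ⟨forcesEq_coe_mono ee hq, forcesEq_refl _ _⟩
  exact ⟨q, hq.trans hr, Forces.ex (ordinal γ) <| Forces.ex (pair e (ordinal γ))
    ⟨forces_isPair.2 (forcesEq_refl _ _), pairMem_limitRel hγ ee' (forcesEq_coe_mono he.y hq)⟩⟩

/-- The order of the forcing requires `λ^s` to be a mangal of every extension of `s`, and each edge
of the limit appears in one of them. -/
theorem forces_isMangal : Forces (SetFormula.isMangal (ordinal κ.ord) (limitNodes κ) (limitRel κ)
    (ordinal s.lam)) (s : MangroveForcing κ) := by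
  refine ⟨forcesMem_ordinal_of_lt s.lam_lt _, fun x y a b c d => forces_edge
    fun t X Y ht he => ⟨t, le_rfl, forces_imp_imp.2 (forces_imp_of_coe fun r hr ⟨h1, h2⟩ => ?_)⟩⟩
  replace hr := WithTop.coe_le_coe.1 hr
  replace ht := WithTop.coe_le_coe.1 ht
  replace he := he.mono hr
  obtain ⟨⟨_, γ⟩, hZ, rfl, h3, h4⟩ := (hr.trans ht).2.2.2.2.2 X Y he.rel
    (lt_of_forcesMem h1 he.a (forcesEq_refl _ _)) (lt_of_forcesMem h2 (forcesEq_refl _ _) he.c)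
  exact ⟨r, le_rfl, Forces.ex (nodeName (s.lam, γ)) <| Forces.ex (ordinal γ)
    ⟨forces_isPair.2 (forcesEq_refl _ _), mem_limitNodes hZ (forcesEq_refl _ _),
    pairMem_limitRel h3 he.x (forcesEq_refl _ _), pairMem_limitRel h4 (forcesEq_refl _ _) he.y⟩⟩

theorem forces_mangals_cofinal (hκ : ℵ₀ < κ) :
    Forces (∀ₛ a, a ∈ₛ ordinal κ.ord →ₛ ∃ₛ e, SetFormula.isMangal (ordinal κ.ord) (limitNodes κ)
      (limitRel κ) e ∧ₛ a ∈ₛ e) p := by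
  refine fun a => forces_imp_of_coe fun s _ ha => ?_
  obtain ⟨t, ht, α, hα, e⟩ := exists_eq_of_mem_ordinal ha
  obtain ⟨r, hr, -, hle⟩ := t.exists_le_lam_gt hκ ((Cardinal.isSuccLimit_ord hκ.le).add_one_lt hα)
  exact ⟨r, hr.trans ht, Forces.ex (ordinal r.lam) ⟨forces_isMangal,
    forcesMem_ordinal_of_eq (forcesEq_coe_mono e hr) (Order.add_one_le_iff.1 hle)⟩⟩

end MangroveForcing

namespace MangroveForcing

open PName SetFormula

variable {κ : Cardinal.{u}} {s : MorassCondition κ} {p : MangroveForcing κ} {x y a f : Name κ}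

/-! ### Preservation of cardinals -/

theorem exists_value {α β γ : Ordinal.{u}} (ha : ForcesEq a (ordinal α) (s : MangroveForcing κ))
    (h : Forces (isFun f a (ordinal β)) (s : MangroveForcing κ)) (hγ : γ < α) :
    ∃ t ≤ s, ∃ δ < β, Forces (pairMem (ordinal γ) (ordinal δ) f) (t : MangroveForcing κ) := by
  obtain ⟨t, ht, y, hy⟩ := exists_of_forces_ex (forces_imp.1 (h.2.1 (ordinal γ)) _ le_rfl
    (forcesMem_congr_right (forcesEq_symm ha) (forcesMem_ordinal_of_lt hγ _)))
  obtain ⟨r, hr, x', hx⟩ := exists_of_forces_ex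
    (forces_imp.1 (h.1 (pair (ordinal γ) y)) _ (coe_le ht) (forces_pairMem.1 hy))
  obtain ⟨q, hq, y', hx1, hy1, hp⟩ := exists_of_forces_ex hx
  obtain ⟨-, e⟩ := forcesEq_pair.1 (forces_isPair.1 hp)
  obtain ⟨q', hq', δ, hδ, e'⟩ := exists_eq_of_mem_ordinal hy1
  refine ⟨q', hq'.trans (hq.trans (hr.trans ht)), δ, hδ, forces_pairMem.2 ?_⟩
  exact forcesMem_congr_left (forcesEq_pair.2 ⟨forcesEq_refl _ _,
    forcesEq_trans (forcesEq_coe_mono e hq') e'⟩)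
    (forces_pairMem.1 (hy.mono (coe_le (hq'.trans (hq.trans hr)))))

theorem exists_of_isFun {α β : Ordinal.{u}} (ha : ForcesEq a (ordinal α) (s : MangroveForcing κ))
    (h : Forces (isFun f a (ordinal β)) (s : MangroveForcing κ))
    (hxy : Forces (pairMem x y f) (s : MangroveForcing κ)) :
    ∃ t ≤ s, ∃ γ < α, ∃ δ < β, ForcesEq x (ordinal γ) (t : MangroveForcing κ) ∧
      ForcesEq y (ordinal δ) (t : MangroveForcing κ) := by
  obtain ⟨r, hr, x', hx⟩ := exists_of_forces_ex
    (forces_imp.1 (h.1 (pair x y)) _ le_rfl (forces_pairMem.1 hxy))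
  obtain ⟨q, hq, y', hx1, hy1, hp⟩ := exists_of_forces_ex hx
  obtain ⟨e1, e2⟩ := forcesEq_pair.1 (forces_isPair.1 hp)
  obtain ⟨q1, hq1, γ, hγ, e3⟩ := exists_eq_of_mem_ordinal
    (forcesMem_congr_right (forcesEq_coe_mono ha (hq.trans hr)) hx1)
  obtain ⟨q2, hq2, δ, hδ, e4⟩ := exists_eq_of_mem_ordinal (forcesMem_mono hy1 (coe_le hq1))
  exact ⟨q2, hq2.trans (hq1.trans (hq.trans hr)), γ, hγ, δ, hδ,
    forcesEq_trans (forcesEq_coe_mono e1 (hq2.trans hq1)) (forcesEq_coe_mono e3 hq2),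
    forcesEq_trans (forcesEq_coe_mono e2 (hq2.trans hq1)) e4⟩

variable [Nonempty (MorassCondition κ)]

/-- If the possible values of a function on an ordinal are bounded by `b`, so is the function. -/
theorem forces_bounded {α β b : Ordinal.{u}} (ha : ForcesEq a (ordinal α) (s : MangroveForcing κ))
    (h : Forces (isFun f a (ordinal β)) (s : MangroveForcing κ))
    (hb : ∀ γ < α, ∀ δ < β, ∀ t ≤ s,
      Forces (pairMem (ordinal γ) (ordinal δ) f) (t : MangroveForcing κ) → δ < b) :
    Forces (∀ₛ c, ∀ₛ d, pairMem c d f →ₛ d ∈ₛ ordinal b) (s : MangroveForcing κ) := by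
  refine fun c d => forces_imp_of_coe fun t ht hcd => ?_
  obtain ⟨r, hr, γ, hγ, δ, hδ, e1, e2⟩ := exists_of_isFun (forcesEq_mono ha ht) (h.mono ht) hcd
  refine ⟨r, hr, forcesMem_ordinal_of_eq e2 (hb γ hγ δ hδ r (hr.trans (WithTop.coe_le_coe.1 ht)) ?_)⟩
  exact forces_pairMem.2 (forcesMem_congr_left (forcesEq_pair.2 ⟨e1, e2⟩)
    (forces_pairMem.1 (hcd.mono (coe_le hr))))

omit [Nonempty (MorassCondition κ)] in
theorem value_unique {γ δ δ' : Ordinal.{u}} {β : Ordinal.{u}}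
    (h : Forces (isFun f a (ordinal β)) (s : MangroveForcing κ))
    (h1 : Forces (pairMem (ordinal γ) (ordinal δ) f) (s : MangroveForcing κ))
    (h2 : Forces (pairMem (ordinal γ) (ordinal δ') f) (s : MangroveForcing κ)) : δ = δ' :=
  forcesEq_ordinal_iff.1 (forces_imp.1 (forces_imp.1 (h.2.2 _ _ _) _ le_rfl h1) _ le_rfl h2)

/-- By distributivity one extension decides all values of `f`, which thus form a ground-model
function, bounded by regularity. -/
theorem exists_bounded_kappa (hreg : κ.IsRegular) (hκ : ℵ₀ < κ) {α : Ordinal.{u}}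
    (hα : α < κ.ord) (ha : ForcesEq a (ordinal α) (s : MangroveForcing κ))
    (h : Forces (isFun f a (ordinal κ.ord)) (s : MangroveForcing κ)) :
    ∃ t ≤ s, ∃ b < κ.ord,
      Forces (∀ₛ c, ∀ₛ d, pairMem c d f →ₛ d ∈ₛ ordinal b) (t : MangroveForcing κ) := by
  obtain ⟨t, ht, hD⟩ := MorassCondition.exists_le_forall hreg hκ hα
    -- The alternative of being incompatible with `s` makes the set dense everywhere, not only below
    -- `s`.
    (D := fun γ t => (∃ δ < κ.ord, Forces (pairMem (ordinal γ) (ordinal δ) f)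
      (t : MangroveForcing κ)) ∨ ∀ r ≤ t, ¬ r ≤ s) (by
      intro γ hγ q
      by_cases hq : ∃ r ≤ q, r ≤ s
      · obtain ⟨r, hrq, hrs⟩ := hq
        obtain ⟨t, ht, h'⟩ := exists_value (forcesEq_coe_mono ha hrs) (h.mono (coe_le hrs)) hγ
        exact ⟨t, ht.trans hrq, .inl h'⟩
      · exact ⟨q, le_rfl, .inr fun r hr hrs => hq ⟨r, hr, hrs⟩⟩) (by
      rintro γ q r hr (⟨δ, hδ, h'⟩ | h')
      · exact .inl ⟨δ, hδ, h'.mono (coe_le hr)⟩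
      · exact .inr fun r' hr' => h' r' (hr'.trans hr)) s
  have hD' : ∀ γ < α, ∃ δ < κ.ord, Forces (pairMem (ordinal γ) (ordinal δ) f)
      (t : MangroveForcing κ) := fun γ hγ => (hD γ hγ).resolve_right fun h' => h' t le_rfl ht
  choose! F hF1 hF2 using hD'
  obtain ⟨b, hb, hlt⟩ := exists_bound_Iio hreg (Cardinal.lt_ord.1 hα) F hF1
  refine ⟨t, ht, b, hb, forces_bounded (forcesEq_coe_mono ha ht) (h.mono (coe_le ht))
    fun γ hγ δ hδ r hr h' => ?_⟩
  rw [value_unique (h.mono (coe_le (hr.trans ht))) h' ((hF2 γ hγ).mono (coe_le hr))]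
  exact hlt γ hγ

/-- Conditions below `s` forcing different values at the same argument are incompatible, so by the
chain condition the possible values at each argument are bounded below `κ⁺`; regularity of `κ⁺`
bounds them uniformly. No extension of `s` is needed. -/
theorem exists_bounded_succ (hreg : κ.IsRegular) (hκ : ℵ₀ < κ)
    (hpow : ∀ μ : Cardinal.{u}, μ < κ → 2 ^ μ ≤ κ) {α : Ordinal.{u}} (hα : α < (succ κ).ord)
    (ha : ForcesEq a (ordinal α) (s : MangroveForcing κ))
    (h : Forces (isFun f a (ordinal (succ κ).ord)) (s : MangroveForcing κ)) :
    ∃ b < (succ κ).ord,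
      Forces (∀ₛ c, ∀ₛ d, pairMem c d f →ₛ d ∈ₛ ordinal b) (s : MangroveForcing κ) := by
  classical
  have hreg' := Cardinal.isRegular_succ hreg.aleph0_le
  have hbd : ∀ γ < α, ∃ b < (succ κ).ord, ∀ δ < (succ κ).ord, ∀ t ≤ s,
      Forces (pairMem (ordinal γ) (ordinal δ) f) (t : MangroveForcing κ) → δ < b := by
    intro γ hγ
    by_contra hc
    push Not at hc
    let D : Set Ordinal.{u} := {δ | δ < (succ κ).ord ∧ ∃ t ≤ s,
      Forces (pairMem (ordinal γ) (ordinal δ) f) (t : MangroveForcing κ)}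
    have hex : ∀ δ, ∃ t : MorassCondition κ, δ ∈ D → t ≤ s ∧
        Forces (pairMem (ordinal γ) (ordinal δ) f) (t : MangroveForcing κ) := by
      intro δ
      by_cases hδ : δ ∈ D
      · obtain ⟨t, h1, h2⟩ := hδ.2
        exact ⟨t, fun _ => ⟨h1, h2⟩⟩
      · exact ⟨s, fun h' => absurd h' hδ⟩
    choose q hq using hex
    obtain ⟨d, hd, d', hd', hne, r, h1, h2⟩ := MorassCondition.exists_compatible hreg hκ hpow D
      (fun d hd => hd.1) (fun b hb => by
        obtain ⟨δ, hδ, t, ht, h', hle⟩ := hc b hb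
        exact ⟨δ, ⟨hδ, t, ht, h'⟩, hle⟩) q
    exact hne (value_unique (h.mono (coe_le (h1.trans (hq d hd).1)))
      ((hq d hd).2.mono (coe_le h1)) ((hq d' hd').2.mono (coe_le h2)))
  choose! B hB1 hB2 using hbd
  obtain ⟨b, hb, hlt⟩ := exists_bound_Iio hreg' (Cardinal.lt_ord.1 hα) B hB1
  exact ⟨b, hb, forces_bounded ha h fun γ hγ δ hδ t ht h' => (hB2 γ hγ δ hδ t ht h').trans (hlt γ hγ)⟩

/-- A bound `b < β` on the values is itself an omitted value, so the function is not onto `β`. -/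
theorem forces_isCardinal_of_bounded {β : Ordinal.{u}}
    (H : ∀ (s : MorassCondition κ) (a f : Name κ), ∀ α < β,
      ForcesEq a (ordinal α) (s : MangroveForcing κ) →
      Forces (isFun f a (ordinal β)) (s : MangroveForcing κ) → ∃ t ≤ s, ∃ b < β,
        Forces (∀ₛ c, ∀ₛ d, pairMem c d f →ₛ d ∈ₛ ordinal b) (t : MangroveForcing κ)) :
    Forces (isCardinal (ordinal β)) p := by
  refine ⟨forces_isOrd (forcesEq_refl _ _), fun a => forces_imp_of_coe fun s _ ha => ?_⟩
  obtain ⟨t, ht, α, hα, e⟩ := exists_eq_of_mem_ordinal ha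
  refine ⟨t, ht, fun f => forces_imp_of_coe fun r hr hf => ?_⟩
  obtain ⟨q, hq, b, hb, h⟩ := H r a f α hα (forcesEq_mono e hr) hf
  refine ⟨q, hq, Forces.ex (ordinal b) ⟨forcesMem_ordinal_of_lt hb _, fun c q' hq' hc => ?_⟩⟩
  exact not_forcesMem_ordinal_of_le le_rfl q' (forces_imp.1 (h c (ordinal b)) q' hq' hc)

theorem forces_isUncountableRegular (hreg : κ.IsRegular) (hκ : ℵ₀ < κ) :
    Forces (isUncountableRegular (ordinal κ.ord)) p := by
  refine ⟨forces_isCardinal_of_bounded fun s a f α hα ha hf =>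
    exists_bounded_kappa hreg hκ hα ha hf, Forces.ex (ordinal ω) ⟨forcesMem_ordinal_of_lt ?_ _,
    (forces_isLimit (forcesEq_refl _ _)).2 Ordinal.isSuccLimit_omega0⟩,
    fun a => forces_imp_of_coe fun s _ ha => ?_⟩
  · rwa [← Cardinal.ord_aleph0, Cardinal.ord_lt_ord]
  · obtain ⟨t, ht, α, hα, e⟩ := exists_eq_of_mem_ordinal ha
    refine ⟨t, ht, fun f => forces_imp_of_coe fun r hr hf => ?_⟩
    obtain ⟨q, hq, b, hb, h⟩ := exists_bounded_kappa hreg hκ hα (forcesEq_mono e hr) hf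
    exact ⟨q, hq, Forces.ex (ordinal b) ⟨forcesMem_ordinal_of_lt hb _, h⟩⟩

theorem exists_surjOn_Iio {κ : Cardinal.{u}} {ν : Ordinal.{u}} (hν : ν < (succ κ).ord)
    (h0 : 0 < ν) : ∃ F : Ordinal.{u} → Ordinal.{u}, (∀ γ, F γ < ν) ∧
      ∀ β < ν, ∃ γ < κ.ord, F γ = β := by
  classical
  obtain ⟨E, h1, h2⟩ := MorassCondition.exists_injOn_Iio hν
  refine ⟨fun γ => if h : ∃ β < ν, E β = γ then h.choose else 0, fun γ => ?_, fun β hβ =>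
    ⟨E β, h1 β hβ, ?_⟩⟩
  · beta_reduce
    split_ifs with h
    · exact h.choose_spec.1
    · exact h0
  · have h : ∃ β' < ν, E β' = E β := ⟨β, hβ, rfl⟩
    beta_reduce
    rw [dif_pos h]
    exact h2 _ h.choose_spec.1 _ hβ h.choose_spec.2

theorem forces_isSuccCardinal (hreg : κ.IsRegular) (hκ : ℵ₀ < κ)
    (hpow : ∀ μ : Cardinal.{u}, μ < κ → 2 ^ μ ≤ κ) :
    Forces (isSuccCardinal (ordinal (succ κ).ord) (ordinal κ.ord)) p := by
  refine ⟨forces_isCardinal_of_bounded fun s a f α hα ha hf => ⟨s, le_rfl,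
    exists_bounded_succ hreg hκ hpow hα ha hf⟩,
    forcesMem_ordinal_of_lt (Cardinal.ord_lt_ord.2 (Order.lt_succ κ)) _,
    fun n => forces_imp_imp.2 (forces_imp_of_coe fun s _ ⟨h1, h2⟩ => ?_)⟩
  obtain ⟨t, ht, ν, hν, e⟩ := exists_eq_of_mem_ordinal h1
  have hκν := lt_of_forcesMem (h2.mono (coe_le ht)) (forcesEq_refl _ _) e
  obtain ⟨F, hF1, hF2⟩ := exists_surjOn_Iio hν (pos_of_gt hκν)
  refine ⟨t, ht, fun q hq hn => ?_⟩
  replace e := forcesEq_mono e hq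
  -- A ground-model surjection from `κ` onto `ν` remains one, so no ordinal strictly between `κ` and
  -- `κ⁺` is a cardinal in the extension.
  have hf : Forces (isFun (ordinalFun (Set.Iio κ.ord) F) (ordinal κ.ord) n) q :=
    forces_isFun_ordinalFun (forcesEq_refl _ _) (forcesEq_refl _ _) e (fun γ => Set.mem_Iio)
      fun γ _ => hF1 γ
  obtain ⟨r, hr, b, hb, hc⟩ := forces_ex.1 (forces_imp.1 (forces_imp.1 (hn.2 _) q le_rfl
    (h2.mono (hq.trans (coe_le ht))) _) q le_rfl hf) q le_rfl
  obtain ⟨r', hr', β, hβ, e'⟩ := exists_of_forcesMem_ordinal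
    (forcesMem_congr_right (forcesEq_mono e hr) hb)
  obtain ⟨γ, hγ, rfl⟩ := hF2 β hβ
  exact hc (ordinal γ) r' hr' (pairMem_ordinalFun (forcesEq_refl _ _) (Set.mem_Iio.2 hγ)
    (forcesEq_refl _ _) e')

end MangroveForcing

/-- Forcing with the mangrove forcing at `κ` makes the direct limit of the conditions in the generic
filter a `κ`-mangrove in the generic extension. -/
theorem mainTheorem6 (κ : Cardinal.{u}) (hreg : κ.IsRegular) (hunc : Cardinal.aleph0 < κ)
    (hpow : ∀ μ : Cardinal.{u}, μ < κ → 2 ^ μ ≤ κ) :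
    PName.HoldsInGenericExtension
      (SetFormula.isMangrove (PName.ordinal.{u, u + 1} (P := MangroveForcing κ) κ.ord)
        (MangroveForcing.limitNodes κ) (MangroveForcing.limitRel κ)
        (MangroveForcing.limitMaps κ)) := by
  have := MorassCondition.nonempty hunc
  exact ⟨⟨MangroveForcing.forces_isUncountableRegular hreg hunc,
    PName.Forces.ex (PName.ordinal (succ κ).ord)
      ⟨MangroveForcing.forces_isSuccCardinal hreg hunc hpow, MangroveForcing.forces_nodesBounded,
        MangroveForcing.forces_leftAlignment hunc⟩,
    MangroveForcing.forces_isTreeOrder, MangroveForcing.forces_isMapFamily,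
    MangroveForcing.forces_monotonicity, MangroveForcing.forces_commutativity,
    MangroveForcing.forces_axiomM1, MangroveForcing.forces_axiomM2,
    MangroveForcing.forces_axiomM3 hunc, MangroveForcing.forces_axiomM4 hunc,
    MangroveForcing.forces_axiomM5 hunc, MangroveForcing.forces_axiomM6 hunc,
    MangroveForcing.forces_axiomM7 hunc⟩, MangroveForcing.forces_mangals_cofinal hunc⟩
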